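/- **Theorem (5-opt Optimization in time $O(n^{3.4})$).** An instance of $k$-opt Optimization consists of the complete graph $G$ on $n$ vertices with edge weights $w:E(G)\to\mathbb{N}$ and a Hamiltonian cycle $H$ of $G$, given as the sequence of its vertices in the order of a traversal. A $k$-move is a pair $(E^-,E^+)$ with $E^-\subseteq E(H)$, $E^+\subseteq E(G)$ and $|E^-|=|E^+|=k$ such that $(E(H)\setminus E^-)\cup E^+$ is the edge set of a Hamiltonian cycle of $G$; its gain is $\sum_{e\in E^-}w(e)-\sum_{e\in E^+}w(e)$. The task is to output a $k$-move of maximum gain, or to report that there is no $k$-move (which happens exactly when $n<k$). There is a deterministic algorithm that solves $5$-opt Optimization in $O(n^{3.4})$ time in the unit-cost word RAM model: there are a program $P$ (with the instructions addition, subtraction, multiplication, indirect load, indirect store and tests for positivity, each of cost $1$), a natural number $c$ and a constant $C$ such that, for every instance with $n$ vertices and every $W$ bounding all weights, $P$ halts with a correct output after at most $C\,n^{3.4}$ steps and handles only integers of absolute value at most $(n+W)^c$, that is, words of $O(\log(n+W))$ bits. The constants $c$ and $C$ depend neither on $n$ nor on the weights. -/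

import Mathlib

namespace KOpt

/-! ## The machine model: a unit-cost random access machine with bounded words

A program is a finite command over integer registers and a random access memory. Control flow is
structured. Every elementary instruction and every test costs one time unit. -/

/-- The arithmetic operations. -/
inductive Op where
  | add
  | sub
  | mul

/-- The result of an arithmetic operation. -/
def Op.eval : Op → ℤ → ℤ → ℤ
  | .add, u, v => u + v
  | .sub, u, v => u - v
  | .mul, u, v => u * v

/-- Programs. Registers are named by natural numbers (a program mentions finitely many). -/
inductive Cmd where
  /-- do nothing -/
  | skip : Cmd
  /-- `x := v` for an integer literal `v` -/
  | const (x : ℕ) (v : ℤ) : Cmd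
  /-- `x := y` -/
  | copy (x y : ℕ) : Cmd
  /-- `x := y o z` -/
  | arith (o : Op) (x y z : ℕ) : Cmd
  /-- `x := mem[y]` -/
  | load (x y : ℕ) : Cmd
  /-- `mem[x] := y` -/
  | store (x y : ℕ) : Cmd
  /-- sequential composition -/
  | seq (p q : Cmd) : Cmd
  /-- `if x > 0 then p else q` -/
  | ifPos (x : ℕ) (p q : Cmd) : Cmd
  /-- `while x > 0 do p` -/
  | whilePos (x : ℕ) (p : Cmd) : Cmd

/-- A machine state: the contents of the registers and of the memory cells. -/
structure State where
  reg : ℕ → ℤ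
  mem : ℕ → ℤ

/-- Write `v` to register `x`. -/
def State.setReg (s : State) (x : ℕ) (v : ℤ) : State :=
  { s with reg := Function.update s.reg x v }

/-- Write `v` to the memory cell with address `a`. -/
def State.setMem (s : State) (a : ℕ) (v : ℤ) : State :=
  { s with mem := Function.update s.mem a v }

/-- `Exec B p s s' t`: on a machine whose words hold the integers of absolute value at most `B`,
the program `p` started in state `s` halts in state `s'` after exactly `t` time units.
An instruction that creates a number which does not fit into a word, or that uses a negative
address, is an error: such a computation has no result. -/
inductive Exec (B : ℕ) : Cmd → State → State → ℕ → Prop where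
  | skip (s : State) : Exec B .skip s s 1
  | const (s : State) (x : ℕ) (v : ℤ) (hv : |v| ≤ (B : ℤ)) :
      Exec B (.const x v) s (s.setReg x v) 1
  | copy (s : State) (x y : ℕ) : Exec B (.copy x y) s (s.setReg x (s.reg y)) 1
  | arith (s : State) (o : Op) (x y z : ℕ) (hv : |o.eval (s.reg y) (s.reg z)| ≤ (B : ℤ)) :
      Exec B (.arith o x y z) s (s.setReg x (o.eval (s.reg y) (s.reg z))) 1
  | load (s : State) (x y : ℕ) (ha : 0 ≤ s.reg y) :
      Exec B (.load x y) s (s.setReg x (s.mem (s.reg y).toNat)) 1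
  | store (s : State) (x y : ℕ) (ha : 0 ≤ s.reg x) :
      Exec B (.store x y) s (s.setMem (s.reg x).toNat (s.reg y)) 1
  | seq {p q : Cmd} {s s' s'' : State} {t t' : ℕ} (hp : Exec B p s s' t)
      (hq : Exec B q s' s'' t') : Exec B (.seq p q) s s'' (t + t')
  | ifTrue {x : ℕ} {p q : Cmd} {s s' : State} {t : ℕ} (hx : 0 < s.reg x)
      (hp : Exec B p s s' t) : Exec B (.ifPos x p q) s s' (t + 1)
  | ifFalse {x : ℕ} {p q : Cmd} {s s' : State} {t : ℕ} (hx : s.reg x ≤ 0)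
      (hq : Exec B q s s' t) : Exec B (.ifPos x p q) s s' (t + 1)
  | whileDone {x : ℕ} {p : Cmd} {s : State} (hx : s.reg x ≤ 0) :
      Exec B (.whilePos x p) s s 1
  | whileStep {x : ℕ} {p : Cmd} {s s' s'' : State} {t t' : ℕ} (hx : 0 < s.reg x)
      (hp : Exec B p s s' t) (hw : Exec B (.whilePos x p) s' s'' t') :
      Exec B (.whilePos x p) s s'' (t + t' + 1)

/-! ## Moves -/

/-- `F` is the edge set of a Hamiltonian cycle of the complete graph on `V`. -/
def IsTourEdgeSet {V : Type*} [DecidableEq V] (F : Finset (Sym2 V)) : Prop :=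
  ∃ (a : V) (p : (⊤ : SimpleGraph V).Walk a a), p.IsHamiltonianCycle ∧ p.edges.toFinset = F

/-- `(Em, Ep)` is a `k`-move for the tour with edge set `EH`: remove the `k` edges in `Em` from the
tour and add the `k` edges in `Ep` of the complete graph, so that the result is a tour. -/
structure IsKMove {V : Type*} [DecidableEq V] (k : ℕ) (EH Em Ep : Finset (Sym2 V)) : Prop where
  removed_subset : Em ⊆ EH
  added_edges : ∀ e ∈ Ep, e ∈ (⊤ : SimpleGraph V).edgeSet
  card_removed : Em.card = k
  card_added : Ep.card = k
  tour : IsTourEdgeSet ((EH \ Em) ∪ Ep)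

/-- The gain of a move: the weight removed minus the weight added. -/
def gain {V : Type*} (w : Sym2 V → ℕ) (Em Ep : Finset (Sym2 V)) : ℤ :=
  ∑ e ∈ Em, (w e : ℤ) - ∑ e ∈ Ep, (w e : ℤ)

/-- `(Em, Ep)` is a `k`-move of maximum gain. -/
def IsOptimalKMove {V : Type*} [DecidableEq V] (k : ℕ) (w : Sym2 V → ℕ)
    (EH Em Ep : Finset (Sym2 V)) : Prop :=
  IsKMove k EH Em Ep ∧ ∀ Em' Ep', IsKMove k EH Em' Ep' → gain w Em' Ep' ≤ gain w Em Ep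

/-! ## Input and output -/

/-- The initial memory: cell `0` holds `n`, cells `1, …, n` hold the vertices in the order in
which the tour visits them, and the next `n * n` cells hold the weight matrix row by row.
All other cells hold `0`. -/
def inputMem {n : ℕ} (w : Sym2 (Fin n) → ℕ) {a : Fin n} (H : (⊤ : SimpleGraph (Fin n)).Walk a a)
    (i : ℕ) : ℤ :=
  if i = 0 then (n : ℤ)
  else if i ≤ n then ((H.getVert (i - 1) : ℕ) : ℤ)
  else if h : i - (n + 1) < n * n then
    (w s((⟨i - (n + 1), h⟩ : Fin (n * n)).divNat, (⟨i - (n + 1), h⟩ : Fin (n * n)).modNat) : ℤ)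
  else 0

/-- The initial state: all registers hold `0` and the memory holds the input. -/
def inputState {n : ℕ} (w : Sym2 (Fin n) → ℕ) {a : Fin n}
    (H : (⊤ : SimpleGraph (Fin n)).Walk a a) : State :=
  { reg := fun _ => 0, mem := inputMem w H }

/-- The memory `m` shows the pair `(Em, Ep)` of sets of edges: cell `0` holds `1`, and for each
`j < k` the four cells from `4 * j + 1` on hold the endpoints of the `j`-th edge of `Em` and the
endpoints of the `j`-th edge of `Ep`. -/
def ShowsMove (k : ℕ) {n : ℕ} (m : ℕ → ℤ) (Em Ep : Finset (Sym2 (Fin n))) : Prop :=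
  m 0 = 1 ∧ ∃ u v x y : Fin k → Fin n,
    (∀ j : Fin k, m (4 * (j : ℕ) + 1) = ((u j : ℕ) : ℤ) ∧ m (4 * (j : ℕ) + 2) = ((v j : ℕ) : ℤ) ∧
      m (4 * (j : ℕ) + 3) = ((x j : ℕ) : ℤ) ∧ m (4 * (j : ℕ) + 4) = ((y j : ℕ) : ℤ)) ∧
    Em = Finset.univ.image (fun j => s(u j, v j)) ∧
    Ep = Finset.univ.image (fun j => s(x j, y j))

/-- The final memory `m` answers the instance: it shows a `k`-move of maximum gain, or cell `0`
holds `0` and there is no `k`-move at all. -/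
def IsAnswer (k : ℕ) {n : ℕ} (w : Sym2 (Fin n) → ℕ) (EH : Finset (Sym2 (Fin n)))
    (m : ℕ → ℤ) : Prop :=
  (∃ Em Ep, ShowsMove k m Em Ep ∧ IsOptimalKMove k w EH Em Ep) ∨
  (m 0 = 0 ∧ ¬ ∃ Em Ep, IsKMove k EH Em Ep)

/-- The program `P` solves `k`-opt Optimization in time `T n`, where `n` is the number of vertices,
on every machine with words for the integers of absolute value at most `(n + W) ^ c`, where `W`
bounds the edge weights (that is, with words of `O(log (n + W))` bits). -/
def SolvesKOptOptimization (k : ℕ) (P : Cmd) (c : ℕ) (T : ℕ → ℝ) : Prop :=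
  ∀ (n W : ℕ) (w : Sym2 (Fin n) → ℕ) (a : Fin n) (H : (⊤ : SimpleGraph (Fin n)).Walk a a),
    H.IsHamiltonianCycle → (∀ e, w e ≤ W) →
    ∃ (s : State) (t : ℕ), Exec ((n + W) ^ c) P (inputState w H) s t ∧ (t : ℝ) ≤ T n ∧
      IsAnswer k w H.edges.toFinset s.mem

/-- `k`-opt Optimization can be solved in time `O(f n)` by a single program. Inputs have at least
three vertices, so the constant is claimed for all of them. -/
def KOptOptimizationInTime (k : ℕ) (f : ℕ → ℝ) : Prop :=
  ∃ (P : Cmd) (c : ℕ) (C : ℝ), SolvesKOptOptimization k P c (fun n => C * f n)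

end KOpt

/-! A 5-move is given by five positions on the tour, where it is cut, and a pattern: the order and
the orientations in which the five segments are put together again. `isKMove_of_pattern` shows that
every such choice is a move. Conversely, `exists_positions` and `IsKMove.exists_pattern` show that
every move arises in this way, because the pieces of the new tour between added edges and the
segments of the old tour between removed edges are the components of the same graph. The number of
patterns is constant, so it suffices to maximize `gainAt` over the positions, one pattern at a time.

For a fixed pattern, let two positions interact if an added edge joins ends of their removed edges
or if they are consecutive in the order of the positions. At most 5 + 4 of the 10 pairs interact, so
some pair does not (`Pattern.exists_plan`). Once the other three positions are fixed, the two
positions of that pair can be optimized independently (`Plan.Fits.exchange`).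

Each of these two optima must be available in constant time. A position b carries only two ends of
added edges, so added edges join it to at most two other positions. Hence there are positions p and
q such that the dependence of the gain on b involves only p and q, and such that one of the two
bounds for b is either determined by p and q or an end of the range (`Pattern.exists_role`). The
best b is therefore a function of p, q and the other bound. For fixed p and q, a sweep of that other
bound produces all entries as running maxima. Two tables of cubic size are thus filled in cubic
time, and a loop over the three remaining positions combines them. The total is O(n^3), which is
within n^3.4.

The rest verifies a program that does this. `WP` is a weakest-precondition calculus that also tracks
the number of steps; the loops are handled by invariants. With N = n + 3, the weights between
positions occupy the cells from N^2 to 2N^2, and the two tables the blocks from N^3 to 2N^3 and from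
2N^3 to 3N^3. The gains that are compared are at most 5W in absolute value, so words for (n + W)^10
suffice (`word_bound`). -/

namespace KOpt

/-! ## Edges of paths and cycles given by lists of vertices -/

section Lists

variable {V : Type*}

/-- The edges between consecutive members of a list. -/
def pathEdges : List V → List (Sym2 V)
  | [] => []
  | [_] => []
  | a :: b :: l => s(a, b) :: pathEdges (b :: l)

/-- The edges of the cycle that visits the members of a list in order. -/
def cycleEdges : List V → List (Sym2 V)
  | [] => []
  | a :: l => pathEdges (a :: l ++ [a])

theorem pathEdges_append : ∀ (l m : List V) (hl : l ≠ []) (hm : m ≠ []),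
    pathEdges (l ++ m) = pathEdges l ++ s(l.getLast hl, m.head hm) :: pathEdges m
  | [a], b :: m, _, _ => by simp [pathEdges]
  | a :: b :: l, m, _, hm => by
    have := pathEdges_append (b :: l) m (by simp) hm
    simp only [List.cons_append, pathEdges] at this ⊢
    rw [this]
    simp

theorem cycleEdges_eq (l : List V) (hl : l ≠ []) :
    cycleEdges l = pathEdges l ++ [s(l.getLast hl, l.head hl)] := by
  cases l with
  | nil => simp at hl
  | cons a l =>
    rw [cycleEdges, pathEdges_append _ _ (by simp) (by simp)]
    simp [pathEdges]

theorem mem_of_mem_pathEdges {v : V} {e : Sym2 V} : ∀ {l : List V}, e ∈ pathEdges l → v ∈ e → v ∈ l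
  | a :: b :: l, he, hv => by
    simp only [pathEdges, List.mem_cons] at he
    rcases he with rfl | he
    · rcases Sym2.mem_iff.1 hv with rfl | rfl <;> simp
    · exact List.mem_cons_of_mem _ (mem_of_mem_pathEdges he hv)
  | [], he, _ => by simp [pathEdges] at he
  | [_], he, _ => by simp [pathEdges] at he

theorem mem_pathEdges_reverse {e : Sym2 V} : ∀ {l : List V}, e ∈ pathEdges l.reverse ↔ e ∈ pathEdges l
  | [] => by simp
  | [_] => by simp
  | a :: b :: l => by
    have := mem_pathEdges_reverse (e := e) (l := b :: l)
    rw [List.reverse_cons, pathEdges_append _ _ (by simp) (by simp), List.mem_append, this]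
    simp [pathEdges, Sym2.eq_swap, or_comm]

theorem mem_cycleEdges_append_comm {e : Sym2 V} (l m : List V) :
    e ∈ cycleEdges (l ++ m) ↔ e ∈ cycleEdges (m ++ l) := by
  rcases eq_or_ne l [] with rfl | hl
  · simp
  rcases eq_or_ne m [] with rfl | hm
  · simp
  rw [cycleEdges_eq _ (by simp [hl]), cycleEdges_eq _ (by simp [hl]), pathEdges_append _ _ hl hm,
    pathEdges_append _ _ hm hl]
  simp only [List.mem_append, List.mem_cons, List.not_mem_nil, or_false, List.getLast_append_of_ne_nil _ hl,
    List.getLast_append_of_ne_nil _ hm, List.head_append_of_ne_nil hl, List.head_append_of_ne_nil hm]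
  tauto

theorem edges_eq_pathEdges {G : SimpleGraph V} : ∀ {u v : V} (p : G.Walk u v), p.edges = pathEdges p.support
  | _, _, .nil => rfl
  | _, _, .cons h .nil => by simp [pathEdges]
  | _, _, .cons h (.cons h' p) => by
    have := edges_eq_pathEdges (SimpleGraph.Walk.cons h' p)
    rw [SimpleGraph.Walk.edges_cons, this]
    simp [pathEdges]

theorem exists_walk_of_list {G : SimpleGraph V} {l : List V} (hne : l ≠ []) (hl : l.IsChain G.Adj)
    {u v : V} (hu : l.head hne = u) (hv : l.getLast hne = v) : ∃ q : G.Walk u v, q.support = l := by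
  subst hu hv
  exact ⟨_, SimpleGraph.Walk.support_ofSupport hne hl⟩

/-- The first edge `s(a, b)` is put in front of the path that runs from `b` through the remaining
vertices to `a`. That path leaves `b` for a third vertex, so it does not use `s(a, b)` again; this
is where length three is needed. -/
theorem exists_cycle_of_list [DecidableEq V] {l : List V} (hl : l.Nodup) (h3 : 3 ≤ l.length) :
    ∃ (a : V) (p : (⊤ : SimpleGraph V).Walk a a), p.IsCycle ∧ p.edges = cycleEdges l ∧
      p.support.tail.Perm l := by
  match l, h3 with
  | a :: b :: c :: t, _ =>
    have hnd := hl
    simp only [List.nodup_cons, List.mem_cons, not_or] at hnd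
    obtain ⟨⟨hab, hac, hat⟩, ⟨hbc, hbt⟩, hct, ht⟩ := hnd
    have hnd' : (b :: c :: t ++ [a]).Nodup := by
      have : (b :: c :: t ++ [a]).Perm (a :: b :: c :: t) := by
        simpa using (List.perm_append_singleton a (b :: c :: t))
      exact this.nodup_iff.2 hl
    have hchain : (b :: c :: t ++ [a]).IsChain (⊤ : SimpleGraph V).Adj := by
      refine List.Pairwise.isChain (hnd'.imp ?_)
      intro x y h
      simpa using h
    obtain ⟨q, hq⟩ := exists_walk_of_list (by simp) hchain (u := b) (v := a) (by simp) (by simp)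
    have hadj : (⊤ : SimpleGraph V).Adj a b := by simpa using hab
    refine ⟨a, .cons hadj q, ?_, ?_, ?_⟩
    · rw [SimpleGraph.Walk.cons_isCycle_iff]
      refine ⟨SimpleGraph.Walk.IsPath.mk' (by rw [hq]; exact hnd'), ?_⟩
      rw [edges_eq_pathEdges, hq]
      simp only [List.cons_append, pathEdges, List.mem_cons, not_or]
      constructor
      · intro h
        rcases Sym2.eq_iff.1 h with ⟨h1, _⟩ | ⟨h1, _⟩
        · exact hab h1
        · exact hac h1
      · intro h
        have := mem_of_mem_pathEdges h (Sym2.mem_mk_right a b)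
        simp only [List.mem_cons, List.mem_append, List.not_mem_nil, or_false] at this
        rcases this with h | h | h
        · exact hbc h
        · exact hbt h
        · exact hab h.symm
    · rw [edges_eq_pathEdges, SimpleGraph.Walk.support_cons, hq]
      rfl
    · rw [SimpleGraph.Walk.support_cons, hq]
      simpa using (List.perm_append_singleton a (b :: c :: t))

theorem nodup_cycleEdges [DecidableEq V] {l : List V} (hl : l.Nodup) (h3 : 3 ≤ l.length) :
    (cycleEdges l).Nodup := by
  obtain ⟨a, p, hp, he, -⟩ := exists_cycle_of_list hl h3
  rw [← he]
  exact hp.edges_nodup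

theorem not_isDiag_of_mem_cycleEdges [DecidableEq V] {l : List V} (hl : l.Nodup) (h3 : 3 ≤ l.length)
    {e : Sym2 V} (he : e ∈ cycleEdges l) : e ∈ (⊤ : SimpleGraph V).edgeSet := by
  obtain ⟨a, p, hp, he', -⟩ := exists_cycle_of_list hl h3
  rw [← he'] at he
  exact p.edges_subset_edgeSet he

/-- Together with `IsTourEdgeSet.exists_list` this replaces Hamiltonian walks by duplicate-free
lists of all vertices, which can be cut, rotated and reversed freely. -/
theorem isTourEdgeSet_of_list [DecidableEq V] {l : List V} (hl : l.Nodup) (h3 : 3 ≤ l.length)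
    (hall : ∀ v, v ∈ l) {F : Finset (Sym2 V)} (hF : ∀ e, e ∈ F ↔ e ∈ cycleEdges l) :
    IsTourEdgeSet F := by
  obtain ⟨a, p, hp, he, hs⟩ := exists_cycle_of_list hl h3
  refine ⟨a, p, ?_, ?_⟩
  · rw [SimpleGraph.Walk.isHamiltonianCycle_iff_isCycle_and_support_count_tail_eq_one]
    refine ⟨hp, fun v => ?_⟩
    rw [hs.count_eq]
    exact List.count_eq_one_of_mem hl (hall v)
  · ext e
    rw [hF, List.mem_toFinset, he]

theorem IsTourEdgeSet.exists_list [DecidableEq V] {F : Finset (Sym2 V)} (h : IsTourEdgeSet F) :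
    ∃ l : List V, l.Nodup ∧ 3 ≤ l.length ∧ (∀ v, v ∈ l) ∧ ∀ e, e ∈ F ↔ e ∈ cycleEdges l := by
  obtain ⟨a, p, hp, rfl⟩ := h
  have h3 := hp.isCycle.three_le_length
  rw [SimpleGraph.Walk.isHamiltonianCycle_iff_isCycle_and_support_count_tail_eq_one] at hp
  have hne : p.support.tail ≠ [] := by
    intro h
    have := congrArg List.length h
    rw [List.length_tail, SimpleGraph.Walk.length_support, List.length_nil] at this
    omega
  refine ⟨p.support.tail, hp.1.support_nodup, by simpa using h3, ?_, ?_⟩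
  · intro v
    rw [← List.count_pos_iff, hp.2 v]
    exact one_pos
  · intro e
    rw [List.mem_toFinset, edges_eq_pathEdges, cycleEdges_eq _ hne]
    have hsup : p.support = [a] ++ p.support.tail := by
      simp
    have hlast : p.support.tail.getLast hne = a := by
      rw [List.getLast_tail, SimpleGraph.Walk.getLast_support]
    conv_lhs => rw [hsup]
    rw [pathEdges_append [a] _ (by simp) hne, hlast]
    simp [pathEdges, or_comm]

/-- Two duplicate-free lists with the same members and the same edges agree up to reversal. -/
theorem eq_or_eq_reverse_of_pathEdges : ∀ {l m : List V}, l.Nodup → m.Nodup → (∀ v, v ∈ l ↔ v ∈ m) →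
    (∀ e, e ∈ pathEdges l ↔ e ∈ pathEdges m) → m = l ∨ m = l.reverse
  | [], m, _, _, hv, _ => by
    left
    exact List.eq_nil_iff_forall_not_mem.2 (fun v h => by simpa using (hv v).2 h)
  | [a], m, _, hm, hv, _ => by
    left
    have h1 : ([a] : List V).Perm m := (List.perm_ext_iff_of_nodup (by simp) hm).2 hv
    exact (List.perm_singleton.1 h1.symm)
  | a :: b :: t, m, hl, hm, hv, he => by
    have hnd := hl
    rw [List.nodup_cons] at hnd
    -- If both lists start with `a`, removing it leaves two lists to which induction applies. A
    -- reversed tail would end with `b`, although the edge at `a` forces `b` to come second.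
    have key : ∀ m' : List V, (a :: m').Nodup → (∀ v, v ∈ a :: b :: t ↔ v ∈ a :: m') →
        (∀ e, e ∈ pathEdges (a :: b :: t) ↔ e ∈ pathEdges (a :: m')) → m' = b :: t := by
      intro m' hm' hv' he'
      have hnd' := hm'
      rw [List.nodup_cons] at hnd'
      have hv2 : ∀ v, v ∈ b :: t ↔ v ∈ m' := by
        intro v
        have := hv' v
        rw [List.mem_cons, List.mem_cons (b := a)] at this
        by_cases hva : v = a
        · subst hva
          simp only [hnd.1, hnd'.1]
        · simpa [hva] using this
      match m', hm', hv', he', hnd', hv2 with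
      | [], _, _, _, _, hv2 => simpa using (hv2 b).1 (by simp)
      | c :: m'', hm', hv', he', hnd', hv2 =>
        have he2 : ∀ e, e ∈ pathEdges (b :: t) ↔ e ∈ pathEdges (c :: m'') := by
          intro e
          have := he' e
          simp only [pathEdges, List.mem_cons] at this
          constructor
          · intro h
            rcases this.1 (Or.inr h) with h1 | h1
            · exact absurd (mem_of_mem_pathEdges h (h1 ▸ Sym2.mem_mk_left a c)) hnd.1
            · exact h1
          · intro h
            rcases this.2 (Or.inr h) with h1 | h1
            · exact absurd (mem_of_mem_pathEdges h (h1 ▸ Sym2.mem_mk_left a b)) hnd'.1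
            · exact h1
        have hbc : b = c := by
          have := (he' s(a, b)).1 (by simp [pathEdges])
          simp only [pathEdges, List.mem_cons] at this
          rcases this with h1 | h1
          · rcases Sym2.eq_iff.1 h1 with ⟨-, h⟩ | ⟨h2, h3⟩
            · exact h
            · exact absurd (h3 ▸ by simp) hnd.1
          · exact absurd (mem_of_mem_pathEdges h1 (Sym2.mem_mk_left a b)) hnd'.1
        rcases eq_or_eq_reverse_of_pathEdges hnd.2 hnd'.2 hv2 he2 with h | h
        · exact h
        · subst hbc
          rcases eq_or_ne t [] with rfl | ht
          · simpa using h
          · exfalso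
            have h1 : (b :: m'').head? = (b :: t).reverse.head? := by rw [h]
            rw [List.head?_reverse, List.getLast?_cons, List.head?_cons] at h1
            have h2 := Option.some.inj h1
            rw [List.getLast?_eq_some_getLast ht, Option.getD_some] at h2
            have := hnd.2
            rw [List.nodup_cons] at this
            exact this.1 (h2 ▸ List.getLast_mem ht)
    have ham : a ∈ m := (hv a).1 (by simp)
    obtain ⟨m1, m2, rfl⟩ := List.append_of_mem ham
    rcases eq_or_ne m1 [] with rfl | h1
    · left
      rw [List.nil_append, key m2 hm hv he]
    rcases eq_or_ne m2 [] with rfl | h2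
    · right
      have hrev : (m1 ++ [a]) = (a :: m1.reverse).reverse := by simp
      rw [hrev, key m1.reverse]
      · have := List.nodup_reverse.2 hm
        simpa using this
      · intro v
        rw [hv v]
        simp [or_comm]
      · intro e
        rw [he e, hrev, mem_pathEdges_reverse]
    -- In the interior of `m`, `a` would have two different neighbours, but its only neighbour in
    -- the other list is `b`.
    · exfalso
      rw [pathEdges_append _ _ h1 (by simp)] at he
      obtain ⟨c, m2, rfl⟩ := List.exists_cons_of_ne_nil h2
      have e1 : s(m1.getLast h1, a) = s(a, b) := by
        have := (he s(m1.getLast h1, a)).2 (by simp)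
        simp only [pathEdges, List.mem_cons] at this
        rcases this with h | h
        · exact h
        · exact absurd (mem_of_mem_pathEdges h (Sym2.mem_mk_right _ a)) hnd.1
      have e2 : s(a, c) = s(a, b) := by
        have := (he s(a, c)).2 (by simp [pathEdges])
        simp only [pathEdges, List.mem_cons] at this
        rcases this with h | h
        · exact h
        · exact absurd (mem_of_mem_pathEdges h (Sym2.mem_mk_left a _)) hnd.1
      rw [Sym2.eq_swap] at e1
      have e3 : m1.getLast h1 = c := Sym2.congr_right.1 (e1.trans e2.symm)
      have := List.disjoint_of_nodup_append hm (List.getLast_mem h1)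
      rw [e3] at this
      exact this (by simp)

/-- Cut a list at the edges that satisfy a predicate. -/
theorem exists_cut (D : Sym2 V → Prop) [DecidablePred D] : ∀ l : List V, l ≠ [] →
    ∃ L : List (List V), L.flatten = l ∧ (∀ m ∈ L, m ≠ []) ∧ (∀ m ∈ L, ∀ e ∈ pathEdges m, ¬ D e) ∧
      L.length = (pathEdges l).countP (fun e => decide (D e)) + 1
  | [a], _ => ⟨[[a]], by simp, by simp, by simp [pathEdges], by simp [pathEdges]⟩
  | a :: b :: l, _ => by
    obtain ⟨L, h1, h2, h3, h4⟩ := exists_cut D (b :: l) (by simp)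
    match L, h1, h2, h3, h4 with
    | [], h1, _, _, _ => simp at h1
    | [] :: L, _, h2, _, _ => exact absurd rfl (h2 [] (by simp))
    | (c :: m) :: L, h1, h2, h3, h4 =>
      have hcb : c = b := by
        simp at h1
        exact h1.1
      subst hcb
      by_cases hD : D s(a, c)
      · refine ⟨[a] :: (c :: m) :: L, ?_, ?_, ?_, ?_⟩
        · rw [List.flatten_cons, h1]
          rfl
        · intro m' hm'
          rcases List.mem_cons.1 hm' with rfl | hm'
          · simp
          · exact h2 m' hm'
        · intro m' hm'
          rcases List.mem_cons.1 hm' with rfl | hm'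
          · simp [pathEdges]
          · exact h3 m' hm'
        · rw [List.length_cons, h4]
          simp [pathEdges, hD]
      · refine ⟨(a :: c :: m) :: L, ?_, ?_, ?_, ?_⟩
        · simp only [List.flatten_cons, List.cons_append] at h1 ⊢
          rw [h1]
        · intro m' hm'
          rcases List.mem_cons.1 hm' with rfl | hm'
          · simp
          · exact h2 m' (List.mem_cons_of_mem _ hm')
        · intro m' hm' e he
          rcases List.mem_cons.1 hm' with rfl | hm'
          · simp only [pathEdges, List.mem_cons] at he
            rcases he with rfl | he
            · exact hD
            · exact h3 _ (by simp) e he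
          · exact h3 m' (List.mem_cons_of_mem _ hm') e he
        · rw [List.length_cons] at h4 ⊢
          rw [h4]
          simp [pathEdges, hD]

/-- Membership in `S` propagates from neighbour to neighbour. This is how a piece of the new tour is
shown to stay inside a single segment of the old one, and vice versa. -/
theorem mem_iff_mem_of_pathEdges {S : Set V} : ∀ {l : List V},
    (∀ e ∈ pathEdges l, ∀ v ∈ e, v ∈ S → ∀ u ∈ e, u ∈ S) → ∀ a ∈ l, ∀ b ∈ l, a ∈ S → b ∈ S
  | [], _, a, ha, _, _, _ => by simp at ha
  | [c], _, a, ha, b, hb, h => by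
    simp only [List.mem_singleton] at ha hb
    rwa [hb, ← ha]
  | c :: d :: l, H, a, ha, b, hb, h => by
    have IH := mem_iff_mem_of_pathEdges (l := d :: l)
      (fun e he => H e (by simp [pathEdges, he]))
    have hcd := H s(c, d) (by simp [pathEdges])
    have hd : d ∈ S := by
      rcases List.mem_cons.1 ha with rfl | ha
      · exact hcd a (by simp) h d (by simp)
      · exact IH a ha d (by simp) h
    rcases List.mem_cons.1 hb with rfl | hb
    · exact hcd d (by simp) hd b (by simp)
    · exact IH d (by simp) b hb hd

/-- A cyclic sequence can be rotated so that a given edge closes the cycle. -/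
theorem exists_rotation [DecidableEq V] {l : List V} (hl : l.Nodup) {e : Sym2 V}
    (he : e ∈ cycleEdges l) :
    ∃ (m : List V) (hm : m ≠ []), m.Perm l ∧ (∀ f, f ∈ cycleEdges m ↔ f ∈ cycleEdges l) ∧
      e = s(m.getLast hm, m.head hm) := by
  have hsplit : ∀ l : List V, e ∈ pathEdges l → ∃ (l₁ l₂ : List V) (h₁ : l₁ ≠ []) (h₂ : l₂ ≠ []),
      l = l₁ ++ l₂ ∧ e = s(l₁.getLast h₁, l₂.head h₂) := by
    intro l
    induction l with
    | nil => intro h; simp [pathEdges] at h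
    | cons a l ih =>
      intro h
      match l, h, ih with
      | [], h, _ => simp [pathEdges] at h
      | b :: l, h, ih =>
        simp only [pathEdges, List.mem_cons] at h
        rcases h with rfl | h
        · exact ⟨[a], b :: l, by simp, by simp, rfl, rfl⟩
        · obtain ⟨l₁, l₂, h₁, h₂, h3, h4⟩ := ih h
          refine ⟨a :: l₁, l₂, by simp, h₂, by rw [h3]; rfl, ?_⟩
          rw [h4, List.getLast_cons h₁]
  have hne : l ≠ [] := by
    rintro rfl
    simp [cycleEdges] at he
  have he' := he
  rw [cycleEdges_eq l hne, List.mem_append, List.mem_singleton] at he'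
  rcases he' with he' | he'
  · obtain ⟨l₁, l₂, h₁, h₂, rfl, h4⟩ := hsplit l he'
    refine ⟨l₂ ++ l₁, by simp [h₁], List.perm_append_comm, fun f => mem_cycleEdges_append_comm _ _, ?_⟩
    rw [h4, List.getLast_append_of_ne_nil _ h₁, List.head_append_of_ne_nil h₂]
  · exact ⟨l, hne, List.Perm.refl _, fun f => Iff.rfl, he'⟩

/-- A cycle cut into five pieces has the edges inside the pieces and five links; `k + 1` wraps
around in `Fin 5`, so the last link closes the cycle. A permutation is recorded rather than equality
of members, so that absence of duplicates carries over: the links are distinct and differ from all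
inner edges. -/
theorem perm_cycleEdges_ofFn (S : Fin 5 → List V) (hS : ∀ k, S k ≠ []) :
    (cycleEdges (List.ofFn S).flatten).Perm ((List.ofFn fun k => pathEdges (S k)).flatten ++
      List.ofFn fun k => s((S k).getLast (hS k), (S (k + 1)).head (hS (k + 1)))) := by
  have e : (List.ofFn S).flatten = S 0 ++ (S 1 ++ (S 2 ++ (S 3 ++ S 4))) := by
    simp [List.ofFn_succ]
  have e1 : (List.ofFn fun k => pathEdges (S k)).flatten = pathEdges (S 0) ++ (pathEdges (S 1) ++
      (pathEdges (S 2) ++ (pathEdges (S 3) ++ pathEdges (S 4)))) := by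
    simp [List.ofFn_succ]
  have e2 : (List.ofFn fun k => s((S k).getLast (hS k), (S (k + 1)).head (hS (k + 1)))) =
      [s((S 0).getLast (hS 0), (S 1).head (hS 1)), s((S 1).getLast (hS 1), (S 2).head (hS 2)),
       s((S 2).getLast (hS 2), (S 3).head (hS 3)), s((S 3).getLast (hS 3), (S 4).head (hS 4)),
       s((S 4).getLast (hS 4), (S 0).head (hS 0))] := by
    simp [List.ofFn_succ]
  rw [e, e1, e2, cycleEdges_eq _ (by simp [hS 0])]
  rw [pathEdges_append _ _ (hS 0) (by simp [hS 1]), pathEdges_append _ _ (hS 1) (by simp [hS 2]),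
    pathEdges_append _ _ (hS 2) (by simp [hS 3]), pathEdges_append _ _ (hS 3) (hS 4)]
  simp only [List.head_append_of_ne_nil, hS, ne_eq, not_false_eq_true, List.getLast_append_of_ne_nil,
    List.append_eq_nil_iff, and_self]
  classical
  rw [List.perm_iff_count]
  intro a
  simp only [List.count_append, List.count_cons, List.count_nil]
  ring

theorem mem_cycleEdges_ofFn (S : Fin 5 → List V) (hS : ∀ k, S k ≠ []) (e : Sym2 V) :
    e ∈ cycleEdges (List.ofFn S).flatten ↔ (∃ k, e ∈ pathEdges (S k)) ∨
      ∃ k, s((S k).getLast (hS k), (S (k + 1)).head (hS (k + 1))) = e := by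
  rw [(perm_cycleEdges_ofFn S hS).mem_iff]
  simp only [List.mem_append, List.mem_flatten, List.mem_ofFn, exists_exists_eq_and]

end Lists

/-! ## Segments of a tour and signed permutations of them -/

/-- An end of a removed edge: `(i, false)` is the first and `(i, true)` the second end of the
`i`-th removed edge. -/
abbrev EndPt := Fin 5 × Bool

/-- An order of the five segments of the tour together with their orientations. -/
abbrev Pattern := Equiv.Perm (Fin 5) × (Fin 5 → Bool)

/-- The end at which the oriented segment `j` is entered. -/
def headPt (j : Fin 5) (o : Bool) : EndPt := if o then (j, true) else (j + 1, false)

/-- The end at which the oriented segment `j` is left. -/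
def lastPt (j : Fin 5) (o : Bool) : EndPt := if o then (j + 1, false) else (j, true)

/-- The edge that is added behind the `k`-th segment of the new tour. -/
def Pattern.added (p : Pattern) (k : Fin 5) : EndPt × EndPt :=
  (lastPt (p.1 k) (p.2 k), headPt (p.1 (k + 1)) (p.2 (k + 1)))

/-- The position on the tour (counted from one) of an end of a removed edge. -/
def ptPos (x : Fin 5 → ℕ) (s : EndPt) : ℕ := x s.1 + if s.2 then 1 else 0

/-- `x` lists the positions of five edges of a tour on `n` vertices in increasing order. -/
def Valid (n : ℕ) (x : Fin 5 → ℕ) : Prop := StrictMono x ∧ 0 < x 0 ∧ x 4 ≤ n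

section Segments

variable {V : Type*}

/-- `g` runs periodically through the `n` vertices. -/
structure IsCyclicEnum (g : ℕ → V) (n : ℕ) : Prop where
  three_le : 3 ≤ n
  periodic : Function.Periodic g n
  inj : ∀ i < n, ∀ j < n, g i = g j → i = j
  surj : ∀ v, ∃ i < n, g i = v

/-- The edges of the tour that is enumerated by `g`. -/
def enumEdges [DecidableEq V] (g : ℕ → V) (n : ℕ) : Finset (Sym2 V) :=
  (Finset.range n).image fun i => s(g i, g (i + 1))

/-- The removed edges at the positions `x`. -/
def removedEdges [DecidableEq V] (g : ℕ → V) (x : Fin 5 → ℕ) : Finset (Sym2 V) :=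
  Finset.univ.image fun i => s(g (x i - 1), g (x i))

/-- The edges added by a pattern at the positions `x`. -/
def addedEdges [DecidableEq V] (g : ℕ → V) (x : Fin 5 → ℕ) (p : Pattern) : Finset (Sym2 V) :=
  Finset.univ.image fun k => s(g (ptPos x (p.added k).1 - 1), g (ptPos x (p.added k).2 - 1))

/-- The position behind the end of segment `j`. -/
def segEnd (n : ℕ) (x : Fin 5 → ℕ) (j : Fin 5) : ℕ := if j = 4 then x 0 + n else x (j + 1)

/-- The `j`-th segment: the vertices between the `j`-th removed edge and the next one. -/
def seg (g : ℕ → V) (n : ℕ) (x : Fin 5 → ℕ) (j : Fin 5) : List V :=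
  (List.range' (x j) (segEnd n x j - x j)).map g

/-- The oriented segment `j`. -/
def oseg (g : ℕ → V) (n : ℕ) (x : Fin 5 → ℕ) (j : Fin 5) (o : Bool) : List V :=
  if o then seg g n x j else (seg g n x j).reverse

theorem pathEdges_map_range' (g : ℕ → V) : ∀ (m a : ℕ), pathEdges ((List.range' a (m + 1)).map g) =
    (List.range' a m).map fun i => s(g i, g (i + 1))
  | 0, a => by simp [pathEdges]
  | m + 1, a => by
    have := pathEdges_map_range' g m (a + 1)
    rw [List.range'_succ] at this ⊢
    rw [List.range'_succ, List.map_cons, List.map_cons, pathEdges, ← List.map_cons (f := g), this,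
      List.range'_succ, List.map_cons]

variable {g : ℕ → V} {n : ℕ} {x : Fin 5 → ℕ}

theorem Valid.lt_segEnd (hx : Valid n x) (j : Fin 5) : x j < segEnd n x j := by
  obtain ⟨h1, h2, h3⟩ := hx
  unfold segEnd
  split_ifs with h
  · subst h; omega
  · exact h1 (by revert h; revert j; decide)

theorem Valid.seg_ne_nil (hx : Valid n x) (j : Fin 5) : seg g n x j ≠ [] := by
  have := hx.lt_segEnd j
  simp [seg]
  omega

theorem Valid.oseg_ne_nil (hx : Valid n x) (j : Fin 5) (o : Bool) : oseg g n x j o ≠ [] := by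
  unfold oseg
  split_ifs
  · exact hx.seg_ne_nil j
  · simpa using hx.seg_ne_nil j

theorem IsCyclicEnum.eq_of_eq (hg : IsCyclicEnum g n) {a i j : ℕ} (hi : a ≤ i) (hi' : i < a + n)
    (hj : a ≤ j) (hj' : j < a + n) (h : g i = g j) : i = j := by
  have hn : 0 < n := by have := hg.three_le; omega
  rw [← hg.periodic.map_mod_nat i, ← hg.periodic.map_mod_nat j] at h
  have h2 := hg.inj _ (Nat.mod_lt _ hn) _ (Nat.mod_lt _ hn) h
  have h3 : i ≡ j [MOD n] := h2
  rcases le_total i j with h | h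
  · have := (Nat.modEq_iff_dvd' h).1 h3
    have := Nat.eq_zero_of_dvd_of_lt this (by omega)
    omega
  · have := (Nat.modEq_iff_dvd' h).1 h3.symm
    have := Nat.eq_zero_of_dvd_of_lt this (by omega)
    omega

theorem flatten_seg (hx : Valid n x) : (List.ofFn (seg g n x)).flatten =
    (List.range' (x 0) n).map g := by
  have h0 := hx.lt_segEnd 0
  have h1 := hx.lt_segEnd 1
  have h2 := hx.lt_segEnd 2
  have h3 := hx.lt_segEnd 3
  have h4 := hx.lt_segEnd 4
  simp only [segEnd] at h0 h1 h2 h3 h4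
  simp at h0 h1 h2 h3 h4
  obtain ⟨d0, e0⟩ := Nat.exists_eq_add_of_lt h0
  obtain ⟨d1, e1⟩ := Nat.exists_eq_add_of_lt h1
  obtain ⟨d2, e2⟩ := Nat.exists_eq_add_of_lt h2
  obtain ⟨d3, e3⟩ := Nat.exists_eq_add_of_lt h3
  obtain ⟨d4, e4⟩ := Nat.exists_eq_add_of_lt h4
  have k0 : segEnd n x 0 - x 0 = d0 + 1 := by simp [segEnd]; omega
  have k1 : segEnd n x 1 - x 1 = d1 + 1 := by simp [segEnd]; omega
  have k2 : segEnd n x 2 - x 2 = d2 + 1 := by simp [segEnd]; omega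
  have k3 : segEnd n x 3 - x 3 = d3 + 1 := by simp [segEnd]; omega
  have k4 : segEnd n x 4 - x 4 = d4 + 1 := by simp [segEnd]; omega
  have hn : n = (d0 + 1) + ((d1 + 1) + ((d2 + 1) + ((d3 + 1) + (d4 + 1)))) := by omega
  have : (List.ofFn (seg g n x)).flatten = seg g n x 0 ++ (seg g n x 1 ++ (seg g n x 2 ++
      (seg g n x 3 ++ seg g n x 4))) := by
    simp [List.ofFn_succ]
  rw [this]
  simp only [seg, k0, k1, k2, k3, k4, ← List.map_append]
  have cat : ∀ a b k m, b = a + k → List.range' a k ++ List.range' b m = List.range' a (k + m) := by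
    rintro a b k m rfl
    exact List.range'_append_1
  rw [cat (x 3) (x 4) _ _ (by omega), cat (x 2) (x 3) _ _ (by omega), cat (x 1) (x 2) _ _ (by omega),
    cat (x 0) (x 1) _ _ (by omega), ← hn]

theorem head_seg (j : Fin 5) (h : seg g n x j ≠ []) : (seg g n x j).head h = g (x j) := by
  simp [seg]

/-- Segment 4 runs beyond index `n` up to `x 0 + n - 1`, and periodicity takes its end back to `x 0
- 1`. The wraparound `4 + 1 = 0` thus needs no separate case in the statement. -/
theorem getLast_seg (hg : IsCyclicEnum g n) (hx : Valid n x) (j : Fin 5) (h : seg g n x j ≠ []) :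
    (seg g n x j).getLast h = g (x (j + 1) - 1) := by
  have h1 := hx.lt_segEnd j
  simp only [seg, List.getLast_map, List.getLast_range']
  by_cases hj : j = 4
  · subst hj
    have h2 := hx.2.1
    rw [show x 4 + (segEnd n x 4 - x 4) - 1 = (x 0 - 1) + n by
      rw [show segEnd n x 4 = x 0 + n by simp [segEnd]] at h1 ⊢
      omega]
    rw [hg.periodic]
    rfl
  · congr 1
    simp only [segEnd, hj, if_false] at h1 ⊢
    omega

theorem head_oseg (hg : IsCyclicEnum g n) (hx : Valid n x) (j : Fin 5) (o : Bool)
    (h : oseg g n x j o ≠ []) : (oseg g n x j o).head h = g (ptPos x (headPt j o) - 1) := by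
  cases o
  · simp only [oseg, headPt, ptPos, Bool.false_eq_true, if_false, List.head_reverse, add_zero]
    exact getLast_seg hg hx j _
  · simp only [oseg, headPt, ptPos, if_true, Nat.add_sub_cancel]
    exact head_seg j _

theorem getLast_oseg (hg : IsCyclicEnum g n) (hx : Valid n x) (j : Fin 5) (o : Bool)
    (h : oseg g n x j o ≠ []) : (oseg g n x j o).getLast h = g (ptPos x (lastPt j o) - 1) := by
  cases o
  · simp only [oseg, lastPt, ptPos, Bool.false_eq_true, if_false, List.getLast_reverse, if_true,
      Nat.add_sub_cancel]
    exact head_seg j _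
  · simp only [oseg, lastPt, ptPos, if_true, Bool.false_eq_true, if_false, add_zero]
    exact getLast_seg hg hx j _

theorem mem_oseg {v : V} (j : Fin 5) (o : Bool) : v ∈ oseg g n x j o ↔ v ∈ seg g n x j := by
  cases o <;> simp [oseg]

theorem mem_pathEdges_oseg {e : Sym2 V} (j : Fin 5) (o : Bool) :
    e ∈ pathEdges (oseg g n x j o) ↔ e ∈ pathEdges (seg g n x j) := by
  cases o <;> simp [oseg, mem_pathEdges_reverse]

theorem nodup_flatten_seg (hg : IsCyclicEnum g n) (hx : Valid n x) :
    (List.ofFn (seg g n x)).flatten.Nodup := by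
  rw [flatten_seg hx]
  refine List.Nodup.map_on ?_ List.nodup_range'
  intro i hi j hj h
  rw [List.mem_range'_1] at hi hj
  exact hg.eq_of_eq hi.1 hi.2 hj.1 hj.2 h

theorem mem_flatten_seg (hg : IsCyclicEnum g n) (hx : Valid n x) (v : V) :
    v ∈ (List.ofFn (seg g n x)).flatten := by
  rw [flatten_seg hx]
  obtain ⟨i, hi, rfl⟩ := hg.surj v
  obtain ⟨h1, h2, h3⟩ := hx
  have : x 0 < x 4 := h1 (by decide)
  by_cases h : x 0 ≤ i
  · exact List.mem_map.2 ⟨i, by rw [List.mem_range'_1]; omega, rfl⟩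
  · exact List.mem_map.2 ⟨i + n, by rw [List.mem_range'_1]; omega, hg.periodic i⟩

theorem exists_mem_seg (hg : IsCyclicEnum g n) (hx : Valid n x) (v : V) : ∃ j, v ∈ seg g n x j := by
  have := mem_flatten_seg hg hx v
  simpa only [List.mem_flatten, List.mem_ofFn, exists_exists_eq_and] using this

theorem nodup_seg (hg : IsCyclicEnum g n) (hx : Valid n x) (j : Fin 5) : (seg g n x j).Nodup :=
  (List.nodup_flatten.1 (nodup_flatten_seg hg hx)).1 _ (List.mem_ofFn.2 ⟨j, rfl⟩)

theorem disjoint_seg (hg : IsCyclicEnum g n) (hx : Valid n x) {i j : Fin 5} (hij : i ≠ j) :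
    List.Disjoint (seg g n x i) (seg g n x j) := by
  have := List.pairwise_ofFn.1 (List.nodup_flatten.1 (nodup_flatten_seg hg hx)).2
  rcases lt_or_gt_of_ne hij with h | h
  · exact this h
  · exact (this h).symm

theorem length_flatten_seg (hx : Valid n x) : (List.ofFn (seg g n x)).flatten.length = n := by
  rw [flatten_seg hx]
  simp

variable [DecidableEq V]

/-- The segments enumerate the window of length `n` that starts at `x 0`, whereas `enumEdges` uses
the window that starts at 0. The two differ by a shift by the period. -/
theorem mem_enumEdges (hg : IsCyclicEnum g n) (hx : Valid n x) (e : Sym2 V) :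
    e ∈ enumEdges g n ↔ e ∈ cycleEdges (List.ofFn (seg g n x)).flatten := by
  have hn := hg.three_le
  have hcyc : cycleEdges ((List.range' (x 0) n).map g) =
      (List.range' (x 0) n).map fun i => s(g i, g (i + 1)) := by
    rw [← pathEdges_map_range']
    obtain ⟨m, rfl⟩ : ∃ m, n = m + 1 := ⟨n - 1, by omega⟩
    have e1 : (List.range' (x 0) (m + 1)).map g = g (x 0) :: (List.range' (x 0 + 1) m).map g := by
      rw [List.range'_succ, List.map_cons]
    have e2 : (List.range' (x 0) (m + 1 + 1)).map g =
        (List.range' (x 0) (m + 1)).map g ++ [g (x 0)] := by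
      rw [List.range'_concat, List.map_append, List.map_singleton, one_mul, hg.periodic]
    rw [e2, e1]
    rfl
  rw [flatten_seg hx, hcyc]
  obtain ⟨h1, h2, h3⟩ := hx
  have h4 : x 0 < x 4 := h1 (by decide)
  have hper : ∀ i, s(g (i + n), g (i + n + 1)) = s(g i, g (i + 1)) := by
    intro i
    rw [hg.periodic i, add_right_comm, hg.periodic]
  simp only [enumEdges, Finset.mem_image, Finset.mem_range, List.mem_map, List.mem_range'_1]
  constructor
  · rintro ⟨i, hi, rfl⟩
    by_cases h : x 0 ≤ i
    · exact ⟨i, by omega, rfl⟩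
    · exact ⟨i + n, by omega, hper i⟩
  · rintro ⟨i, hi, rfl⟩
    by_cases h : i < n
    · exact ⟨i, h, rfl⟩
    · refine ⟨i - n, by omega, ?_⟩
      rw [← hper (i - n)]
      congr 3 <;> omega

theorem mem_removedEdges (hg : IsCyclicEnum g n) (hx : Valid n x) (e : Sym2 V) :
    e ∈ removedEdges g x ↔ ∃ k, s((seg g n x k).getLast (hx.seg_ne_nil k),
      (seg g n x (k + 1)).head (hx.seg_ne_nil (k + 1))) = e := by
  simp only [getLast_seg hg hx, head_seg, removedEdges, Finset.mem_image, Finset.mem_univ, true_and]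
  constructor
  · rintro ⟨i, rfl⟩
    exact ⟨i - 1, by simp⟩
  · rintro ⟨i, rfl⟩
    exact ⟨i + 1, rfl⟩

/-- The removed edges are the links between consecutive segments. An inner edge cannot also be a
link, because the edge list of a cycle on at least three vertices has no duplicates. -/
theorem mem_sdiff_removedEdges (hg : IsCyclicEnum g n) (hx : Valid n x) (e : Sym2 V) :
    e ∈ enumEdges g n \ removedEdges g x ↔ ∃ k, e ∈ pathEdges (seg g n x k) := by
  rw [Finset.mem_sdiff, mem_enumEdges hg hx, mem_removedEdges hg hx,
    mem_cycleEdges_ofFn _ (hx.seg_ne_nil)]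
  have hnd := nodup_cycleEdges (nodup_flatten_seg hg hx)
    (by rw [length_flatten_seg hx]; exact hg.three_le)
  rw [(perm_cycleEdges_ofFn _ (hx.seg_ne_nil)).nodup_iff, List.nodup_append] at hnd
  constructor
  · rintro ⟨h1 | h1, h2⟩
    · exact h1
    · exact absurd h1 h2
  · rintro ⟨k, hk⟩
    refine ⟨Or.inl ⟨k, hk⟩, ?_⟩
    rintro ⟨k', hk'⟩
    refine hnd.2.2 e ?_ e ?_ rfl
    · exact List.mem_flatten.2 ⟨_, List.mem_ofFn.2 ⟨k, rfl⟩, hk⟩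
    · exact List.mem_ofFn.2 ⟨k', hk'⟩

theorem card_image_links {S : Fin 5 → List V} (hS : ∀ k, S k ≠ [])
    (hnd : (List.ofFn S).flatten.Nodup) (h3 : 3 ≤ (List.ofFn S).flatten.length) :
    Function.Injective fun k => s((S k).getLast (hS k), (S (k + 1)).head (hS (k + 1))) := by
  have := nodup_cycleEdges hnd h3
  rw [(perm_cycleEdges_ofFn _ hS).nodup_iff, List.nodup_append] at this
  exact List.nodup_ofFn.1 this.2.1

/-- A pattern at valid positions gives a move. -/
theorem isKMove_of_pattern (hg : IsCyclicEnum g n) (hx : Valid n x) (p : Pattern) :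
    IsKMove 5 (enumEdges g n) (removedEdges g x) (addedEdges g x p) := by
  set S : Fin 5 → List V := fun k => oseg g n x (p.1 k) (p.2 k) with hSdef
  have hS : ∀ k, S k ≠ [] := fun k => hx.oseg_ne_nil _ _
  have hnd : (List.ofFn S).flatten.Nodup := by
    rw [List.nodup_flatten]
    constructor
    · intro l hl
      obtain ⟨k, rfl⟩ := List.mem_ofFn.1 hl
      simp only [hSdef, oseg]
      split_ifs
      · exact nodup_seg hg hx _
      · exact List.nodup_reverse.2 (nodup_seg hg hx _)
    · rw [List.pairwise_ofFn]
      intro i j hij v hi hj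
      simp only [hSdef, mem_oseg] at hi hj
      exact disjoint_seg hg hx (fun h => hij.ne (p.1.injective h)) hi hj
  have hall : ∀ v, v ∈ (List.ofFn S).flatten := by
    intro v
    obtain ⟨j, hj⟩ := exists_mem_seg hg hx v
    refine List.mem_flatten.2 ⟨S (p.1.symm j), List.mem_ofFn.2 ⟨_, rfl⟩, ?_⟩
    simp only [hSdef, mem_oseg, Equiv.apply_symm_apply]
    exact hj
  have hlen : 3 ≤ (List.ofFn S).flatten.length := by
    have h1 := length_flatten_seg (g := g) hx
    have h2 : (List.ofFn S).flatten.Perm (List.ofFn (seg g n x)).flatten :=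
      (List.perm_ext_iff_of_nodup hnd (nodup_flatten_seg hg hx)).2
        fun v => iff_of_true (hall v) (mem_flatten_seg hg hx v)
    rw [h2.length_eq, h1]
    exact hg.three_le
  have hadd : ∀ e, e ∈ addedEdges g x p ↔
      ∃ k, s((S k).getLast (hS k), (S (k + 1)).head (hS (k + 1))) = e := by
    intro e
    simp only [hSdef, getLast_oseg hg hx, head_oseg hg hx, addedEdges, Finset.mem_image,
      Finset.mem_univ, true_and]
    rfl
  -- The surviving edges lie inside segments, and neither reordering nor reversing the segments
  -- changes these; only the links become the added edges.
  have hunion : ∀ e, e ∈ (enumEdges g n \ removedEdges g x) ∪ addedEdges g x p ↔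
      e ∈ cycleEdges (List.ofFn S).flatten := by
    intro e
    rw [Finset.mem_union, mem_sdiff_removedEdges hg hx, mem_cycleEdges_ofFn S hS, hadd]
    refine or_congr_left ?_
    constructor
    · rintro ⟨k, hk⟩
      exact ⟨p.1.symm k, by simp only [hSdef, mem_pathEdges_oseg, Equiv.apply_symm_apply]; exact hk⟩
    · rintro ⟨k, hk⟩
      simp only [hSdef, mem_pathEdges_oseg] at hk
      exact ⟨_, hk⟩
  refine ⟨?_, ?_, ?_, ?_, ?_⟩
  · intro e he
    rw [mem_removedEdges hg hx] at he
    rw [mem_enumEdges hg hx, mem_cycleEdges_ofFn _ (hx.seg_ne_nil)]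
    exact Or.inr he
  · intro e he
    exact not_isDiag_of_mem_cycleEdges hnd hlen ((hunion e).1 (Finset.mem_union_right _ he))
  · have : removedEdges g x = Finset.univ.image fun k => s((seg g n x k).getLast (hx.seg_ne_nil k),
      (seg g n x (k + 1)).head (hx.seg_ne_nil (k + 1))) := by
      ext e
      rw [mem_removedEdges hg hx]
      simp
    rw [this, Finset.card_image_of_injective _ (card_image_links _ (nodup_flatten_seg hg hx)
      (by rw [length_flatten_seg hx]; exact hg.three_le))]
    rfl
  · have : addedEdges g x p = Finset.univ.image fun k => s((S k).getLast (hS k),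
      (S (k + 1)).head (hS (k + 1))) := by
      ext e
      rw [hadd]
      simp
    rw [this, Finset.card_image_of_injective _ (card_image_links hS hnd hlen)]
    rfl
  · exact isTourEdgeSet_of_list hnd hlen hall hunion

/-- Five edges of the tour are the edges at some valid positions. -/
theorem exists_positions (hg : IsCyclicEnum g n) {Em : Finset (Sym2 V)} (h : Em ⊆ enumEdges g n)
    (hc : Em.card = 5) : ∃ x, Valid n x ∧ Em = removedEdges g x := by
  classical
  set P := (Finset.range n).filter fun i => s(g i, g (i + 1)) ∈ Em with hP
  have himg : P.image (fun i => s(g i, g (i + 1))) = Em := by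
    ext e
    simp only [hP, Finset.mem_image, Finset.mem_filter, Finset.mem_range]
    constructor
    · rintro ⟨i, ⟨-, h⟩, rfl⟩
      exact h
    · intro he
      have := h he
      simp only [enumEdges, Finset.mem_image, Finset.mem_range] at this
      obtain ⟨i, hi, rfl⟩ := this
      exact ⟨i, ⟨hi, he⟩, rfl⟩
  have hinj : Set.InjOn (fun i => s(g i, g (i + 1))) (P : Set ℕ) := by
    intro i hi j hj hij
    have h3 := hg.three_le
    simp only [hP, Finset.coe_filter, Finset.mem_range, Set.mem_ofPred_eq] at hi hj
    have h0 : g n = g 0 := by simpa using hg.periodic 0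
    rcases Sym2.eq_iff.1 hij with ⟨h1, -⟩ | ⟨h1, h2⟩
    · exact hg.inj _ hi.1 _ hj.1 h1
    -- Equal edges with swapped ends would make each index the cyclic successor of the other, so `n`
    -- would divide 2.
    · exfalso
      have e1 : ∀ k < n, g (k + 1) = g (if k + 1 = n then 0 else k + 1) := by
        intro k hk
        split_ifs with h
        · rw [h, h0]
        · rfl
      rw [e1 j hj.1] at h1
      rw [e1 i hi.1] at h2
      have h1 := hg.inj _ hi.1 _ (by split_ifs <;> omega) h1
      have h2 := hg.inj _ (by split_ifs <;> omega) _ hj.1 h2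
      split_ifs at h1 h2 <;> omega
  have hcard : P.card = 5 := by
    rw [← hc, ← himg, Finset.card_image_of_injOn hinj]
  let f := P.orderEmbOfFin hcard
  have hf : ∀ i, f i < n := by
    intro i
    have := P.orderEmbOfFin_mem hcard i
    simp only [hP, Finset.mem_filter, Finset.mem_range] at this
    exact this.1
  -- `Valid` counts positions from one, whereas `P` consists of indices that start at zero.
  refine ⟨fun i => f i + 1, ⟨?_, ?_, ?_⟩, ?_⟩
  · intro i j hij
    have : f i < f j := f.strictMono hij
    show f i + 1 < f j + 1
    omega
  · exact Nat.succ_pos _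
  · exact hf 4
  · rw [← himg]
    ext e
    simp only [removedEdges, Finset.mem_image, Finset.mem_univ, true_and, Nat.add_sub_cancel]
    constructor
    · rintro ⟨i, hi, rfl⟩
      have : i ∈ Set.range f := by
        rw [Finset.range_orderEmbOfFin]
        exact hi
      obtain ⟨k, rfl⟩ := this
      exact ⟨k, rfl⟩
    · rintro ⟨k, rfl⟩
      exact ⟨f k, P.orderEmbOfFin_mem hcard k, rfl⟩

end Segments

/-! ### Every move comes from a signed permutation of the segments -/

section Segments

variable {V : Type*} {g : ℕ → V} {n : ℕ} {x : Fin 5 → ℕ}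

theorem length_pathEdges : ∀ l : List V, (pathEdges l).length = l.length - 1
  | [] => rfl
  | [_] => rfl
  | a :: b :: l => by
    have := length_pathEdges (b :: l)
    simp only [pathEdges, List.length_cons] at this ⊢
    omega

theorem length_cycleEdges (l : List V) : (cycleEdges l).length = l.length := by
  cases l with
  | nil => rfl
  | cons a l => simp [cycleEdges, length_pathEdges]

theorem exists_eq_ofFn {α : Type*} {L : List α} {k : ℕ} (h : L.length = k) :
    ∃ S : Fin k → α, List.ofFn S = L := by
  subst h
  exact ⟨L.get, List.ofFn_get L⟩

variable [DecidableEq V]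

/-- Cut a Hamiltonian cycle at five of its edges. -/
theorem exists_pieces {l : List V} (hnd : l.Nodup) (h3 : 3 ≤ l.length) {Ep : Finset (Sym2 V)}
    (hc : Ep.card = 5) (hsub : ∀ e ∈ Ep, e ∈ cycleEdges l) :
    ∃ (S : Fin 5 → List V) (hS : ∀ k, S k ≠ []), (List.ofFn S).flatten.Perm l ∧
      (∀ e, e ∈ cycleEdges (List.ofFn S).flatten ↔ e ∈ cycleEdges l) ∧
      (∀ k, ∀ e ∈ pathEdges (S k), e ∉ Ep) ∧
      Ep = Finset.univ.image fun k => s((S k).getLast (hS k), (S (k + 1)).head (hS (k + 1))) := by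
  obtain ⟨e0, he0⟩ : Ep.Nonempty := by
    rw [← Finset.card_pos]
    omega
  -- After the rotation an edge of `Ep` closes the cycle, so the other four cut the remaining path
  -- into exactly five pieces.
  obtain ⟨m, hm, hperm, hcyc, hclose⟩ := exists_rotation hnd (hsub e0 he0)
  obtain ⟨L, hL1, hL2, hL3, hL4⟩ := exists_cut (fun e => e ∈ Ep) m hm
  have hnd' := nodup_cycleEdges (hperm.nodup_iff.2 hnd) (by rw [hperm.length_eq]; exact h3)
  have hcount : (cycleEdges m).countP (fun e => decide (e ∈ Ep)) = 5 := by
    rw [List.countP_eq_length_filter, ← hc, ← List.toFinset_card_of_nodup (hnd'.filter _)]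
    congr 1
    ext e
    simp only [List.mem_toFinset, List.mem_filter, decide_eq_true_eq, hcyc]
    exact ⟨fun h => h.2, fun h => ⟨hsub e h, h⟩⟩
  rw [cycleEdges_eq m hm, List.countP_append, ← hclose, List.countP_singleton] at hcount
  simp only [he0, decide_true, if_true] at hcount
  obtain ⟨S, rfl⟩ := exists_eq_ofFn (show L.length = 5 by omega)
  have hS : ∀ k, S k ≠ [] := fun k => hL2 _ (List.mem_ofFn.2 ⟨k, rfl⟩)
  have hS3 : ∀ k, ∀ e ∈ pathEdges (S k), e ∉ Ep := fun k => hL3 _ (List.mem_ofFn.2 ⟨k, rfl⟩)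
  refine ⟨S, hS, by rw [hL1]; exact hperm, by rw [hL1]; exact hcyc, hS3, ?_⟩
  -- Every edge of `Ep` is a link, there are at most five links, and `Ep` has five members.
  refine Finset.eq_of_subset_of_card_le ?_ ?_
  · intro e he
    have := (hcyc e).2 (hsub e he)
    rw [← hL1, mem_cycleEdges_ofFn S hS] at this
    rcases this with ⟨k, hk⟩ | ⟨k, hk⟩
    · exact absurd he (hS3 k e hk)
    · exact Finset.mem_image.2 ⟨k, Finset.mem_univ _, hk⟩
  · rw [hc]
    exact Finset.card_image_le

/-- Every move at given positions comes from a pattern. -/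
theorem IsKMove.exists_pattern (hg : IsCyclicEnum g n) (hx : Valid n x) {Ep : Finset (Sym2 V)}
    (h : IsKMove 5 (enumEdges g n) (removedEdges g x) Ep) : ∃ p, Ep = addedEdges g x p := by
  obtain ⟨l, hnd, h3, hall, hF⟩ := h.tour.exists_list
  have hperm : l.Perm (List.ofFn (seg g n x)).flatten :=
    (List.perm_ext_iff_of_nodup hnd (nodup_flatten_seg hg hx)).2
      fun v => iff_of_true (hall v) (mem_flatten_seg hg hx v)
  have hn : l.length = n := by rw [hperm.length_eq, length_flatten_seg hx]
  have hcardF : ((enumEdges g n \ removedEdges g x) ∪ Ep).card = n := by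
    have : (enumEdges g n \ removedEdges g x) ∪ Ep = (cycleEdges l).toFinset := by
      ext e
      rw [hF, List.mem_toFinset]
    rw [this, List.toFinset_card_of_nodup (nodup_cycleEdges hnd h3), length_cycleEdges, hn]
  have hcardE : (enumEdges g n).card = n := by
    have : enumEdges g n = (cycleEdges (List.ofFn (seg g n x)).flatten).toFinset := by
      ext e
      rw [mem_enumEdges hg hx, List.mem_toFinset]
    rw [this, List.toFinset_card_of_nodup (nodup_cycleEdges (nodup_flatten_seg hg hx)
      (by rw [length_flatten_seg hx]; exact hg.three_le)), length_cycleEdges, length_flatten_seg hx]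
  -- Both tours have `n` edges, and `n = (n - 5) + 5` leaves no room for an overlap.
  have hdisj : Disjoint (enumEdges g n \ removedEdges g x) Ep := by
    rw [← Finset.card_union_eq_card_add_card, hcardF, Finset.card_sdiff_of_subset h.removed_subset,
      hcardE, h.card_removed, h.card_added]
    have := Finset.card_le_card h.removed_subset
    rw [hcardE, h.card_removed] at this
    omega
  obtain ⟨S, hS, hSperm, hScyc, hSEp, hlinks⟩ := exists_pieces hnd h3 h.card_added
    (fun e he => (hF e).1 (Finset.mem_union_right _ he))
  have hSnd : (List.ofFn S).flatten.Nodup := hSperm.nodup_iff.2 hnd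
  have hSdisj : ∀ i j v, v ∈ S i → v ∈ S j → i = j := by
    intro i j v hi hj
    by_contra hij
    have := List.pairwise_ofFn.1 (List.nodup_flatten.1 hSnd).2
    rcases lt_or_gt_of_ne hij with h | h
    · exact this h hi hj
    · exact this h hj hi
  have hsegdisj : ∀ i j v, v ∈ seg g n x i → v ∈ seg g n x j → i = j := by
    intro i j v hi hj
    by_contra hij
    exact disjoint_seg hg hx hij hi hj
  -- Both sides describe the edges that survive the removal: on the left as the new tour without its
  -- links `Ep`, on the right as the old tour without the removed edges.
  have hcore : ∀ e, (∃ k, e ∈ pathEdges (S k)) ↔ ∃ k, e ∈ pathEdges (seg g n x k) := by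
    intro e
    rw [← mem_sdiff_removedEdges hg hx]
    constructor
    · rintro ⟨k, hk⟩
      have h1 := (hF e).2 ((hScyc e).1 ((mem_cycleEdges_ofFn S hS e).2 (Or.inl ⟨k, hk⟩)))
      rcases Finset.mem_union.1 h1 with h1 | h1
      · exact h1
      · exact absurd h1 (hSEp k e hk)
    · intro he
      have h1 := (hScyc e).2 ((hF e).1 (Finset.mem_union_left _ he))
      rcases (mem_cycleEdges_ofFn S hS e).1 h1 with h1 | ⟨k, hk⟩
      · exact h1
      · refine absurd ?_ (Finset.disjoint_left.1 hdisj he)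
        rw [hlinks]
        exact Finset.mem_image.2 ⟨k, Finset.mem_univ _, hk⟩
  -- Pieces and segments are disjoint paths with the same total edge set. A piece and a segment that
  -- share a vertex therefore have the same vertices and the same edges, so they agree up to
  -- reversal.
  have hmatch : ∀ k, ∃ j o, S k = oseg g n x j o := by
    intro k
    have hv := List.head_mem (hS k)
    set v := (S k).head (hS k)
    obtain ⟨j, hj⟩ := exists_mem_seg hg hx v
    have h1 : ∀ u ∈ S k, u ∈ seg g n x j := by
      intro u hu
      refine mem_iff_mem_of_pathEdges (S := {v | v ∈ seg g n x j}) ?_ v hv u hu hj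
      intro e he a ha haj b hb
      obtain ⟨j', hj'⟩ := (hcore e).1 ⟨k, he⟩
      have := hsegdisj j j' a haj (mem_of_mem_pathEdges hj' ha)
      subst this
      exact mem_of_mem_pathEdges hj' hb
    have h2 : ∀ u ∈ seg g n x j, u ∈ S k := by
      intro u hu
      refine mem_iff_mem_of_pathEdges (S := {v | v ∈ S k}) ?_ v hj u hu hv
      intro e he a ha haj b hb
      obtain ⟨k', hk'⟩ := (hcore e).2 ⟨j, he⟩
      have := hSdisj k k' a haj (mem_of_mem_pathEdges hk' ha)
      subst this
      exact mem_of_mem_pathEdges hk' hb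
    have h3 : S k = seg g n x j ∨ S k = (seg g n x j).reverse := by
      refine eq_or_eq_reverse_of_pathEdges (nodup_seg hg hx j)
        ((List.nodup_flatten.1 hSnd).1 _ (List.mem_ofFn.2 ⟨k, rfl⟩)) (fun u => ⟨h2 u, h1 u⟩) ?_
      intro e
      induction e using Sym2.ind with
      | _ a b =>
        constructor
        · intro he
          obtain ⟨k', hk'⟩ := (hcore _).2 ⟨j, he⟩
          have := hSdisj k k' a (h2 a (mem_of_mem_pathEdges he (Sym2.mem_mk_left a b)))
            (mem_of_mem_pathEdges hk' (Sym2.mem_mk_left a b))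
          subst this
          exact hk'
        · intro he
          obtain ⟨j', hj'⟩ := (hcore _).1 ⟨k, he⟩
          have := hsegdisj j j' a (h1 a (mem_of_mem_pathEdges he (Sym2.mem_mk_left a b)))
            (mem_of_mem_pathEdges hj' (Sym2.mem_mk_left a b))
          subst this
          exact hj'
    rcases h3 with h3 | h3
    · exact ⟨j, true, by simpa [oseg] using h3⟩
    · exact ⟨j, false, by simpa [oseg] using h3⟩
  choose π o hπ using hmatch
  have hinj : Function.Injective π := by
    intro i j hij
    obtain ⟨v, hv⟩ := List.exists_mem_of_ne_nil _ (hS i)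
    refine hSdisj i j v hv ?_
    rw [hπ, mem_oseg] at hv ⊢
    rwa [← hij]
  refine ⟨(Equiv.ofBijective π (Finite.injective_iff_bijective.1 hinj), o), ?_⟩
  have hS' : S = fun k => oseg g n x (π k) (o k) := funext hπ
  subst hS'
  rw [hlinks]
  simp only [getLast_oseg hg hx, head_oseg hg hx]
  rfl

end Segments

/-! ## The gain as a function of positions, and the exchange argument -/

/-- The gain at the positions `x`, where `f u v` is the weight between positions and `A` lists the
added edges. -/
def gainAt (f : ℕ → ℕ → ℕ) (A : Fin 5 → EndPt × EndPt) (x : Fin 5 → ℕ) : ℤ :=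
  ∑ i, (f (x i) (x i + 1) : ℤ) - ∑ k, (f (ptPos x (A k).1) (ptPos x (A k).2) : ℤ)

/-- The gain sums over sets of edges, `gainAt` over indices. The two agree because both images have
five members, so no index repeats an edge. -/
theorem gain_eq_gainAt {V : Type*} [DecidableEq V] {g : ℕ → V} {n : ℕ} {x : Fin 5 → ℕ}
    (hg : IsCyclicEnum g n) (hx : Valid n x) (p : Pattern) (w : Sym2 V → ℕ) :
    gain w (removedEdges g x) (addedEdges g x p) =
      gainAt (fun u v => w s(g (u - 1), g (v - 1))) p.added x := by
  have h := isKMove_of_pattern hg hx p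
  have h1 := Finset.injOn_of_card_image_eq (s := Finset.univ)
    (f := fun i => s(g (x i - 1), g (x i))) (by rw [Finset.card_univ]; exact h.card_removed)
  have h2 := Finset.injOn_of_card_image_eq (s := Finset.univ)
    (f := fun k => s(g (ptPos x (p.added k).1 - 1), g (ptPos x (p.added k).2 - 1)))
    (by rw [Finset.card_univ]; exact h.card_added)
  rw [gain, removedEdges, addedEdges, Finset.sum_image h1, Finset.sum_image h2]
  rfl

/-- The lower bound for the `i`-th position. -/
def prevVal (x : Fin 5 → ℕ) (i : Fin 5) : ℕ := if i = 0 then 0 else x (i - 1)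

/-- The upper bound for the `i`-th position. -/
def nextVal (n : ℕ) (x : Fin 5 → ℕ) (i : Fin 5) : ℕ := if i = 4 then n + 1 else x (i + 1)

theorem Fin5.sub_one_ne : ∀ i : Fin 5, i - 1 ≠ i := by decide

theorem Fin5.add_one_ne : ∀ i : Fin 5, i + 1 ≠ i := by decide

theorem Fin5.sub_one_ne_four : ∀ i : Fin 5, i ≠ 0 → i - 1 ≠ 4 := by decide

theorem Fin5.add_one_ne_zero : ∀ i : Fin 5, i ≠ 4 → i + 1 ≠ 0 := by decide

theorem Fin5.add_one_ne_sub_one : ∀ i : Fin 5, i + 1 ≠ i - 1 := by decide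

theorem Fin5.castSucc_add_one : ∀ i : Fin 4, i.castSucc ≠ (4 : Fin 5) ∧ i.castSucc + 1 = i.succ := by
  decide

/-- With 0 and `n + 1` as sentinels, validity becomes a local condition at each position. This is
what makes it possible to move a single position, and it is also the test that the program performs.
-/
theorem valid_iff {n : ℕ} {x : Fin 5 → ℕ} :
    Valid n x ↔ ∀ i, prevVal x i < x i ∧ x i < nextVal n x i := by
  constructor
  · rintro ⟨h1, h2, h3⟩ i
    constructor
    · unfold prevVal
      split_ifs with h
      · rw [h]; exact h2
      · exact h1 (by revert h; revert i; decide)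
    · unfold nextVal
      split_ifs with h
      · rw [h]; omega
      · exact h1 (by revert h; revert i; decide)
  · intro h
    refine ⟨Fin.strictMono_iff_lt_succ.2 ?_, (h 0).1, ?_⟩
    · intro i
      have := (h i.castSucc).2
      have h4 := (Fin5.castSucc_add_one i).1
      rw [nextVal, if_neg h4] at this
      have h5 := (Fin5.castSucc_add_one i).2
      rwa [h5] at this
    · have := (h 4).2
      rw [nextVal, if_pos rfl] at this
      omega

/-- How to optimize one position `b`: it interacts with the positions `p` and `q` only, and one of
its bounds is determined by these. The other bound is the upper one if `fwd` holds. -/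
structure Role where
  b : Fin 5
  p : Fin 5
  q : Fin 5
  fwd : Bool

/-- The bound for position `b` at which the sweep starts. -/
def Role.startVal (r : Role) (n : ℕ) (x : Fin 5 → ℕ) : ℕ :=
  if r.fwd then prevVal x r.b else nextVal n x r.b

/-- The bound for position `b` at which the sweep stops. -/
def Role.stopVal (r : Role) (n : ℕ) (x : Fin 5 → ℕ) : ℕ :=
  if r.fwd then nextVal n x r.b else prevVal x r.b

/-- The role fits to the added edges. -/
structure Role.Fits (r : Role) (A : Fin 5 → EndPt × EndPt) : Prop where
  b_ne_p : r.b ≠ r.p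
  b_ne_q : r.b ≠ r.q
  p_ne_q : r.p ≠ r.q
  fst : ∀ k, (A k).1.1 = r.b → (A k).2.1 = r.b ∨ (A k).2.1 = r.p ∨ (A k).2.1 = r.q
  snd : ∀ k, (A k).2.1 = r.b → (A k).1.1 = r.b ∨ (A k).1.1 = r.p ∨ (A k).1.1 = r.q
  prev : r.fwd = true → r.b ≠ 0 → r.b - 1 = r.p ∨ r.b - 1 = r.q
  next : r.fwd = false → r.b ≠ 4 → r.b + 1 = r.p ∨ r.b + 1 = r.q

theorem Role.Fits.startVal_congr {r : Role} {A : Fin 5 → EndPt × EndPt} (hr : r.Fits A) {n : ℕ}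
    {x y : Fin 5 → ℕ} (hp : x r.p = y r.p) (hq : x r.q = y r.q) : r.startVal n x = r.startVal n y := by
  unfold startVal prevVal nextVal
  split_ifs with h1 h2 h2
  · rfl
  · rcases hr.prev h1 h2 with h | h <;> rw [h] <;> assumption
  · rfl
  · rcases hr.next (by simpa using h1) h2 with h | h <;> rw [h] <;> assumption

/-- Only terms that involve position `r.b` change, and their other ends belong to `r.b`, `r.p` or
`r.q`. The gain itself depends on all positions; only its differences along `r.b` do not, and
comparing candidates needs no more. -/
theorem Role.Fits.gainAt_sub_congr {r : Role} {A : Fin 5 → EndPt × EndPt} (hr : r.Fits A)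
    (f : ℕ → ℕ → ℕ) {x y : Fin 5 → ℕ} (hp : x r.p = y r.p) (hq : x r.q = y r.q) (a c : ℕ) :
    gainAt f A (Function.update x r.b a) - gainAt f A (Function.update x r.b c) =
      gainAt f A (Function.update y r.b a) - gainAt f A (Function.update y r.b c) := by
  have e1 : ∀ u : ℕ, ∀ i, (i = r.b ∨ i = r.p ∨ i = r.q) →
      Function.update x r.b u i = Function.update y r.b u i := by
    rintro u i (rfl | rfl | rfl)
    · simp
    · simp [hr.b_ne_p.symm, hp]
    · simp [hr.b_ne_q.symm, hq]
  have e2 : ∀ (z : Fin 5 → ℕ) (i), i ≠ r.b → Function.update z r.b a i = Function.update z r.b c i := by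
    intro z i hi
    simp [hi]
  have hrem : ∀ i, (f (Function.update x r.b a i) (Function.update x r.b a i + 1) : ℤ) -
      f (Function.update x r.b c i) (Function.update x r.b c i + 1) =
      f (Function.update y r.b a i) (Function.update y r.b a i + 1) -
      f (Function.update y r.b c i) (Function.update y r.b c i + 1) := by
    intro i
    by_cases hi : i = r.b
    · rw [e1 a i (Or.inl hi), e1 c i (Or.inl hi)]
    · rw [e2 x i hi, e2 y i hi, sub_self, sub_self]
  have hadd : ∀ k, (f (ptPos (Function.update x r.b a) (A k).1) (ptPos (Function.update x r.b a) (A k).2) : ℤ) -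
      f (ptPos (Function.update x r.b c) (A k).1) (ptPos (Function.update x r.b c) (A k).2) =
      f (ptPos (Function.update y r.b a) (A k).1) (ptPos (Function.update y r.b a) (A k).2) -
      f (ptPos (Function.update y r.b c) (A k).1) (ptPos (Function.update y r.b c) (A k).2) := by
    intro k
    unfold ptPos
    by_cases h1 : (A k).1.1 = r.b
    · rw [e1 a _ (Or.inl h1), e1 c _ (Or.inl h1), e1 a _ (hr.fst k h1), e1 c _ (hr.fst k h1)]
    · by_cases h2 : (A k).2.1 = r.b
      · rw [e1 a _ (Or.inl h2), e1 c _ (Or.inl h2), e1 a _ (hr.snd k h2), e1 c _ (hr.snd k h2)]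
      · rw [e2 x _ h1, e2 x _ h2, e2 y _ h1, e2 y _ h2, sub_self, sub_self]
  have s1 := Finset.sum_congr (s₁ := Finset.univ) rfl fun i _ => hrem i
  have s2 := Finset.sum_congr (s₁ := Finset.univ) rfl fun i _ => hadd i
  simp only [Finset.sum_sub_distrib] at s1 s2
  unfold gainAt
  linarith

/-- The table `T` holds an optimal position `b` for each choice of the positions `p`, `q` and the
stop bound. -/
def Role.IsTable (r : Role) (n : ℕ) (f : ℕ → ℕ → ℕ) (A : Fin 5 → EndPt × EndPt)
    (T : ℕ → ℕ → ℕ → ℕ) : Prop :=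
  ∀ x : Fin 5 → ℕ, (∀ i, x i ≤ n + 1) → ∀ c, prevVal x r.b < c → c < nextVal n x r.b →
    (prevVal x r.b < T (x r.p) (x r.q) (r.stopVal n x) ∧
      T (x r.p) (x r.q) (r.stopVal n x) < nextVal n x r.b) ∧
    gainAt f A (Function.update x r.b c) ≤
      gainAt f A (Function.update x r.b (T (x r.p) (x r.q) (r.stopVal n x)))

theorem prevVal_update_self (x : Fin 5 → ℕ) (i : Fin 5) (a : ℕ) :
    prevVal (Function.update x i a) i = prevVal x i := by
  unfold prevVal
  split_ifs with h
  · rfl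
  · rw [Function.update_of_ne (by revert i; decide)]

theorem nextVal_update_self (n : ℕ) (x : Fin 5 → ℕ) (i : Fin 5) (a : ℕ) :
    nextVal n (Function.update x i a) i = nextVal n x i := by
  unfold nextVal
  split_ifs with h
  · rfl
  · rw [Function.update_of_ne (by revert i; decide)]

theorem Valid.le {n : ℕ} {x : Fin 5 → ℕ} (hx : Valid n x) (i : Fin 5) : x i ≤ n + 1 := by
  have : x i ≤ x 4 := hx.1.monotone (by revert i; decide)
  have := hx.2.2
  omega

theorem Valid.update {n : ℕ} {x : Fin 5 → ℕ} (hx : Valid n x) {i : Fin 5} {a : ℕ}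
    (h1 : prevVal x i < a) (h2 : a < nextVal n x i) : Valid n (Function.update x i a) := by
  rw [valid_iff] at hx ⊢
  intro j
  by_cases hj : j = i
  · subst hj
    rw [prevVal_update_self, nextVal_update_self, Function.update_self]
    exact ⟨h1, h2⟩
  · rw [Function.update_of_ne hj]
    constructor
    · by_cases h : j ≠ 0 ∧ j - 1 = i
      · obtain ⟨h0, rfl⟩ := h
        rw [prevVal, if_neg h0, Function.update_self]
        rwa [nextVal, if_neg (Fin5.sub_one_ne_four j h0), sub_add_cancel] at h2
      · have := (hx j).1
        unfold prevVal at this ⊢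
        split_ifs at this ⊢ with h0
        · exact this
        · rwa [Function.update_of_ne (fun h' => h ⟨h0, h'⟩)]
    · by_cases h : j ≠ 4 ∧ j + 1 = i
      · obtain ⟨h0, rfl⟩ := h
        rw [nextVal, if_neg h0, Function.update_self]
        rwa [prevVal, if_neg (Fin5.add_one_ne_zero j h0), add_sub_cancel_right] at h1
      · have := (hx j).2
        unfold nextVal at this ⊢
        split_ifs at this ⊢ with h0
        · exact this
        · rwa [Function.update_of_ne (fun h' => h ⟨h0, h'⟩)]

/-- Two positions that do not interact, with their roles, and the other three positions. -/
structure Plan where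
  r₁ : Role
  r₂ : Role
  t₁ : Fin 5
  t₂ : Fin 5
  t₃ : Fin 5

/-- The plan fits to the added edges. -/
structure Plan.Fits (c : Plan) (A : Fin 5 → EndPt × EndPt) : Prop where
  fits₁ : c.r₁.Fits A
  fits₂ : c.r₂.Fits A
  nodup : [c.r₁.b, c.r₂.b, c.t₁, c.t₂, c.t₃].Nodup
  p₁ : c.r₁.p ≠ c.r₂.b
  q₁ : c.r₁.q ≠ c.r₂.b
  p₂ : c.r₂.p ≠ c.r₁.b
  q₂ : c.r₂.q ≠ c.r₁.b
  succ₁ : c.r₁.b ≠ 4 → c.r₁.b + 1 ≠ c.r₂.b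
  succ₂ : c.r₂.b ≠ 4 → c.r₂.b + 1 ≠ c.r₁.b

/-- Fill in the two optimized positions. -/
def Plan.complete (c : Plan) (n : ℕ) (T₁ T₂ : ℕ → ℕ → ℕ → ℕ) (x : Fin 5 → ℕ) : Fin 5 → ℕ :=
  Function.update (Function.update x c.r₁.b (T₁ (x c.r₁.p) (x c.r₁.q) (c.r₁.stopVal n x))) c.r₂.b
    (T₂ (x c.r₂.p) (x c.r₂.q) (c.r₂.stopVal n x))

/-- Moving a position that is not a neighbour affects neither bound. Positions 4 and 0 are not
neighbours here, since their outer bounds are sentinels; hence the guards `≠ 4` against the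
wraparound in `Fin 5`. -/
theorem Role.stopVal_update {r : Role} {n : ℕ} {x : Fin 5 → ℕ} {i : Fin 5} (a : ℕ)
    (h1 : r.b ≠ 4 → r.b + 1 ≠ i) (h2 : i ≠ 4 → i + 1 ≠ r.b) :
    r.stopVal n (Function.update x i a) = r.stopVal n x ∧
      prevVal (Function.update x i a) r.b = prevVal x r.b ∧
      nextVal n (Function.update x i a) r.b = nextVal n x r.b := by
  have e1 : prevVal (Function.update x i a) r.b = prevVal x r.b := by
    unfold prevVal
    split_ifs with h
    · rfl
    · rw [Function.update_of_ne]
      intro hi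
      refine h2 ?_ (by rw [← hi, sub_add_cancel])
      rw [← hi]
      exact Fin5.sub_one_ne_four _ h
  have e2 : nextVal n (Function.update x i a) r.b = nextVal n x r.b := by
    unfold nextVal
    split_ifs with h
    · rfl
    · rw [Function.update_of_ne (h1 h)]
  refine ⟨?_, e1, e2⟩
  rw [stopVal, stopVal, e1, e2]

theorem Plan.Fits.b_ne {c : Plan} {A : Fin 5 → EndPt × EndPt} (hc : c.Fits A) : c.r₁.b ≠ c.r₂.b := by
  have := hc.nodup
  simp only [List.nodup_cons, List.mem_cons, not_or] at this
  exact this.1.1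

/-- The exchange argument: replacing the two optimized positions by the table entries does not
decrease the gain. -/
theorem Plan.Fits.exchange {c : Plan} {A : Fin 5 → EndPt × EndPt} (hc : c.Fits A) {n : ℕ}
    {f : ℕ → ℕ → ℕ} {T₁ T₂ : ℕ → ℕ → ℕ → ℕ} (h₁ : c.r₁.IsTable n f A T₁) (h₂ : c.r₂.IsTable n f A T₂)
    {x : Fin 5 → ℕ} (hx : Valid n x) :
    Valid n (c.complete n T₁ T₂ x) ∧ gainAt f A x ≤ gainAt f A (c.complete n T₁ T₂ x) := by
  have hb := hc.b_ne
  obtain ⟨⟨h3, h4⟩, h5⟩ := h₁ x hx.le (x c.r₁.b) ((valid_iff.1 hx) _).1 ((valid_iff.1 hx) _).2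
  set y := Function.update x c.r₁.b (T₁ (x c.r₁.p) (x c.r₁.q) (c.r₁.stopVal n x)) with hy
  have hyv : Valid n y := hx.update h3 h4
  -- The second table is consulted after the first position has moved. Since the two positions do
  -- not interact, the lookup has the same arguments as for `x`, so both lookups can be made from
  -- the original tuple.
  obtain ⟨⟨h6, h7⟩, h8⟩ := h₂ y hyv.le (y c.r₂.b) ((valid_iff.1 hyv) _).1 ((valid_iff.1 hyv) _).2
  have e1 : y c.r₂.p = x c.r₂.p := Function.update_of_ne hc.p₂ _ _
  have e2 : y c.r₂.q = x c.r₂.q := Function.update_of_ne hc.q₂ _ _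
  have e3 : c.r₂.stopVal n y = c.r₂.stopVal n x := (Role.stopVal_update _ hc.succ₂ hc.succ₁).1
  rw [e1, e2, e3] at h6 h7 h8
  rw [Function.update_eq_self] at h5 h8
  exact ⟨hyv.update h6 h7, h5.trans h8⟩

/-! ## Every pattern has a fitting plan -/

theorem exists_rest {b d t : Fin 5} (h1 : b ≠ d) (h2 : t ≠ b) (h3 : t ≠ d) :
    ∃ p q, p ≠ b ∧ q ≠ b ∧ p ≠ d ∧ q ≠ d ∧ p ≠ q ∧ p ≠ t ∧ q ≠ t ∧
      ∀ i, i ≠ b → i ≠ d → i ≠ t → i = p ∨ i = q := by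
  revert b d t; decide

/-- The ends of the added edges. -/
def Pattern.endOf (p : Pattern) (s : Fin 5 × Bool) : EndPt :=
  if s.2 then (p.added s.1).2 else (p.added s.1).1

/-- Each segment is entered at one of its ends and left at the other, and different segments have
different ends. So every end of a removed edge is used by the added edges only once. -/
theorem Pattern.endOf_injective (p : Pattern) : Function.Injective p.endOf := by
  have h1 : ∀ j j' o o', lastPt j o = lastPt j' o' → j = j' := by decide
  have h2 : ∀ j j' o o', headPt j o = headPt j' o' → j = j' := by decide
  have h3 : ∀ j j' o o', lastPt j o = headPt j' o' → j = j' ∧ o ≠ o' := by decide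
  have key : ∀ i j, lastPt (p.1 i) (p.2 i) ≠ headPt (p.1 j) (p.2 j) := by
    intro i j h
    obtain ⟨h4, h5⟩ := h3 _ _ _ _ h
    exact h5 (by rw [p.1.injective h4])
  rintro ⟨k, a⟩ ⟨k', a'⟩ h
  cases a <;> cases a' <;> simp only [endOf, added, if_true, Bool.false_eq_true, if_false] at h
  · rw [p.1.injective (h1 _ _ _ _ h)]
  · exact absurd h (key _ _)
  · exact absurd h.symm (key _ _)
  · have := p.1.injective (h2 _ _ _ _ h)
    rw [add_right_cancel this]

/-- Position `b` has two ends, so added edges join it to at most two positions. These together with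
`b` and `d` cannot exhaust `Fin 5`, so some `t` remains that no added edge joins to `b`; the two
positions different from `b`, `d` and `t` serve as `p` and `q`. -/
theorem Pattern.exists_role (p : Pattern) {b d : Fin 5} (hbd : b ≠ d)
    (hd : ∀ k, s((p.added k).1.1, (p.added k).2.1) ≠ s(b, d))
    (h1 : b ≠ 4 → b + 1 ≠ d) (h2 : d ≠ 4 → d + 1 ≠ b) :
    ∃ r : Role, r.b = b ∧ r.Fits p.added ∧ r.p ≠ d ∧ r.q ≠ d := by
  classical
  let E : Finset (Fin 5 × Bool) := Finset.univ.filter fun s => (p.endOf s).1 = b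
  have hE : E.card ≤ 2 := by
    rw [← Finset.card_image_of_injective E p.endOf_injective]
    have : E.image p.endOf ⊆ ({b} : Finset (Fin 5)) ×ˢ (Finset.univ : Finset Bool) := by
      intro s hs
      obtain ⟨s', hs', rfl⟩ := Finset.mem_image.1 hs
      simp only [E, Finset.mem_filter, Finset.mem_univ, true_and] at hs'
      exact Finset.mem_product.2 ⟨by simp [hs'], Finset.mem_univ _⟩
    simpa using Finset.card_le_card this
  let N : Finset (Fin 5) := E.image fun s => (p.endOf (s.1, !s.2)).1
  have hN : N.card ≤ 2 := Finset.card_image_le.trans hE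
  obtain ⟨t, -, ht⟩ := Finset.exists_mem_notMem_of_card_lt_card (s := N ∪ {b, d})
    (t := (Finset.univ : Finset (Fin 5))) (by
      have := Finset.card_union_le N {b, d}
      have := Finset.card_le_two (a := b) (b := d)
      simp only [Finset.card_univ, Fintype.card_fin]
      omega)
  simp only [Finset.mem_union, Finset.mem_insert, Finset.mem_singleton, not_or] at ht
  obtain ⟨htN, htb, htd⟩ := ht
  obtain ⟨u, v, hub, hvb, hud, hvd, huv, hut, hvt, hrest⟩ := exists_rest hbd htb htd
  have hfst : ∀ k, (p.added k).1.1 = b → (p.added k).2.1 ≠ t := by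
    intro k hk hk'
    refine htN (Finset.mem_image.2 ⟨(k, false), ?_, by simpa [Pattern.endOf] using hk'⟩)
    exact Finset.mem_filter.2 ⟨Finset.mem_univ _, hk⟩
  have hsnd : ∀ k, (p.added k).2.1 = b → (p.added k).1.1 ≠ t := by
    intro k hk hk'
    refine htN (Finset.mem_image.2 ⟨(k, true), ?_, by simpa [Pattern.endOf] using hk'⟩)
    exact Finset.mem_filter.2 ⟨Finset.mem_univ _, hk⟩
  -- At most one neighbour of `b` is `t`, and none is `d`. The sweep starts from the side where the
  -- bound is not `t`, so its start is a sentinel or one of `u` and `v`.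
  refine ⟨⟨b, u, v, decide (¬ (b ≠ 0 ∧ b - 1 = t))⟩, rfl, ⟨hub.symm, hvb.symm, huv, ?_, ?_, ?_, ?_⟩, hud, hvd⟩
  · intro k hk
    by_cases hk' : (p.added k).2.1 = b
    · exact Or.inl hk'
    · refine Or.inr (hrest _ hk' ?_ (hfst k hk))
      intro h
      exact hd k (by rw [h, show (p.added k).1.1 = b from hk])
  · intro k hk
    by_cases hk' : (p.added k).1.1 = b
    · exact Or.inl hk'
    · refine Or.inr (hrest _ hk' ?_ (hsnd k hk))
      intro h
      exact hd k (by rw [h, show (p.added k).2.1 = b from hk, Sym2.eq_swap])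
  · intro hf hb0
    have hf := of_decide_eq_true hf
    refine hrest (b - 1) ?_ ?_ (fun h => hf ⟨hb0, h⟩)
    · exact Fin5.sub_one_ne b
    · intro h
      refine h2 ?_ (by rw [← h, sub_add_cancel])
      rw [← h]
      exact Fin5.sub_one_ne_four b hb0
  · intro hf hb4
    have hf := not_not.1 (of_decide_eq_false hf)
    refine hrest (b + 1) ?_ (h1 hb4) ?_
    · exact Fin5.add_one_ne b
    · rw [← hf.2]
      exact Fin5.add_one_ne_sub_one b

/-- There are ten pairs of positions. The added edges account for at most five of them and the
consecutive pairs for four, so a pair without interaction is left; each of its members then gets a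
role. -/
theorem Pattern.exists_plan (p : Pattern) : ∃ c : Plan, c.Fits p.added := by
  classical
  let E : Finset (Sym2 (Fin 5)) := Finset.univ.image fun k => s((p.added k).1.1, (p.added k).2.1)
  let O : Finset (Sym2 (Fin 5)) := Finset.univ.image fun i : Fin 4 => s(i.castSucc, i.succ)
  obtain ⟨e, he, he'⟩ := Finset.exists_mem_notMem_of_card_lt_card (s := E ∪ O)
    (t := (Finset.univ : Finset (Sym2 (Fin 5))).filter fun e => ¬ e.IsDiag) (by
      have h1 := Finset.card_union_le E O
      have h2 : E.card ≤ 5 := Finset.card_image_le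
      have h3 : O.card ≤ 4 := Finset.card_image_le
      have h4 : ((Finset.univ : Finset (Sym2 (Fin 5))).filter fun e => ¬ e.IsDiag).card = 10 := by
        decide
      omega)
  induction e using Sym2.ind with
  | _ b d =>
    simp only [Finset.mem_union, not_or, Finset.mem_filter, Finset.mem_univ, true_and,
      Sym2.mk_isDiag_iff, E, O, Finset.mem_image, not_exists] at he he'
    have hsucc : ∀ b d : Fin 5, (∀ i : Fin 4, ¬ s(i.castSucc, i.succ) = s(b, d)) → b ≠ 4 → b + 1 ≠ d := by
      intro b d h hb hbd
      refine h ⟨b, by omega⟩ ?_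
      subst hbd
      congr 2
      revert b
      decide
    have s1 := hsucc b d he'.2
    have s2 := hsucc d b (by
      intro i
      rw [Sym2.eq_swap (a := d)]
      exact he'.2 i)
    obtain ⟨r₁, hb₁, hf₁, hp₁, hq₁⟩ := p.exists_role he he'.1 s1 s2
    obtain ⟨r₂, hb₂, hf₂, hp₂, hq₂⟩ := p.exists_role (Ne.symm he) (by
      intro k
      rw [Sym2.eq_swap (a := d)]
      exact he'.1 k) s2 s1
    have hthree : ∀ b d : Fin 5, b ≠ d → ∃ t₁ t₂ t₃ : Fin 5, [b, d, t₁, t₂, t₃].Nodup := by decide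
    obtain ⟨t₁, t₂, t₃, ht⟩ := hthree b d he
    subst hb₁ hb₂
    exact ⟨⟨r₁, r₂, t₁, t₂, t₃⟩, hf₁, hf₂, ht, hp₁, hq₁, hp₂, hq₂, s1, s2⟩

/-! ## Program logic -/

@[simp] theorem State.reg_setReg (s : State) (x y : ℕ) (v : ℤ) :
    (s.setReg x v).reg y = if y = x then v else s.reg y := by
  simp [State.setReg, Function.update_apply]

@[simp] theorem State.mem_setReg (s : State) (x : ℕ) (v : ℤ) : (s.setReg x v).mem = s.mem := rfl

@[simp] theorem State.reg_setMem (s : State) (a : ℕ) (v : ℤ) : (s.setMem a v).reg = s.reg := rfl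

@[simp] theorem State.mem_setMem (s : State) (a b : ℕ) (v : ℤ) :
    (s.setMem a v).mem b = if b = a then v else s.mem b := by
  simp [State.setMem, Function.update_apply]

/-- The program `c` started in `s` halts, and its final state and its running time satisfy `Q`. -/
def WP (B : ℕ) (c : Cmd) (s : State) (Q : State → ℕ → Prop) : Prop :=
  ∃ s' t, Exec B c s s' t ∧ Q s' t

section WP

variable {B : ℕ} {s : State} {Q : State → ℕ → Prop}

theorem WP.mono {c : Cmd} {Q' : State → ℕ → Prop} (h : WP B c s Q) (hQ : ∀ s' t, Q s' t → Q' s' t) :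
    WP B c s Q' := by
  obtain ⟨s', t, h1, h2⟩ := h
  exact ⟨s', t, h1, hQ _ _ h2⟩

theorem wp_skip : WP B .skip s Q ↔ Q s 1 := by
  constructor
  · rintro ⟨s', t, h, hQ⟩
    cases h
    exact hQ
  · exact fun h => ⟨_, _, .skip s, h⟩

theorem wp_const {x : ℕ} {v : ℤ} : WP B (.const x v) s Q ↔ |v| ≤ (B : ℤ) ∧ Q (s.setReg x v) 1 := by
  constructor
  · rintro ⟨s', t, h, hQ⟩
    cases h with
    | const _ _ _ hv => exact ⟨hv, hQ⟩
  · exact fun h => ⟨_, _, .const s x v h.1, h.2⟩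

theorem wp_copy {x y : ℕ} : WP B (.copy x y) s Q ↔ Q (s.setReg x (s.reg y)) 1 := by
  constructor
  · rintro ⟨s', t, h, hQ⟩
    cases h
    exact hQ
  · exact fun h => ⟨_, _, .copy s x y, h⟩

theorem wp_arith {o : Op} {x y z : ℕ} : WP B (.arith o x y z) s Q ↔
    |o.eval (s.reg y) (s.reg z)| ≤ (B : ℤ) ∧ Q (s.setReg x (o.eval (s.reg y) (s.reg z))) 1 := by
  constructor
  · rintro ⟨s', t, h, hQ⟩
    cases h with
    | arith _ _ _ _ _ hv => exact ⟨hv, hQ⟩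
  · exact fun h => ⟨_, _, .arith s o x y z h.1, h.2⟩

theorem wp_load {x y : ℕ} : WP B (.load x y) s Q ↔
    0 ≤ s.reg y ∧ Q (s.setReg x (s.mem (s.reg y).toNat)) 1 := by
  constructor
  · rintro ⟨s', t, h, hQ⟩
    cases h with
    | load _ _ _ hv => exact ⟨hv, hQ⟩
  · exact fun h => ⟨_, _, .load s x y h.1, h.2⟩

theorem wp_store {x y : ℕ} : WP B (.store x y) s Q ↔
    0 ≤ s.reg x ∧ Q (s.setMem (s.reg x).toNat (s.reg y)) 1 := by
  constructor
  · rintro ⟨s', t, h, hQ⟩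
    cases h with
    | store _ _ _ hv => exact ⟨hv, hQ⟩
  · exact fun h => ⟨_, _, .store s x y h.1, h.2⟩

theorem wp_seq {p q : Cmd} : WP B (.seq p q) s Q ↔
    WP B p s fun s' t => WP B q s' fun s'' t' => Q s'' (t + t') := by
  constructor
  · rintro ⟨s', t, h, hQ⟩
    cases h with
    | seq hp hq => exact ⟨_, _, hp, _, _, hq, hQ⟩
  · rintro ⟨s', t, h, s'', t', h', hQ⟩
    exact ⟨_, _, .seq h h', hQ⟩

theorem wp_ifPos {x : ℕ} {p q : Cmd} : WP B (.ifPos x p q) s Q ↔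
    (0 < s.reg x → WP B p s fun s' t => Q s' (t + 1)) ∧
      (s.reg x ≤ 0 → WP B q s fun s' t => Q s' (t + 1)) := by
  constructor
  · rintro ⟨s', t, h, hQ⟩
    cases h with
    | ifTrue hx hp => exact ⟨fun _ => ⟨_, _, hp, hQ⟩, fun h => absurd hx (not_lt.2 h)⟩
    | ifFalse hx hp => exact ⟨fun h => absurd h (not_lt.2 hx), fun _ => ⟨_, _, hp, hQ⟩⟩
  · rintro ⟨h1, h2⟩
    rcases lt_or_ge 0 (s.reg x) with h | h
    · obtain ⟨s', t, h', hQ⟩ := h1 h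
      exact ⟨_, _, .ifTrue h h', hQ⟩
    · obtain ⟨s', t, h', hQ⟩ := h2 h
      exact ⟨_, _, .ifFalse h h', hQ⟩

/-- The commands of a list in sequence. -/
def block (l : List Cmd) : Cmd := l.foldr .seq .skip

theorem wp_block_nil : WP B (block []) s Q ↔ Q s 1 := wp_skip

theorem wp_block_cons {c : Cmd} {l : List Cmd} : WP B (block (c :: l)) s Q ↔
    WP B c s fun s' t => WP B (block l) s' fun s'' t' => Q s'' (t + t') := wp_seq

/-- `for x := 0, …, reg r - 1 do p`, counting down in register `c`. Register `104` holds `1`. -/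
def forLoop (x c r : ℕ) (p : Cmd) : Cmd :=
  .seq (.copy c r) (.seq (.const x 0) (.whilePos c
    (.seq p (.seq (.arith .add x x 104) (.arith .sub c c 104)))))

/-- Induction on the number `d` of remaining rounds. Besides the body, each round costs two
arithmetic instructions and one test, hence `Tb + 3`; the final 1 is the failing test. The invariant
for `i + 1` is required after both counters have been updated. -/
theorem wp_while {x c : ℕ} {p : Cmd} (hxc : x ≠ c) (hx : x ≠ 104) (hc : c ≠ 104) {R : ℕ} (hRB : R ≤ B)
    {I : ℕ → State → Prop} {Tb : ℕ}
    (step : ∀ i < R, ∀ s, I i s → s.reg x = i → s.reg c = R - i → s.reg 104 = 1 →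
      WP B p s fun s' t => t ≤ Tb ∧ s'.reg x = i ∧ s'.reg c = R - i ∧ s'.reg 104 = 1 ∧
        I (i + 1) ((s'.setReg x (i + 1)).setReg c (R - (i + 1)))) :
    ∀ (d i : ℕ), i + d = R → ∀ s, I i s → s.reg x = i → s.reg c = R - i → s.reg 104 = 1 →
      WP B (.whilePos c (.seq p (.seq (.arith .add x x 104) (.arith .sub c c 104)))) s
        fun s' t => t ≤ d * (Tb + 3) + 1 ∧ I R s' ∧ s'.reg 104 = 1
  | 0, i, hd, s, hI, hsx, hsc, h1 => by
    refine ⟨s, 1, .whileDone (by rw [hsc]; omega), by omega, ?_, h1⟩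
    obtain rfl : i = R := by omega
    exact hI
  | d + 1, i, hd, s, hI, hsx, hsc, h1 => by
    obtain ⟨s', t, he, ht, hx', hc', h1', hI'⟩ := step i (by omega) s hI hsx hsc h1
    have hx2 : (s'.setReg x (i + 1)) = s'.setReg x (Op.eval .add (s'.reg x) (s'.reg 104)) := by
      rw [hx', h1']
      rfl
    have e1 : Exec B (.arith .add x x 104) s' (s'.setReg x (i + 1)) 1 := by
      rw [hx2]
      refine .arith s' .add x x 104 ?_
      rw [hx', h1']
      simp only [Op.eval]
      rw [abs_of_nonneg (by omega)]
      omega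
    have e2 : Exec B (.arith .sub c c 104) (s'.setReg x (i + 1))
        ((s'.setReg x (i + 1)).setReg c (R - (i + 1))) 1 := by
      have h3 : (s'.setReg x (i + 1)).reg c = R - i := by simp [hxc.symm, hc']
      have h4 : (s'.setReg x (i + 1)).reg 104 = 1 := by simp [hx.symm, h1']
      have h5 : (s'.setReg x (i + 1)).setReg c (R - (i + 1)) = (s'.setReg x (i + 1)).setReg c
          (Op.eval .sub ((s'.setReg x (i + 1)).reg c) ((s'.setReg x (i + 1)).reg 104)) := by
        rw [h3, h4]
        simp only [Op.eval]
        congr 1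
        ring
      rw [h5]
      refine .arith _ .sub c c 104 ?_
      rw [h3, h4]
      simp only [Op.eval]
      rw [abs_of_nonneg (by omega)]
      omega
    obtain ⟨s'', t'', he'', ht'', hQ⟩ := wp_while hxc hx hc hRB step d (i + 1) (by omega) _ hI'
      (by simp [hxc]) (by simp) (by simp [hx.symm, hc.symm, h1'])
    refine ⟨s'', _, .whileStep (by rw [hsc]; omega) (.seq he (.seq e1 e2)) he'', ?_, hQ⟩
    rw [Nat.succ_mul]
    omega

theorem wp_forLoop {x c r : ℕ} {p : Cmd} (hxc : x ≠ c) (hx : x ≠ 104) (hc : c ≠ 104) {R : ℕ}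
    (hRB : R ≤ B) (I : ℕ → State → Prop) (Tb : ℕ) (hr : s.reg r = R) (h1 : s.reg 104 = 1)
    (init : I 0 ((s.setReg c R).setReg x 0))
    (step : ∀ i < R, ∀ s, I i s → s.reg x = i → s.reg c = R - i → s.reg 104 = 1 →
      WP B p s fun s' t => t ≤ Tb ∧ s'.reg x = i ∧ s'.reg c = R - i ∧ s'.reg 104 = 1 ∧
        I (i + 1) ((s'.setReg x (i + 1)).setReg c (R - (i + 1))))
    (post : ∀ s t, t ≤ R * (Tb + 3) + 3 → I R s → s.reg 104 = 1 → Q s t) :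
    WP B (forLoop x c r p) s Q := by
  rw [forLoop, wp_seq, wp_copy, wp_seq, wp_const, hr]
  refine ⟨by simp, ?_⟩
  refine (wp_while hxc hx hc hRB step R 0 (by omega) _ init (by simp) (by simp [hxc.symm])
    (by simp [hx.symm, hc.symm, h1])).mono ?_
  rintro s' t ⟨h3, h4, h5⟩
  exact post _ _ (by omega) h4 h5

end WP

/-! ## Evaluating the gain -/

/-- The address of an entry of the table that starts at `m * N * N`. -/
def adr (N m p q y : ℕ) : ℕ := ((m + p) * N + q) * N + y

/-- The size conditions, and the memory below `(n + 3) ^ 3`, which holds the weights `f u v`. -/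
structure Ctx (B n W : ℕ) (M : ℕ → ℤ) (f : ℕ → ℕ → ℕ) : Prop where
  three_le : 3 ≤ n
  word : 100 * ((n + 3) ^ 3 + W) ≤ B
  weight_le : ∀ u v, f u v ≤ W
  weight : ∀ u ≤ n + 2, ∀ v ≤ n + 2, M ((n + 3 + u) * (n + 3) + v) = f u v

/-- The constants and the memory below `(n + 3) ^ 3` are intact. -/
structure Env (n : ℕ) (M : ℕ → ℤ) (s : State) : Prop where
  r100 : s.reg 100 = 0
  r101 : s.reg 101 = n + 1
  r102 : s.reg 102 = n + 3
  r103 : s.reg 103 = n + 2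
  r104 : s.reg 104 = 1
  r106 : s.reg 106 = 2 * (n + 3)
  mem : ∀ a < (n + 3) ^ 3, s.mem a = M a

theorem Env.of_eq {n : ℕ} {M : ℕ → ℤ} {s s' : State} (h : Env n M s)
    (hr : ∀ r, 100 ≤ r → r < 105 ∨ r = 106 → s'.reg r = s.reg r)
    (hm : ∀ a < (n + 3) ^ 3, s'.mem a = s.mem a) : Env n M s' where
  r100 := by rw [hr _ (by omega) (by omega), h.r100]
  r101 := by rw [hr _ (by omega) (by omega), h.r101]
  r102 := by rw [hr _ (by omega) (by omega), h.r102]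
  r103 := by rw [hr _ (by omega) (by omega), h.r103]
  r104 := by rw [hr _ (by omega) (by omega), h.r104]
  r106 := by rw [hr _ (by omega) (by omega), h.r106]
  mem := fun a ha => by rw [hm a ha, h.mem a ha]

/-- `dst := ` the position of the end `e`. -/
def ptCode (dst : ℕ) (e : EndPt) : Cmd :=
  .seq (.copy dst e.1) (if e.2 then .arith .add dst dst 104 else .skip)

theorem fin5_reg_ne (i : Fin 5) {k : ℕ} (hk : 5 ≤ k) : (i : ℕ) ≠ k := by omega

theorem wp_ptCode {B n : ℕ} {s : State} {Q : State → ℕ → Prop} {dst : ℕ} {e : EndPt} {x : Fin 5 → ℕ}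
    (h1 : s.reg 104 = 1) (hx : s.reg e.1 = x e.1) (hxn : x e.1 ≤ n + 1) (hB : n + 2 ≤ B) (hdst : dst ≠ 104)
    (hQ : Q (s.setReg dst (ptPos x e)) 2) : WP B (ptCode dst e) s Q := by
  obtain ⟨i, b⟩ := e
  simp only at hx hxn
  have hQ' := hQ
  cases b
  · simp only [ptCode, wp_seq, wp_copy, Bool.false_eq_true, if_false, wp_skip, hx]
    simpa [ptPos] using hQ
  · simp only [ptCode, wp_seq, wp_copy, if_true, wp_arith, hx, State.reg_setReg, if_true, hdst.symm,
      if_false, h1, Op.eval]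
    refine ⟨by rw [abs_of_nonneg (by omega)]; omega, ?_⟩
    have : (s.setReg dst (x i)).setReg dst ((x i : ℤ) + 1) = s.setReg dst (ptPos x (i, true)) := by
      simp [State.setReg, ptPos]
    rw [this]
    exact hQ

/-- Add (`sg = true`) or subtract the weight between two ends to register `10`. -/
def termCode (a : Bool × EndPt × EndPt) : Cmd :=
  block [ptCode 11 a.2.1, ptCode 12 a.2.2, .arith .add 11 11 102, .arith .mul 11 11 102,
    .arith .add 11 11 12, .load 11 11, .arith (if a.1 then .add else .sub) 10 10 11]

/-- The signed weight that `termCode` adds. -/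
def termVal (f : ℕ → ℕ → ℕ) (x : Fin 5 → ℕ) (a : Bool × EndPt × EndPt) : ℤ :=
  if a.1 then f (ptPos x a.2.1) (ptPos x a.2.2) else -f (ptPos x a.2.1) (ptPos x a.2.2)

/-- The matrix of the weights between positions ends below `2 * N * N`, so it does not reach the
tables, which start at `N ^ 3`. -/
theorem pow_three_mono_bounds {N u v : ℕ} (hN : 6 ≤ N) (hu : u < N) (hv : v < N) :
    (N + u) * N + v < N ^ 3 := by
  have h1 : (N + u) * N + v < 2 * N * N := by nlinarith
  have h2 : 2 * N * N ≤ N ^ 3 := by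
    have : N ^ 3 = N * N * N := by ring
    rw [this]
    nlinarith [Nat.mul_le_mul_right (N * N) hN]
  omega

theorem ptPos_le {n : ℕ} {x : Fin 5 → ℕ} (hx : ∀ i, x i ≤ n + 1) (e : EndPt) : ptPos x e ≤ n + 2 := by
  have := hx e.1
  unfold ptPos
  split_ifs <;> omega

theorem wp_termCode {B n W : ℕ} {M : ℕ → ℤ} {f : ℕ → ℕ → ℕ} (hC : Ctx B n W M f) {s : State}
    (hE : Env n M s) {x : Fin 5 → ℕ} (hx : ∀ i : Fin 5, s.reg i = x i) (hxn : ∀ i, x i ≤ n + 1)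
    (a : Bool × EndPt × EndPt) (hacc : |s.reg 10| ≤ 20 * W) :
    WP B (termCode a) s fun s' t => t ≤ 10 ∧ s'.reg 10 = s.reg 10 + termVal f x a ∧ s'.mem = s.mem ∧
      ∀ r, r ≠ 10 → r ≠ 11 → r ≠ 12 → s'.reg r = s.reg r := by
  have hB := hC.word
  have hn := hC.three_le
  have hu := ptPos_le hxn a.2.1
  have hv := ptPos_le hxn a.2.2
  have hadr := pow_three_mono_bounds (N := n + 3) (by omega) (show ptPos x a.2.1 < n + 3 by omega)
    (show ptPos x a.2.2 < n + 3 by omega)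
  have hw := hC.weight _ hu _ hv
  have hwl := hC.weight_le (ptPos x a.2.1) (ptPos x a.2.2)
  have hmem := hE.mem _ hadr
  have hn3 : n + 3 ≤ (n + 3) ^ 3 := Nat.le_self_pow (by omega) _
  obtain ⟨sg, e₁, e₂⟩ := a
  unfold termCode termVal
  dsimp only at hu hv hadr hw hwl hmem ⊢
  rw [wp_block_cons]
  refine wp_ptCode hE.r104 (hx _) (hxn _) (by omega) (by omega) ?_
  rw [wp_block_cons]
  refine wp_ptCode (x := x) (n := n) (by simp [hE.r104]) ?_ (hxn _) (by omega) (by omega) ?_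
  · simp [hx, fin5_reg_ne]
  generalize ptPos x e₁ = u at *
  generalize ptPos x e₂ = v at *
  have hcast : ((u : ℤ) + (n + 3)) * (n + 3) + v = (((n + 3 + u) * (n + 3) + v : ℕ) : ℤ) := by
    push_cast
    ring
  have hnat : ((u : ℤ) + (n + 3)) * (n + 3) ≤ ((n + 3) ^ 3 : ℕ) := by
    have : (u + (n + 3)) * (n + 3) ≤ (n + 3) ^ 3 := by
      have : (u + (n + 3)) * (n + 3) = (n + 3 + u) * (n + 3) := by ring
      omega
    exact_mod_cast this
  have hpos : 0 ≤ ((u : ℤ) + (n + 3)) * (n + 3) := by positivity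
  have hacc' := abs_le.1 hacc
  have hval : s.mem (((u : ℤ) + (n + 3)) * (n + 3) + v).toNat = f u v := by
    rw [hcast, Int.toNat_natCast, hmem, hw]
  -- With the powers and products abstracted, all remaining word bounds are linear.
  generalize (n + 3) ^ 3 = C at *
  generalize hP : ((u : ℤ) + (n + 3)) * (n + 3) = P at *
  have hCP : P + v ≤ C := by rw [hcast]; exact_mod_cast hadr.le
  have bnd : ∀ z : ℤ, -B ≤ z → z ≤ B → |z| ≤ (B : ℤ) := fun z h1 h2 => abs_le.2 ⟨h1, h2⟩
  cases sg <;>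
  · simp only [wp_block_cons, wp_block_nil, wp_arith, wp_load, Op.eval, State.reg_setReg, hE.r102,
      State.mem_setReg, Nat.reduceEqDiff, if_true, if_false, Bool.false_eq_true, hP, hval]
    refine ⟨bnd _ (by omega) (by omega), bnd _ (by omega) (by omega), bnd _ (by omega) (by omega),
      by omega, bnd _ (by omega) (by omega), by omega, by first | exact trivial | omega, trivial, ?_⟩
    intro r h1 h2 h3
    simp only [h1, h2, h3, if_false]

theorem abs_termVal_le {f : ℕ → ℕ → ℕ} {W : ℕ} (hf : ∀ u v, f u v ≤ W) (x : Fin 5 → ℕ)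
    (a : Bool × EndPt × EndPt) : |termVal f x a| ≤ W := by
  have := hf (ptPos x a.2.1) (ptPos x a.2.2)
  unfold termVal
  rw [abs_le]
  split_ifs <;> omega

/-- The parameter `k` is a budget: the accumulator is at most `k * W` so far and each further term
adds at most `W`. A budget of 20 terms keeps every partial sum within the word size. -/
theorem wp_terms {B n W : ℕ} {M : ℕ → ℤ} {f : ℕ → ℕ → ℕ} (hC : Ctx B n W M f) {x : Fin 5 → ℕ}
    (hxn : ∀ i, x i ≤ n + 1) : ∀ (l : List (Bool × EndPt × EndPt)) (k : ℕ), l.length + k ≤ 20 →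
    ∀ s : State, Env n M s → (∀ i : Fin 5, s.reg i = x i) → |s.reg 10| ≤ k * W →
    WP B (block (l.map termCode)) s fun s' t => t ≤ 10 * l.length + 1 ∧
      s'.reg 10 = s.reg 10 + (l.map (termVal f x)).sum ∧ s'.mem = s.mem ∧
      ∀ r, r ≠ 10 → r ≠ 11 → r ≠ 12 → s'.reg r = s.reg r
  | [], k, _, s, _, _, _ => by
    rw [List.map_nil, wp_block_nil]
    simp
  | a :: l, k, hk, s, hE, hx, hacc => by
    rw [List.map_cons, wp_block_cons]
    rw [List.length_cons] at hk
    have hkW : (k : ℤ) * W ≤ 19 * W := by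
      have : k * W ≤ 19 * W := Nat.mul_le_mul_right _ (by omega)
      exact_mod_cast this
    refine (wp_termCode hC hE hx hxn a (by omega)).mono ?_
    rintro s' t ⟨ht, h10, hm, hr⟩
    have ha := abs_termVal_le hC.weight_le x a
    have hacc' : |s'.reg 10| ≤ ((k + 1 : ℕ) : ℤ) * W := by
      rw [h10]
      refine (abs_add_le _ _).trans ?_
      push_cast
      linarith
    refine (wp_terms hC hxn l (k + 1) (by omega) s' ?_ ?_ hacc').mono ?_
    · exact hE.of_eq (fun r h1 _ => hr r (by omega) (by omega) (by omega)) (fun a _ => by rw [hm])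
    · intro i
      rw [hr _ (fin5_reg_ne i (by omega)) (fin5_reg_ne i (by omega)) (fin5_reg_ne i (by omega)), hx]
    · rintro s'' t' ⟨ht', h10', hm', hr'⟩
      refine ⟨by rw [List.length_cons]; omega, ?_, by rw [hm', hm], ?_⟩
      · rw [h10', h10, List.map_cons, List.sum_cons, add_assoc]
      · intro r h1 h2 h3
        rw [hr' r h1 h2 h3, hr r h1 h2 h3]

/-- Compute the gain into register `10`. -/
def gainCode (A : Fin 5 → EndPt × EndPt) : Cmd :=
  .seq (.const 10 0) (block ((List.ofFn (fun i : Fin 5 => (true, (i, false), (i, true))) ++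
    List.ofFn (fun k => (false, A k))).map termCode))

theorem wp_gainCode {B n W : ℕ} {M : ℕ → ℤ} {f : ℕ → ℕ → ℕ} (hC : Ctx B n W M f)
    (A : Fin 5 → EndPt × EndPt) {s : State} (hE : Env n M s) {x : Fin 5 → ℕ}
    (hx : ∀ i : Fin 5, s.reg i = x i) (hxn : ∀ i, x i ≤ n + 1) :
    WP B (gainCode A) s fun s' t => t ≤ 102 ∧ s'.reg 10 = gainAt f A x ∧ s'.mem = s.mem ∧
      ∀ r, r ≠ 10 → r ≠ 11 → r ≠ 12 → s'.reg r = s.reg r := by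
  rw [gainCode, wp_seq, wp_const]
  refine ⟨by simp, ?_⟩
  refine (wp_terms hC hxn _ 0 (by simp) _ ?_ ?_ (by simp)).mono ?_
  · refine hE.of_eq (fun r h1 _ => ?_) (fun a _ => rfl)
    rw [State.reg_setReg, if_neg (by omega)]
  · intro i
    rw [State.reg_setReg, if_neg (fin5_reg_ne i (by omega)), hx]
  · rintro s' t ⟨ht, h10, hm, hr⟩
    refine ⟨?_, ?_, hm, ?_⟩
    · simp at ht
      omega
    · rw [h10, List.map_append, List.sum_append, List.map_ofFn, List.map_ofFn, List.sum_ofFn,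
        List.sum_ofFn, gainAt]
      simp [termVal, ptPos, sub_eq_add_neg]
    · intro r h1 h2 h3
      rw [hr r h1 h2 h3, State.reg_setReg, if_neg h1]

theorem abs_gainAt_le {f : ℕ → ℕ → ℕ} {W : ℕ} (hf : ∀ u v, f u v ≤ W) (A : Fin 5 → EndPt × EndPt)
    (x : Fin 5 → ℕ) : |gainAt f A x| ≤ 5 * W := by
  have h1 : ∑ i, (f (x i) (x i + 1) : ℤ) ≤ 5 * W := by
    have := Finset.sum_le_card_nsmul Finset.univ (fun i => (f (x i) (x i + 1) : ℤ)) W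
      (fun i _ => by exact_mod_cast hf _ _)
    simpa using this
  have h2 : ∑ k, (f (ptPos x (A k).1) (ptPos x (A k).2) : ℤ) ≤ 5 * W := by
    have := Finset.sum_le_card_nsmul Finset.univ
      (fun k => (f (ptPos x (A k).1) (ptPos x (A k).2) : ℤ)) W (fun i _ => by exact_mod_cast hf _ _)
    simpa using this
  have h3 : 0 ≤ ∑ i, (f (x i) (x i + 1) : ℤ) := Finset.sum_nonneg fun i _ => by positivity
  have h4 : 0 ≤ ∑ k, (f (ptPos x (A k).1) (ptPos x (A k).2) : ℤ) :=
    Finset.sum_nonneg fun i _ => by positivity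
  rw [gainAt, abs_le]
  constructor <;> linarith

/-! ## Filling the table of a role -/

/-- The register with the lower bound for position `i`. -/
def prevReg (i : Fin 5) : ℕ := if i = 0 then 100 else (i - 1 : Fin 5)

/-- The register with the upper bound for position `i`. -/
def nextReg (i : Fin 5) : ℕ := if i = 4 then 101 else (i + 1 : Fin 5)

/-- The register with the start bound. -/
def Role.startReg (r : Role) : ℕ := if r.fwd then prevReg r.b else nextReg r.b

/-- The register with the stop bound. -/
def Role.stopReg (r : Role) : ℕ := if r.fwd then nextReg r.b else prevReg r.b

theorem Env.reg_prevReg {n : ℕ} {M : ℕ → ℤ} {s : State} (hE : Env n M s) {x : Fin 5 → ℕ} {i : Fin 5}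
    (hx : i ≠ 0 → s.reg (i - 1 : Fin 5) = x (i - 1)) : s.reg (prevReg i) = prevVal x i := by
  unfold prevReg prevVal
  split_ifs with h
  · rw [hE.r100]; rfl
  · exact hx h

theorem Env.reg_nextReg {n : ℕ} {M : ℕ → ℤ} {s : State} (hE : Env n M s) {x : Fin 5 → ℕ} {i : Fin 5}
    (hx : i ≠ 4 → s.reg (i + 1 : Fin 5) = x (i + 1)) : s.reg (nextReg i) = nextVal n x i := by
  unfold nextReg nextVal
  split_ifs with h
  · rw [hE.r101]; simp
  · exact hx h

theorem Env.reg_startReg {n : ℕ} {M : ℕ → ℤ} {s : State} (hE : Env n M s) {x : Fin 5 → ℕ} {r : Role}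
    (hx : ∀ i, i ≠ r.b → s.reg (i : Fin 5) = x i) : s.reg r.startReg = r.startVal n x := by
  unfold Role.startReg Role.startVal
  split_ifs with h
  · exact hE.reg_prevReg fun _ => hx _ (Fin5.sub_one_ne _)
  · exact hE.reg_nextReg fun _ => hx _ (Fin5.add_one_ne _)

theorem Env.reg_stopReg {n : ℕ} {M : ℕ → ℤ} {s : State} (hE : Env n M s) {x : Fin 5 → ℕ} {r : Role}
    (hx : (r.b ≠ 4 → s.reg (r.b + 1 : Fin 5) = x (r.b + 1)) ∧
      (r.b ≠ 0 → s.reg (r.b - 1 : Fin 5) = x (r.b - 1))) : s.reg r.stopReg = r.stopVal n x := by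
  unfold Role.stopReg Role.stopVal
  split_ifs with h
  · exact hE.reg_nextReg hx.1
  · exact hE.reg_prevReg hx.2

theorem prevReg_ne (i : Fin 5) {k : ℕ} (h1 : 5 ≤ k) (h2 : k < 100) : prevReg i ≠ k := by
  unfold prevReg
  split_ifs <;> omega

theorem nextReg_ne (i : Fin 5) {k : ℕ} (h1 : 5 ≤ k) (h2 : k < 100) : nextReg i ≠ k := by
  unfold nextReg
  split_ifs <;> omega

theorem prevReg_ne_self (i : Fin 5) : prevReg i ≠ i := by
  revert i; decide

theorem nextReg_ne_self (i : Fin 5) : nextReg i ≠ i := by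
  revert i; decide

theorem Role.startReg_ne (r : Role) {k : ℕ} (h1 : 5 ≤ k) (h2 : k < 100) : r.startReg ≠ k := by
  unfold startReg
  split_ifs
  · exact prevReg_ne _ h1 h2
  · exact nextReg_ne _ h1 h2

theorem Role.startReg_ne_b (r : Role) : r.startReg ≠ r.b := by
  unfold startReg
  split_ifs
  · exact prevReg_ne_self _
  · exact nextReg_ne_self _

/-- The `j`-th position in a sweep. -/
def sweepPos (n : ℕ) (fwd : Bool) (j : ℕ) : ℕ := if fwd then j else n + 1 - j

/-- The position `c` lies behind the start bound `st` in the sweep. -/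
def Behind (fwd : Bool) (st c : ℕ) : Prop := if fwd then st < c else c < st

/-- Among the first `i` positions of the sweep that lie behind `st`, `a` is an optimal one. -/
def SweepBest (n : ℕ) (fwd : Bool) (st : ℕ) (G : ℕ → ℤ) (i a : ℕ) : Prop :=
  (∃ j < i, a = sweepPos n fwd j) ∧ Behind fwd st a ∧
    ∀ j < i, Behind fwd st (sweepPos n fwd j) → G (sweepPos n fwd j) ≤ G a

/-- Registers `20`, `21` and `25` describe the optimum over the first `i` positions of the sweep. -/
def SweepAcc (n : ℕ) (fwd : Bool) (st : ℕ) (G : ℕ → ℤ) (i : ℕ) (s : State) : Prop :=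
  ∃ a : ℕ, a ≤ n + 1 ∧ s.reg 20 = a ∧
    ((s.reg 25 = 0 ∧ ∀ j < i, ¬ Behind fwd st (sweepPos n fwd j)) ∨
      (s.reg 25 = 1 ∧ s.reg 21 = G a ∧ SweepBest n fwd st G i a))

theorem sweepPos_le {n : ℕ} (fwd : Bool) {j : ℕ} (hj : j < n + 2) : sweepPos n fwd j ≤ n + 1 := by
  unfold sweepPos
  split_ifs <;> omega

theorem sweepPos_inj {n : ℕ} {fwd : Bool} {i j : ℕ} (hi : i < n + 2) (hj : j < n + 2)
    (h : sweepPos n fwd i = sweepPos n fwd j) : i = j := by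
  unfold sweepPos at h
  split_ifs at h <;> omega

/-- Replace the optimum by position `b` with value in register `10` if that is better. -/
def improveCode (b : ℕ) : Cmd :=
  .seq (.ifPos 25 (.arith .sub 26 10 21) (.const 26 1))
    (.ifPos 26 (block [.copy 20 b, .copy 21 10, .copy 25 104]) .skip)

/-- Register 25 tells whether a candidate has been seen. Before the first one, register 21 is not
the value of any candidate, so register 26 is set to 1 to force the replacement instead of
comparing. -/
theorem wp_improveCode {B : ℕ} {s : State} {b : Fin 5} (h104 : s.reg 104 = 1)
    (h25 : s.reg 25 = 0 ∨ s.reg 25 = 1) (hB : 1 ≤ B) (hd : |s.reg 10 - s.reg 21| ≤ (B : ℤ) ∨ s.reg 25 = 0) :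
    WP B (improveCode b) s fun s' t => t ≤ 8 ∧ s'.mem = s.mem ∧
      (∀ r, r ≠ 20 → r ≠ 21 → r ≠ 25 → r ≠ 26 → s'.reg r = s.reg r) ∧
      (((s.reg 25 = 0 ∨ s.reg 21 < s.reg 10) ∧ s'.reg 20 = s.reg b ∧ s'.reg 21 = s.reg 10 ∧
          s'.reg 25 = 1) ∨
        (s.reg 25 = 1 ∧ s.reg 10 ≤ s.reg 21 ∧ s'.reg 20 = s.reg 20 ∧ s'.reg 21 = s.reg 21 ∧
          s'.reg 25 = 1)) := by
  have hb := fun k h => fin5_reg_ne b (k := k) h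
  rcases h25 with h25 | h25
  · simp only [improveCode, wp_seq, wp_ifPos, wp_block_cons, wp_block_nil, wp_copy, wp_const, wp_skip,
      h25, State.reg_setReg, State.mem_setReg, hb 26, h104, Nat.reduceLeDiff, Nat.reduceEqDiff, if_true, if_false]
    refine ⟨fun h => absurd h (lt_irrefl _), fun _ => ⟨by simpa using hB, fun _ => ?_, fun h => by simp at h⟩⟩
    refine ⟨by omega, trivial, ?_, by simp⟩
    intro r h1 h2 h3 h4
    simp only [h1, h2, h3, h4, if_false]
  · have hd' : |s.reg 10 - s.reg 21| ≤ (B : ℤ) := by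
      rcases hd with hd | hd
      · exact hd
      · omega
    simp only [improveCode, wp_seq, wp_ifPos, wp_block_cons, wp_block_nil, wp_copy, wp_arith, wp_skip,
      h25, State.reg_setReg, State.mem_setReg, hb 26, h104, Nat.reduceLeDiff, Nat.reduceEqDiff, if_true, if_false, Op.eval]
    refine ⟨fun _ => ⟨hd', fun h => ?_, fun h => ?_⟩, fun h => by simp at h⟩
    · refine ⟨by omega, trivial, ?_, Or.inl ⟨Or.inr (by omega), trivial, trivial, trivial⟩⟩
      intro r h1 h2 h3 h4
      simp only [h1, h2, h3, h4, if_false]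
    · refine ⟨by omega, trivial, ?_, Or.inr ⟨trivial, by omega, trivial, trivial, trivial⟩⟩
      intro r h1 h2 h3 h4
      simp only [h4, if_false]

/-- A sweep step has three outcomes: the position is no candidate, it becomes the optimum
(`SweepAcc.step_new`), or the old optimum stays (`SweepAcc.step_keep`). -/
theorem SweepAcc.step_not {n : ℕ} {fwd : Bool} {st : ℕ} {G : ℕ → ℤ} {i : ℕ} {s s' : State}
    (h : SweepAcc n fwd st G i s) (hi : ¬ Behind fwd st (sweepPos n fwd i)) (h20 : s'.reg 20 = s.reg 20)
    (h21 : s'.reg 21 = s.reg 21) (h25 : s'.reg 25 = s.reg 25) : SweepAcc n fwd st G (i + 1) s' := by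
  obtain ⟨a, ha, h1, h2⟩ := h
  refine ⟨a, ha, by rw [h20, h1], ?_⟩
  rw [h21, h25]
  rcases h2 with ⟨h2, h3⟩ | ⟨h2, h3, ⟨j, hj, h4⟩, h5, h6⟩
  · refine Or.inl ⟨h2, fun j hj => ?_⟩
    rcases Nat.lt_succ_iff_lt_or_eq.1 hj with hj | rfl
    · exact h3 j hj
    · exact hi
  · refine Or.inr ⟨h2, h3, ⟨j, by omega, h4⟩, h5, fun j hj hb => ?_⟩
    rcases Nat.lt_succ_iff_lt_or_eq.1 hj with hj | rfl
    · exact h6 j hj hb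
    · exact absurd hb hi

theorem SweepAcc.step_new {n : ℕ} {fwd : Bool} {st : ℕ} {G : ℕ → ℤ} {i : ℕ} {s s' : State} (hin : i < n + 2)
    (h : SweepAcc n fwd st G i s) (hi : Behind fwd st (sweepPos n fwd i))
    (hnew : s.reg 25 = 0 ∨ s.reg 21 < G (sweepPos n fwd i)) (h20 : s'.reg 20 = sweepPos n fwd i)
    (h21 : s'.reg 21 = G (sweepPos n fwd i)) (h25 : s'.reg 25 = 1) :
    SweepAcc n fwd st G (i + 1) s' := by
  obtain ⟨a, ha, h1, h2⟩ := h
  refine ⟨_, sweepPos_le fwd hin, h20, Or.inr ⟨h25, h21, ⟨i, by omega, rfl⟩, hi, fun j hj hb => ?_⟩⟩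
  rcases Nat.lt_succ_iff_lt_or_eq.1 hj with hj | rfl
  · rcases h2 with ⟨h2, h3⟩ | ⟨h2, h3, h4, h5, h6⟩
    · exact absurd hb (h3 j hj)
    · have := h6 j hj hb
      rcases hnew with hnew | hnew
      · omega
      · omega
  · exact le_rfl

theorem SweepAcc.step_keep {n : ℕ} {fwd : Bool} {st : ℕ} {G : ℕ → ℤ} {i : ℕ} {s s' : State}
    (h : SweepAcc n fwd st G i s) (hold : s.reg 25 = 1) (hle : G (sweepPos n fwd i) ≤ s.reg 21)
    (h20 : s'.reg 20 = s.reg 20) (h21 : s'.reg 21 = s.reg 21) (h25 : s'.reg 25 = 1) :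
    SweepAcc n fwd st G (i + 1) s' := by
  obtain ⟨a, ha, h1, h2⟩ := h
  refine ⟨a, ha, by rw [h20, h1], Or.inr ⟨h25, ?_⟩⟩
  rcases h2 with ⟨h2, h3⟩ | ⟨h2, h3, ⟨j, hj, h4⟩, h5, h6⟩
  · omega
  · refine ⟨by rw [h21, h3], ⟨j, by omega, h4⟩, h5, fun j hj hb => ?_⟩
    rcases Nat.lt_succ_iff_lt_or_eq.1 hj with hj | rfl
    · exact h6 j hj hb
    · omega

/-- One step of the sweep for fixed `p` and `q`. -/
def sweepBody (A : Fin 5 → EndPt × EndPt) (r : Role) : Cmd :=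
  block [if r.fwd then .copy r.b 23 else .arith .sub r.b 101 23,
    .arith .add 26 22 r.b, .store 26 20,
    if r.fwd then .arith .sub 26 r.b r.startReg else .arith .sub 26 r.startReg r.b,
    .ifPos 26 (.seq (gainCode A) (improveCode r.b)) .skip]

/-- The running optimum is stored before the current position competes. The entry at a position thus
concerns only earlier positions of the sweep, which matches the strict inequality at the stop bound.
-/
theorem wp_sweepBody {B n W : ℕ} {M : ℕ → ℤ} {f : ℕ → ℕ → ℕ} (hC : Ctx B n W M f)
    (A : Fin 5 → EndPt × EndPt) (r : Role) {x : Fin 5 → ℕ} (hxn : ∀ i, x i ≤ n + 1)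
    {s : State} (hE : Env n M s) (hx : ∀ i, i ≠ r.b → s.reg (i : Fin 5) = x i) {ad i : ℕ}
    (had : s.reg 22 = ad) (hlo : (n + 3) ^ 3 ≤ ad) (hhi : ad + n + 3 ≤ 3 * (n + 3) ^ 3)
    (h23 : s.reg 23 = i) (hi : i < n + 2)
    (hacc : SweepAcc n r.fwd (r.startVal n x) (fun c => gainAt f A (Function.update x r.b c)) i s) :
    WP B (sweepBody A r) s fun s' t => t ≤ 120 ∧
      (∀ k : ℕ, k ≠ r.b → (k < 10 ∨ 30 ≤ k ∨ 22 ≤ k ∧ k ≤ 24) → s'.reg k = s.reg k) ∧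
      (∀ a, s'.mem a = if a = ad + sweepPos n r.fwd i then s.reg 20 else s.mem a) ∧
      SweepAcc n r.fwd (r.startVal n x) (fun c => gainAt f A (Function.update x r.b c)) (i + 1) s' := by
  have hB := hC.word
  have hn := hC.three_le
  have hn3 : n + 3 ≤ (n + 3) ^ 3 := Nat.le_self_pow (by omega) _
  have hbnd : ∀ z : ℤ, -B ≤ z → z ≤ B → |z| ≤ (B : ℤ) := fun z h1 h2 => abs_le.2 ⟨h1, h2⟩
  have hb := fun k h => fin5_reg_ne r.b (k := k) h
  have hb' := fun k h => (fin5_reg_ne r.b (k := k) h).symm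
  set φ := sweepPos n r.fwd i with hφ
  have hφn : φ ≤ n + 1 := sweepPos_le _ hi
  have hst := hE.reg_startReg hx
  have hstn : r.startVal n x ≤ n + 1 := by
    unfold Role.startVal prevVal nextVal
    split_ifs <;> first | omega | exact hxn _
  set st := r.startVal n x with hstdef
  have hstep1 : ∀ Q : State → ℕ → Prop, Q (s.setReg r.b φ) 1 →
      WP B (if r.fwd then .copy r.b 23 else .arith .sub r.b 101 23) s Q := by
    intro Q hQ
    cases hf : r.fwd
    · simp only [Bool.false_eq_true, if_false, wp_arith, Op.eval, hE.r101, h23]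
      have : (n : ℤ) + 1 - i = φ := by
        rw [hφ, sweepPos, hf]
        simp only [Bool.false_eq_true, if_false]
        omega
      rw [this]
      exact ⟨hbnd _ (by omega) (by omega), hQ⟩
    · simp only [if_true, wp_copy, h23]
      rw [hφ, sweepPos, hf] at hQ
      simpa using hQ
  obtain ⟨C, hCd⟩ : ∃ C, (n + 3) ^ 3 = C := ⟨_, rfl⟩
  rw [hCd] at hlo hhi hB hn3
  unfold sweepBody
  rw [wp_block_cons]
  refine hstep1 _ ?_
  rw [wp_block_cons, wp_arith]
  simp only [State.reg_setReg, Op.eval, hb' 22, Nat.reduceLeDiff, if_true, if_false, had]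
  refine ⟨hbnd _ (by omega) (by omega), ?_⟩
  rw [wp_block_cons, wp_store]
  have hcast : (ad : ℤ) + φ = ((ad + φ : ℕ) : ℤ) := by push_cast; rfl
  simp only [State.reg_setReg, if_true, hcast, Int.toNat_natCast, hb' 20, Nat.reduceLeDiff, if_false,
    Nat.reduceEqDiff]
  refine ⟨by positivity, ?_⟩
  set s2 := (((s.setReg r.b φ).setReg 26 ((ad + φ : ℕ) : ℤ)).setMem (ad + φ) (s.reg 20)) with hs2
  have hs2r : ∀ k : ℕ, k ≠ r.b → k ≠ 26 → s2.reg k = s.reg k := by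
    intro k h1 h2
    simp [hs2, h1, h2]
  have hs2b : s2.reg r.b = φ := by simp [hs2, hb 26]
  have hs2m : ∀ a, s2.mem a = if a = ad + φ then s.reg 20 else s.mem a := by
    intro a
    simp [hs2]
  have hstep2 : ∀ Q : State → ℕ → Prop, (∀ d : ℤ, (0 < d ↔ Behind r.fwd st φ) → Q (s2.setReg 26 d) 1) →
      WP B (if r.fwd then .arith .sub 26 r.b r.startReg else .arith .sub 26 r.startReg r.b) s2 Q := by
    intro Q hQ
    have e : s2.reg r.startReg = st := by
      rw [hs2r _ r.startReg_ne_b (r.startReg_ne (by omega) (by omega)), hst]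
    cases hf : r.fwd
    · simp only [Bool.false_eq_true, if_false, wp_arith, Op.eval, hs2b, e]
      refine ⟨hbnd _ (by omega) (by omega), hQ _ ?_⟩
      rw [Behind, hf]
      simp
    · simp only [if_true, wp_arith, Op.eval, hs2b, e]
      refine ⟨hbnd _ (by omega) (by omega), hQ _ ?_⟩
      rw [Behind, hf]
      simp
  rw [wp_block_cons]
  refine hstep2 _ ?_
  intro d hd
  rw [wp_block_cons, wp_ifPos]
  simp only [State.reg_setReg, if_true]
  have hacc2 : SweepAcc n r.fwd st (fun c => gainAt f A (Function.update x r.b c)) i (s2.setReg 26 d) := by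
    obtain ⟨a, ha, h1, h2⟩ := hacc
    refine ⟨a, ha, ?_, ?_⟩
    · rw [State.reg_setReg, if_neg (by omega), hs2r _ (hb' 20 (by omega)) (by omega), h1]
    · simp only [State.reg_setReg, Nat.reduceEqDiff, if_false, hs2r _ (hb' 21 (by omega)) (show 21 ≠ 26 by omega),
        hs2r _ (hb' 25 (by omega)) (show 25 ≠ 26 by omega)]
      exact h2
  set s3 := s2.setReg 26 d with hs3
  have hs3r : ∀ k : ℕ, k ≠ r.b → k ≠ 26 → s3.reg k = s.reg k := by
    intro k h1 h2
    rw [hs3, State.reg_setReg, if_neg h2, hs2r k h1 h2]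
  have hs3m : ∀ a, s3.mem a = if a = ad + φ then s.reg 20 else s.mem a := hs2m
  constructor
  · intro hdpos
    have hbeh := hd.1 hdpos
    have hE3 : Env n M s3 := by
      refine hE.of_eq (fun k h1 _ => hs3r k (hb' k (by omega)) (by omega)) (fun a ha => ?_)
      rw [hs3m, if_neg (by omega)]
    have hx3 : ∀ i : Fin 5, s3.reg i = (Function.update x r.b φ i : ℕ) := by
      intro i
      by_cases hi : i = r.b
      · rw [hi, Function.update_self, hs3, State.reg_setReg, if_neg (hb 26 (by omega)), hs2b]
      · rw [Function.update_of_ne hi, hs3r _ (fun h => hi (Fin.ext h)) (fin5_reg_ne i (by omega)), hx i hi]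
    have hx3n : ∀ i, Function.update x r.b φ i ≤ n + 1 := by
      intro i
      by_cases hi : i = r.b
      · rw [hi, Function.update_self]; exact hφn
      · rw [Function.update_of_ne hi]; exact hxn i
    rw [wp_seq]
    refine (wp_gainCode hC A hE3 hx3 hx3n).mono ?_
    rintro s4 t4 ⟨ht4, h10, hm4, hr4⟩
    have h25 : s4.reg 25 = s3.reg 25 := hr4 _ (by omega) (by omega) (by omega)
    have h20 : s4.reg 20 = s3.reg 20 := hr4 _ (by omega) (by omega) (by omega)
    have h21 : s4.reg 21 = s3.reg 21 := hr4 _ (by omega) (by omega) (by omega)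
    have h4b : s4.reg r.b = φ := by
      rw [hr4 _ (hb 10 (by omega)) (hb 11 (by omega)) (hb 12 (by omega)), hx3, Function.update_self]
    have hor : s4.reg 25 = 0 ∨ s4.reg 25 = 1 := by
      obtain ⟨a, ha, h1, h2 | h2⟩ := hacc2
      · exact Or.inl (by rw [h25, h2.1])
      · exact Or.inr (by rw [h25, h2.1])
    have hdiff : |s4.reg 10 - s4.reg 21| ≤ (B : ℤ) ∨ s4.reg 25 = 0 := by
      obtain ⟨a, ha, h1, h2 | h2⟩ := hacc2
      · exact Or.inr (by rw [h25, h2.1])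
      · left
        rw [h10, h21, h2.2.1]
        have h3 := abs_le.1 (abs_gainAt_le hC.weight_le A (Function.update x r.b φ))
        have h4 := abs_le.1 (abs_gainAt_le hC.weight_le A (Function.update x r.b a))
        exact hbnd _ (by dsimp only; omega) (by dsimp only; omega)
    refine (wp_improveCode (by rw [hr4 _ (by omega) (by omega) (by omega), hE3.r104]) hor (by omega) hdiff).mono ?_
    rintro s5 t5 ⟨ht5, hm5, hr5, hcase⟩
    rw [wp_block_nil]
    refine ⟨by omega, ?_, ?_, ?_⟩
    · intro k h1 h2
      rw [hr5 k (by omega) (by omega) (by omega) (by omega), hr4 k (by omega) (by omega) (by omega),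
        hs3r k h1 (by omega)]
    · intro a
      rw [hm5, hm4, hs3m]
    · rw [h25, h20, h21, h10, h4b] at hcase
      rcases hcase with ⟨h1, h2, h3, h4⟩ | ⟨h1, h2, h3, h4, h5⟩
      · exact hacc2.step_new hi hbeh h1 h2 h3 h4
      · exact hacc2.step_keep h1 h2 h3 h4 h5
  · intro hdneg
    rw [wp_skip, wp_block_nil]
    refine ⟨by omega, fun k h1 h2 => hs3r k h1 (by omega), hs3m, ?_⟩
    exact hacc2.step_not (fun h => absurd (hd.2 h) (not_lt.2 hdneg)) rfl rfl rfl

theorem SweepAcc.congr {n : ℕ} {fwd : Bool} {st : ℕ} {G : ℕ → ℤ} {i : ℕ} {s s' : State}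
    (h : SweepAcc n fwd st G i s) (h20 : s'.reg 20 = s.reg 20) (h21 : s'.reg 21 = s.reg 21)
    (h25 : s'.reg 25 = s.reg 25) : SweepAcc n fwd st G i s' := by
  obtain ⟨a, ha, h1, h2⟩ := h
  exact ⟨a, ha, by rw [h20, h1], by rw [h21, h25]; exact h2⟩

/-- For `m = N` and `m = 2 * N` the tables are two adjacent blocks of length `N ^ 3`, both above the
weights. Hence filling a table destroys neither the weights nor the other table. -/
theorem adr_bounds {N m p q : ℕ} (hm : N ≤ m) (hm' : m ≤ 2 * N) (hp : p < N) (hq : q < N) :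
    N ^ 3 ≤ ((m + p) * N + q) * N ∧ ((m + p) * N + q) * N + N ≤ 3 * N ^ 3 ∧
      m * N * N ≤ ((m + p) * N + q) * N ∧ ((m + p) * N + q) * N + N ≤ (m + N) * N * N := by
  have e : N ^ 3 = N * N * N := by ring
  have h1 : N * N ≤ (m + p) * N := Nat.mul_le_mul_right _ (by omega)
  have h2 : (m + p + 1) * N ≤ (m + N) * N := Nat.mul_le_mul_right _ (by omega)
  have h3 : (m + p + 1) * N = (m + p) * N + N := by ring
  have h4 : (m + N) * N ≤ 3 * N * N := Nat.mul_le_mul_right _ (by omega)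
  have h5 : m * N ≤ (m + p) * N := Nat.mul_le_mul_right _ (by omega)
  refine ⟨?_, ?_, ?_, ?_⟩
  · rw [e]
    exact Nat.mul_le_mul_right _ (by omega)
  · have : ((m + p) * N + q + 1) * N ≤ 3 * N * N * N := Nat.mul_le_mul_right _ (by omega)
    have e2 : ((m + p) * N + q + 1) * N = ((m + p) * N + q) * N + N := by ring
    have e3 : 3 * N ^ 3 = 3 * N * N * N := by ring
    omega
  · exact Nat.mul_le_mul_right _ (by omega)
  · have : ((m + p) * N + q + 1) * N ≤ (m + N) * N * N := Nat.mul_le_mul_right _ (by omega)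
    have e2 : ((m + p) * N + q + 1) * N = ((m + p) * N + q) * N + N := by ring
    omega

theorem mul_add_inj {N a a' b b' : ℕ} (hb : b < N) (hb' : b' < N) (h : a * N + b = a' * N + b') :
    a = a' ∧ b = b' := by
  have h1 : a = a' := by
    have := congrArg (· / N) h
    simp only [mul_comm _ N] at this
    rwa [Nat.mul_add_div (by omega), Nat.mul_add_div (by omega), Nat.div_eq_of_lt hb,
      Nat.div_eq_of_lt hb', add_zero, add_zero] at this
  subst h1
  omega

/-- An address is a number written in base `N`, so its digits are unique. Different rows of a table
therefore do not overwrite each other. -/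
theorem adr_inj {N m p q y p' q' y' : ℕ} (hq : q < N) (hy : y < N) (hq' : q' < N) (hy' : y' < N)
    (h : adr N m p q y = adr N m p' q' y') : p = p' ∧ q = q' ∧ y = y' := by
  obtain ⟨h1, h2⟩ := mul_add_inj hy hy' h
  obtain ⟨h3, h4⟩ := mul_add_inj hq hq' h1
  exact ⟨by omega, h4, h2⟩

/-- The address computation of `adr` up to the last coordinate, in register `22`. -/
def adrCode (rb p q : ℕ) : Cmd :=
  block [.arith .add 22 rb p, .arith .mul 22 22 102, .arith .add 22 22 q, .arith .mul 22 22 102]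

theorem wp_adrCode {B n W : ℕ} {M : ℕ → ℤ} {f : ℕ → ℕ → ℕ} (hC : Ctx B n W M f) {s : State}
    (hE : Env n M s) {rb p q m u v : ℕ} (hrb : s.reg rb = m) (hp : s.reg p = u) (hq : s.reg q = v)
    (hq22 : q ≠ 22) (hm : n + 3 ≤ m) (hm' : m ≤ 2 * (n + 3)) (hu : u < n + 3)
    (hv : v < n + 3) {Q : State → ℕ → Prop}
    (hQ : Q (s.setReg 22 ((((m + u) * (n + 3) + v) * (n + 3) : ℕ) : ℤ)) 5) :
    WP B (adrCode rb p q) s Q := by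
  have hB := hC.word
  obtain ⟨-, h2, -, -⟩ := adr_bounds hm hm' hu hv
  have hbnd : ∀ z : ℕ, z ≤ B → |(z : ℤ)| ≤ (B : ℤ) := fun z h1 => by
    rw [abs_of_nonneg (by positivity)]
    exact_mod_cast h1
  have hX : (m + u) * (n + 3) + v ≤ ((m + u) * (n + 3) + v) * (n + 3) := Nat.le_mul_of_pos_right _ (by omega)
  have hX2 : m + u ≤ (m + u) * (n + 3) := Nat.le_mul_of_pos_right _ (by omega)
  have e1 : (m : ℤ) + u = ((m + u : ℕ) : ℤ) := by push_cast; rfl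
  have e2 : ((m + u : ℕ) : ℤ) * (n + 3) = (((m + u) * (n + 3) : ℕ) : ℤ) := by push_cast; rfl
  have e3 : (((m + u) * (n + 3) : ℕ) : ℤ) + v = (((m + u) * (n + 3) + v : ℕ) : ℤ) := by push_cast; rfl
  have e4 : (((m + u) * (n + 3) + v : ℕ) : ℤ) * (n + 3) = ((((m + u) * (n + 3) + v) * (n + 3) : ℕ) : ℤ) := by
    push_cast; rfl
  have eset : ∀ a b c d : ℤ, (((s.setReg 22 a).setReg 22 b).setReg 22 c).setReg 22 d = s.setReg 22 d := by
    intro a b c d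
    simp [State.setReg]
  simp only [adrCode, wp_block_cons, wp_block_nil, wp_arith, Op.eval, State.reg_setReg, hrb, hp, hq, hq22,
    hE.r102, Nat.reduceEqDiff, if_true, if_false, e1, e2, e3, e4, eset]
  refine ⟨hbnd _ (by omega), hbnd _ (by omega), hbnd _ (by omega), hbnd _ (by omega), hQ⟩

/-- Fill the table of a role for fixed `p` and `q`. -/
def rowCode (A : Fin 5 → EndPt × EndPt) (r : Role) (rb : ℕ) : Cmd :=
  block [adrCode rb r.p r.q, .const 20 0, .const 21 0, .const 25 0, forLoop 23 24 103 (sweepBody A r)]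

/-- The table entries for fixed `p` and `q` are as they should be. -/
def RowOK (n : ℕ) (f : ℕ → ℕ → ℕ) (A : Fin 5 → EndPt × EndPt) (r : Role) (x : Fin 5 → ℕ) (m : ℕ)
    (mem : ℕ → ℤ) (u v : ℕ) : Prop :=
  ∀ i < n + 2, ∃ a : ℕ, a ≤ n + 1 ∧ mem (adr (n + 3) m u v (sweepPos n r.fwd i)) = a ∧
    ((∃ j < i, Behind r.fwd (r.startVal n x) (sweepPos n r.fwd j)) →
      SweepBest n r.fwd (r.startVal n x) (fun c => gainAt f A (Function.update x r.b c)) i a)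

theorem wp_rowCode {B n W : ℕ} {M : ℕ → ℤ} {f : ℕ → ℕ → ℕ} (hC : Ctx B n W M f)
    (A : Fin 5 → EndPt × EndPt) (r : Role) (hr : r.Fits A) {x : Fin 5 → ℕ} (hxn : ∀ i, x i ≤ n + 1)
    {s : State} (hE : Env n M s) (hx : ∀ i, i ≠ r.b → s.reg (i : Fin 5) = x i) {rb m : ℕ}
    (hrb : s.reg rb = m) (hm : n + 3 ≤ m) (hm' : m ≤ 2 * (n + 3)) :
    WP B (rowCode A r rb) s fun s' t => t ≤ 123 * (n + 2) + 20 ∧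
      (∀ k : ℕ, k ≠ r.b → (k < 10 ∨ 30 ≤ k) → s'.reg k = s.reg k) ∧
      (∀ a, (∀ y ≤ n + 1, a ≠ adr (n + 3) m (x r.p) (x r.q) y) → s'.mem a = s.mem a) ∧
      RowOK n f A r x m s'.mem (x r.p) (x r.q) := by
  have hB := hC.word
  have hn3 : n + 3 ≤ (n + 3) ^ 3 := Nat.le_self_pow (by omega) _
  have hu : x r.p < n + 3 := by have := hxn r.p; omega
  have hv : x r.q < n + 3 := by have := hxn r.q; omega
  obtain ⟨hlo, hhi, -, -⟩ := adr_bounds hm hm' hu hv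
  have hb' := fun k h => (fin5_reg_ne r.b (k := k) h).symm
  rw [rowCode, wp_block_cons]
  refine wp_adrCode hC hE hrb (hx _ hr.b_ne_p.symm) (hx _ hr.b_ne_q.symm) (fin5_reg_ne _ (by omega)) hm hm' hu hv ?_
  set ad := ((m + x r.p) * (n + 3) + x r.q) * (n + 3) with had
  have hadr : ∀ y, adr (n + 3) m (x r.p) (x r.q) y = ad + y := fun y => rfl
  simp only [wp_block_cons, wp_const, abs_zero, Nat.cast_nonneg, true_and]
  refine wp_forLoop (by omega) (by omega) (by omega) (R := n + 2) (by omega)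
    (fun i s' => (∀ k : ℕ, k ≠ r.b → (k < 10 ∨ 30 ≤ k) → s'.reg k = s.reg k) ∧ s'.reg 22 = ad ∧
      SweepAcc n r.fwd (r.startVal n x) (fun c => gainAt f A (Function.update x r.b c)) i s' ∧
      (∀ a, (∀ y ≤ n + 1, a ≠ ad + y) → s'.mem a = s.mem a) ∧
      ∀ k < i, ∃ a : ℕ, a ≤ n + 1 ∧ s'.mem (ad + sweepPos n r.fwd k) = a ∧
        ((∃ j < k, Behind r.fwd (r.startVal n x) (sweepPos n r.fwd j)) →
        SweepBest n r.fwd (r.startVal n x) (fun c => gainAt f A (Function.update x r.b c)) k a)) 120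
    ?_ ?_ ?_ ?_ ?_
  · simp [hE.r103]
  · simp [hE.r104]
  · refine ⟨?_, by simp, ⟨0, by omega, by simp, Or.inl ⟨by simp, by simp⟩⟩, by simp, by simp⟩
    intro k _ hk
    simp only [State.reg_setReg]
    repeat rw [if_neg (by omega)]
  · rintro i hi s1 ⟨h1, h2, h3, h4, h5⟩ h23 h24 h104
    have hE1 : Env n M s1 := by
      refine hE.of_eq (fun k hk _ => h1 k (hb' k (by omega)) (by omega)) (fun a ha => h4 a ?_)
      intro y _
      omega
    refine (wp_sweepBody hC A r hxn hE1 (fun i hi => ?_) h2 hlo hhi h23 hi h3).mono ?_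
    · rw [h1 _ (fun h => hi (Fin.ext h)) (by omega), hx i hi]
    rintro s2 t2 ⟨ht, hr2, hm2, hacc2⟩
    have hne : ∀ k, k ≠ 23 → k ≠ 24 →
        ((s2.setReg 23 (i + 1)).setReg 24 (((n + 2 : ℕ) : ℤ) - (i + 1))).reg k = s2.reg k := by
      intro k h1 h2
      simp only [State.reg_setReg, h1, h2, if_false]
    refine ⟨ht, by rw [hr2 _ (hb' _ (by omega)) (by omega), h23],
      by rw [hr2 _ (hb' _ (by omega)) (by omega), h24],
      by rw [hr2 _ (hb' _ (by omega)) (by omega), h104], ?_, ?_, ?_, ?_, ?_⟩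
    · intro k hk hk'
      rw [hne k (by omega) (by omega), hr2 k hk (by omega), h1 k hk hk']
    · rw [hne _ (by omega) (by omega), hr2 _ (hb' _ (by omega)) (by omega), h2]
    · exact hacc2.congr (hne _ (by omega) (by omega)) (hne _ (by omega) (by omega)) (hne _ (by omega) (by omega))
    · intro a ha
      simp only [State.mem_setReg]
      rw [hm2, if_neg (ha _ (sweepPos_le _ hi)), h4 a ha]
    · intro k hk
      simp only [State.mem_setReg, hm2]
      rcases Nat.lt_succ_iff_lt_or_eq.1 hk with hk | rfl
      · obtain ⟨a, ha, h6, h7⟩ := h5 k hk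
        refine ⟨a, ha, ?_, h7⟩
        rw [if_neg, h6]
        intro h
        have := sweepPos_inj (n := n) (fwd := r.fwd) (by omega) hi (Nat.add_left_cancel h)
        omega
      · obtain ⟨a, ha, h6, h7⟩ := h3
        refine ⟨a, ha, by rw [if_pos rfl, h6], ?_⟩
        rintro ⟨j, hj, hbj⟩
        rcases h7 with ⟨-, h7⟩ | ⟨-, -, h7⟩
        · exact absurd hbj (h7 j hj)
        · exact h7
  · rintro s1 t1 ht ⟨h1, h2, h3, h4, h5⟩ h104
    rw [wp_block_nil]
    exact ⟨by omega, h1, h4, h5⟩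

/-- Fill the table of a role. -/
def fillCode (A : Fin 5 → EndPt × EndPt) (r : Role) (rb : ℕ) : Cmd :=
  block [.const 0 0, .const 1 0, .const 2 0, .const 3 0, .const 4 0,
    forLoop r.p 30 103 (forLoop r.q 31 103 (rowCode A r rb))]

/-- The rows of the table hold what is needed for all positions. -/
theorem RowOK.congr {n : ℕ} {f : ℕ → ℕ → ℕ} {A : Fin 5 → EndPt × EndPt} {r : Role} (hr : r.Fits A)
    {x y : Fin 5 → ℕ} {m : ℕ} {mem : ℕ → ℤ} {u v : ℕ} (h : RowOK n f A r x m mem u v)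
    (hp : x r.p = y r.p) (hq : x r.q = y r.q) : RowOK n f A r y m mem u v := by
  intro i hi
  obtain ⟨a, ha, h1, h2⟩ := h i hi
  refine ⟨a, ha, h1, ?_⟩
  rw [hr.startVal_congr hp hq] at h2
  intro hj
  obtain ⟨h3, h4, h5⟩ := h2 hj
  refine ⟨h3, h4, fun j hj hb => ?_⟩
  have h6 := h5 j hj hb
  -- The gains at `x` and `y` may differ, but the comparison of two candidates depends only on a
  -- difference of gains, which is the same for both.
  have h7 := hr.gainAt_sub_congr f hp hq (sweepPos n r.fwd j) a
  dsimp only at h6 ⊢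
  linarith

/-- The entry at the stop bound is optimal among the positions swept before it and behind the start
bound, and these are exactly the positions strictly between the two bounds. In a backward sweep
position `c` has index `n + 1 - c`. -/
theorem Role.isTable_of_rowOK {n : ℕ} {f : ℕ → ℕ → ℕ} {A : Fin 5 → EndPt × EndPt} {r : Role}
    {m : ℕ} {mem : ℕ → ℤ}
    (h : ∀ x : Fin 5 → ℕ, (∀ i, x i ≤ n + 1) → RowOK n f A r x m mem (x r.p) (x r.q)) :
    r.IsTable n f A fun p q y => (mem (adr (n + 3) m p q y)).toNat := by
  intro x hx c hc1 hc2
  have hsv : r.stopVal n x ≤ n + 1 := by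
    unfold Role.stopVal prevVal nextVal
    split_ifs <;> first | omega | exact hx _
  have hnext : nextVal n x r.b ≤ n + 1 := by
    unfold nextVal
    split_ifs <;> first | omega | exact hx _
  cases hf : r.fwd
  · have e1 : r.stopVal n x = prevVal x r.b := by simp [stopVal, hf]
    have e2 : r.startVal n x = nextVal n x r.b := by simp [startVal, hf]
    obtain ⟨a, ha, h1, h2⟩ := h x hx (n + 1 - r.stopVal n x) (by omega)
    have e3 : sweepPos n r.fwd (n + 1 - r.stopVal n x) = r.stopVal n x := by
      simp only [sweepPos, hf, Bool.false_eq_true, if_false]; omega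
    rw [e3] at h1
    obtain ⟨⟨j, hj, h3⟩, h4, h5⟩ := h2 ⟨n + 1 - c, by omega, by
      simp only [Behind, sweepPos, hf, Bool.false_eq_true, if_false]; omega⟩
    have h6 := h5 (n + 1 - c) (by omega) (by
      simp only [Behind, sweepPos, hf, Bool.false_eq_true, if_false]; omega)
    simp only [Behind, sweepPos, hf, Bool.false_eq_true, if_false] at h3 h4 h6
    dsimp only
    rw [h1, Int.toNat_natCast]
    rw [show n + 1 - (n + 1 - c) = c by omega] at h6
    exact ⟨by omega, h6⟩
  · have e1 : r.stopVal n x = nextVal n x r.b := by simp [stopVal, hf]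
    have e2 : r.startVal n x = prevVal x r.b := by simp [startVal, hf]
    obtain ⟨a, ha, h1, h2⟩ := h x hx (r.stopVal n x) (by omega)
    have e3 : sweepPos n r.fwd (r.stopVal n x) = r.stopVal n x := by simp [sweepPos, hf]
    rw [e3] at h1
    obtain ⟨⟨j, hj, h3⟩, h4, h5⟩ := h2 ⟨c, by omega, by simp only [Behind, sweepPos, hf, if_true]; omega⟩
    have h6 := h5 c (by omega) (by simp only [Behind, sweepPos, hf, if_true]; omega)
    simp only [Behind, sweepPos, hf, if_true] at h3 h4 h6
    dsimp only
    rw [h1, Int.toNat_natCast]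
    exact ⟨by omega, h6⟩

theorem RowOK.of_mem_eq {n : ℕ} {f : ℕ → ℕ → ℕ} {A : Fin 5 → EndPt × EndPt} {r : Role}
    {x : Fin 5 → ℕ} {m : ℕ} {mem mem' : ℕ → ℤ} {u v : ℕ} (h : RowOK n f A r x m mem u v)
    (he : ∀ y ≤ n + 1, mem' (adr (n + 3) m u v y) = mem (adr (n + 3) m u v y)) :
    RowOK n f A r x m mem' u v := by
  intro i hi
  obtain ⟨a, ha, h1, h2⟩ := h i hi
  exact ⟨a, ha, by rw [he _ (sweepPos_le _ hi), h1], h2⟩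

/-- Only `p` and `q` are looped over. The two positions outside `p`, `q` and `b` are initially set
to 0 and need only stay in range: a row computed for one tuple serves every tuple with the same `p`
and `q`, by `RowOK.congr`. -/
theorem wp_fillCode {B n W : ℕ} {M : ℕ → ℤ} {f : ℕ → ℕ → ℕ} (hC : Ctx B n W M f)
    (A : Fin 5 → EndPt × EndPt) (r : Role) (hr : r.Fits A)
    {s : State} (hE : Env n M s) {rb m : ℕ} (hrb40 : 40 ≤ rb)
    (hrb : s.reg rb = m) (hm : n + 3 ≤ m) (hm' : m ≤ 2 * (n + 3)) :
    WP B (fillCode A r rb) s fun s' t => t ≤ (n + 2) * ((n + 2) * (123 * (n + 2) + 23) + 6) + 20 ∧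
      (∀ k : ℕ, 40 ≤ k → s'.reg k = s.reg k) ∧
      (∀ a, (a < m * (n + 3) * (n + 3) ∨ (m + (n + 3)) * (n + 3) * (n + 3) ≤ a) → s'.mem a = s.mem a) ∧
      ∀ x : Fin 5 → ℕ, (∀ i, x i ≤ n + 1) → RowOK n f A r x m s'.mem (x r.p) (x r.q) := by
  have hB := hC.word
  have hn3 : n + 3 ≤ (n + 3) ^ 3 := Nat.le_self_pow (by omega) _
  have hpq : (r.p : ℕ) ≠ r.q := fun h => hr.p_ne_q (Fin.ext h)
  have hbp : (r.p : ℕ) ≠ r.b := fun h => hr.b_ne_p (Fin.ext h.symm)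
  have hbq : (r.q : ℕ) ≠ r.b := fun h => hr.b_ne_q (Fin.ext h.symm)
  have hb5 := r.b.isLt
  have hp5 := r.p.isLt
  have hq5 := r.q.isLt
  have hmlo : (n + 3) ^ 3 ≤ m * (n + 3) * (n + 3) := by
    have : (n + 3) ^ 3 = (n + 3) * (n + 3) * (n + 3) := by ring
    rw [this]
    exact Nat.mul_le_mul_right _ (Nat.mul_le_mul_right _ hm)
  let J : State → Prop := fun s' => (∀ k : ℕ, 40 ≤ k → s'.reg k = s.reg k) ∧
    (∀ a, (a < m * (n + 3) * (n + 3) ∨ (m + (n + 3)) * (n + 3) * (n + 3) ≤ a) → s'.mem a = s.mem a) ∧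
    ∀ i : Fin 5, i ≠ r.p → i ≠ r.q → i ≠ r.b → ∃ c : ℕ, c ≤ n + 1 ∧ s'.reg i = c
  have hJE : ∀ s', J s' → Env n M s' := fun s' h =>
    hE.of_eq (fun k hk _ => h.1 k (by omega)) (fun a ha => h.2.1 a (by omega))
  have hJset : ∀ (s' : State) (k : ℕ) (v : ℤ), J s' → (30 ≤ k ∧ k < 40 ∨ k = r.p ∨ k = r.q) → J (s'.setReg k v) := by
    rintro s' k v ⟨h1, h2, h3⟩ hk
    refine ⟨fun k' hk' => ?_, h2, fun i h4 h5 h6 => ?_⟩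
    · rw [State.reg_setReg, if_neg (by omega), h1 k' hk']
    · have h4' : (i : ℕ) ≠ r.p := fun h => h4 (Fin.ext h)
      have h5' : (i : ℕ) ≠ r.q := fun h => h5 (Fin.ext h)
      rw [State.reg_setReg, if_neg (by omega)]
      exact h3 i h4 h5 h6
  simp only [fillCode, wp_block_cons, wp_const, abs_zero, Nat.cast_nonneg, true_and]
  have hJ0 : J (((((s.setReg 0 0).setReg 1 0).setReg 2 0).setReg 3 0).setReg 4 0) := by
    refine ⟨fun k hk => ?_, fun _ _ => rfl, fun i _ _ _ => ⟨0, by omega, ?_⟩⟩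
    · simp only [State.reg_setReg]
      repeat rw [if_neg (by omega)]
    · fin_cases i <;> simp
  refine wp_forLoop (by omega) (by omega) (by omega) (R := n + 2) (by omega)
    (fun u s' => J s' ∧ ∀ x : Fin 5 → ℕ, (∀ i, x i ≤ n + 1) → x r.p < u →
      RowOK n f A r x m s'.mem (x r.p) (x r.q)) ((n + 2) * (123 * (n + 2) + 23) + 3)
    (by simp [hE.r103]) (by simp [hE.r104]) ?_ ?_ ?_
  · refine ⟨hJset _ _ _ (hJset _ _ _ hJ0 (by omega)) (by omega), ?_⟩
    intro x _ h
    omega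
  · rintro u hu s1 ⟨hJ1, hrow1⟩ hsp hs30 h104
    refine wp_forLoop (by omega) (by omega) (by omega) (R := n + 2) (by omega)
      (fun v s' => J s' ∧ s'.reg r.p = u ∧ s'.reg 30 = ((n + 2 : ℕ) : ℤ) - u ∧
        ∀ x : Fin 5 → ℕ, (∀ i, x i ≤ n + 1) → (x r.p < u ∨ x r.p = u ∧ x r.q < v) →
        RowOK n f A r x m s'.mem (x r.p) (x r.q)) (123 * (n + 2) + 20)
      (by rw [(hJE _ hJ1).r103]; simp) h104 ?_ ?_ ?_
    · refine ⟨hJset _ _ _ (hJset _ _ _ hJ1 (by omega)) (by omega), ?_, ?_, ?_⟩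
      · rw [State.reg_setReg, State.reg_setReg, if_neg (by omega), if_neg (by omega), hsp]
      · rw [State.reg_setReg, State.reg_setReg, if_neg (by omega), if_neg (by omega), hs30]
      · rintro x hx (h | ⟨-, h⟩)
        · exact hrow1 x hx h
        · omega
    · rintro v hv s2 ⟨hJ2, hsp2, hs302, hrow2⟩ hsq hs31 h104'
      -- This is the tuple in the registers, except at `r.b`, where the sweep supplies all values
      -- and 0 is a mere filler.
      let y : Fin 5 → ℕ := fun i => if i = r.p then u else if i = r.q then v else
        if i = r.b then 0 else (s2.reg i).toNat
      have hyp : y r.p = u := by simp [y]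
      have hyq : y r.q = v := by simp [y, hr.p_ne_q.symm]
      have hyn : ∀ i, y i ≤ n + 1 := by
        intro i
        simp only [y]
        split_ifs with h1 h2 h3
        · omega
        · omega
        · omega
        · obtain ⟨c, hc, h4⟩ := hJ2.2.2 i h1 h2 h3
          rw [h4]
          simpa using hc
      have hys : ∀ i, i ≠ r.b → s2.reg (i : Fin 5) = y i := by
        intro i h3
        simp only [y]
        split_ifs with h1 h2
        · rw [h1, hsp2]
        · rw [h2, hsq]
        · obtain ⟨c, hc, h4⟩ := hJ2.2.2 i h1 h2 h3
          rw [h4]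
          simp
      refine (wp_rowCode hC A r hr hyn (hJE _ hJ2) hys (by rw [hJ2.1 rb hrb40, hrb]) hm hm').mono ?_
      rintro s3 t3 ⟨ht3, hr3, hm3, hrow3⟩
      rw [hyp, hyq] at hm3 hrow3
      obtain ⟨-, -, hlo, hhi⟩ := adr_bounds hm hm' (show u < n + 3 by omega) (show v < n + 3 by omega)
      refine ⟨ht3, by rw [hr3 _ hbq (by omega), hsq], by rw [hr3 _ (by omega) (by omega), hs31],
        by rw [hr3 _ (by omega) (by omega), h104'], ?_, ?_, ?_, ?_⟩
      · refine hJset _ _ _ (hJset _ _ _ ⟨?_, ?_, ?_⟩ (by omega)) (by omega)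
        · intro k hk
          rw [hr3 _ (by omega) (by omega), hJ2.1 k hk]
        · intro a ha
          rw [hm3 a (fun y' hy' => ?_), hJ2.2.1 a ha]
          unfold adr
          omega
        · intro i h1 h2 h3
          rw [hr3 _ (fun h => h3 (Fin.ext h)) (by omega)]
          exact hJ2.2.2 i h1 h2 h3
      · rw [State.reg_setReg, State.reg_setReg, if_neg (by omega), if_neg (by omega),
          hr3 _ hbp (by omega), hsp2]
      · rw [State.reg_setReg, State.reg_setReg, if_neg (by omega), if_neg (by omega),
          hr3 _ (by omega) (by omega), hs302]
      · intro x hx hlt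
        simp only [State.mem_setReg]
        by_cases hnew : x r.p = u ∧ x r.q = v
        · have := hrow3.congr hr (y := x) (by rw [hyp, hnew.1]) (by rw [hyq, hnew.2])
          rwa [hnew.1, hnew.2]
        · refine (hrow2 x hx (by omega)).of_mem_eq fun y' hy' => hm3 _ fun y'' hy'' h => hnew ?_
          have h1 := hx r.p
          have h2 := hx r.q
          obtain ⟨h3, h4, -⟩ := adr_inj (by omega) (by omega) (by omega) (by omega) h
          exact ⟨h3, h4⟩
    · rintro s3 t3 ht3 ⟨hJ3, hsp3, hs303, hrow3⟩ h104'
      refine ⟨ht3, hsp3, hs303, h104', hJset _ _ _ (hJset _ _ _ hJ3 (by omega)) (by omega), ?_⟩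
      intro x hx hlt
      have := hx r.q
      exact hrow3 x hx (by omega)
  · rintro s1 t1 ht ⟨hJ1, hrow1⟩ h104
    rw [wp_block_nil]
    rw [show ∀ a : ℕ, a + 3 + 3 = a + 6 from fun _ => rfl] at ht
    refine ⟨by omega, hJ1.1, hJ1.2.1, fun x hx => hrow1 x hx ?_⟩
    have := hx r.p
    omega

/-! ## Combining the tables -/

/-- The registers with the output, and the ends whose positions they hold. -/
def outPts (A : Fin 5 → EndPt × EndPt) : List (ℕ × EndPt) :=
  (List.finRange 5).flatMap fun j : Fin 5 => [(110 + 4 * (j : ℕ), (j, false)), (111 + 4 * (j : ℕ), (j, true)),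
    (112 + 4 * (j : ℕ), (A j).1), (113 + 4 * (j : ℕ), (A j).2)]

theorem map_fst_outPts (A : Fin 5 → EndPt × EndPt) : (outPts A).map Prod.fst = List.range' 110 20 := rfl

/-- Store the positions of ends. -/
def ptsCode (l : List (ℕ × EndPt)) : Cmd := block (l.map fun a => ptCode a.1 a.2)

theorem wp_ptsCode {B n : ℕ} {x : Fin 5 → ℕ} (hxn : ∀ i, x i ≤ n + 1) (hB : n + 2 ≤ B) :
    ∀ (l : List (ℕ × EndPt)), (∀ a ∈ l, 110 ≤ a.1) → (l.map Prod.fst).Nodup → ∀ s : State,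
    s.reg 104 = 1 → (∀ i : Fin 5, s.reg i = x i) →
    WP B (ptsCode l) s fun s' t => t ≤ 2 * l.length + 1 ∧ s'.mem = s.mem ∧
      (∀ k, k ∉ l.map Prod.fst → s'.reg k = s.reg k) ∧ ∀ a ∈ l, s'.reg a.1 = ptPos x a.2
  | [], _, _, s, _, _ => by
    rw [ptsCode, List.map_nil, wp_block_nil]
    simp
  | a :: l, hl, hnd, s, h1, hx => by
    rw [ptsCode, List.map_cons, wp_block_cons]
    rw [List.map_cons, List.nodup_cons] at hnd
    have ha := hl a List.mem_cons_self
    refine wp_ptCode h1 (hx _) (hxn _) hB (by omega) ?_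
    refine (wp_ptsCode hxn hB l (fun b hb => hl b (List.mem_cons_of_mem _ hb)) hnd.2 _ ?_ ?_).mono ?_
    · rw [State.reg_setReg, if_neg (by omega), h1]
    · intro i
      rw [State.reg_setReg, if_neg (by omega), hx]
    · rintro s' t ⟨ht, hm, hr, hv⟩
      refine ⟨by rw [List.length_cons]; omega, hm, fun k hk => ?_, fun b hb => ?_⟩
      · rw [List.map_cons, List.mem_cons, not_or] at hk
        rw [hr k hk.2, State.reg_setReg, if_neg hk.1]
      · rcases List.mem_cons.1 hb with rfl | hb
        · rw [hr _ hnd.1, State.reg_setReg, if_pos rfl]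
        · exact hv b hb

/-- Register `105` holds the gain of a move, and the output registers describe this move. -/
def BestInv (n : ℕ) (f : ℕ → ℕ → ℕ) (s : State) : Prop :=
  ∃ (p : Pattern) (x : Fin 5 → ℕ), Valid n x ∧ s.reg 105 = gainAt f p.added x ∧
    ∀ a ∈ outPts p.added, s.reg a.1 = ptPos x a.2

theorem mem_outPts {A : Fin 5 → EndPt × EndPt} {a : ℕ × EndPt} (ha : a ∈ outPts A) :
    110 ≤ a.1 ∧ a.1 < 130 := by
  have : a.1 ∈ (outPts A).map Prod.fst := List.mem_map_of_mem ha
  rw [map_fst_outPts, List.mem_range'_1] at this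
  omega

theorem BestInv.congr {n : ℕ} {f : ℕ → ℕ → ℕ} {s s' : State} (h : BestInv n f s)
    (hr : ∀ k, 105 ≤ k → k ≠ 106 → s'.reg k = s.reg k) : BestInv n f s' := by
  obtain ⟨p, x, hx, hg, ho⟩ := h
  refine ⟨p, x, hx, by rw [hr _ (by omega) (by omega), hg], fun a ha => ?_⟩
  have := mem_outPts ha
  rw [hr _ (by omega) (by omega), ho a ha]

theorem BestInv.abs_le {n W : ℕ} {f : ℕ → ℕ → ℕ} {s : State} (h : BestInv n f s)
    (hf : ∀ u v, f u v ≤ W) : |s.reg 105| ≤ 5 * W := by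
  obtain ⟨p, x, -, hg, -⟩ := h
  rw [hg]
  exact abs_gainAt_le hf _ _

/-- Save the move with the gain in register `10`. -/
def saveCode (A : Fin 5 → EndPt × EndPt) : Cmd := .seq (.copy 105 10) (ptsCode (outPts A))

theorem wp_saveCode {B n : ℕ} {f : ℕ → ℕ → ℕ} (p : Pattern) {x : Fin 5 → ℕ} (hxn : Valid n x)
    (hB : n + 2 ≤ B) {s : State} (h1 : s.reg 104 = 1) (hx : ∀ i : Fin 5, s.reg i = x i)
    (h10 : s.reg 10 = gainAt f p.added x) :
    WP B (saveCode p.added) s fun s' t => t ≤ 42 ∧ s'.mem = s.mem ∧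
      (∀ k, k ≠ 105 → (k < 110 ∨ 130 ≤ k) → s'.reg k = s.reg k) ∧ s'.reg 105 = s.reg 10 ∧
      BestInv n f s' := by
  rw [saveCode, wp_seq, wp_copy]
  refine (wp_ptsCode hxn.le hB _ (fun a ha => (mem_outPts ha).1) ?_ _ ?_ ?_).mono ?_
  · rw [map_fst_outPts]
    exact List.nodup_range'
  · simp [h1]
  · intro i
    rw [State.reg_setReg, if_neg (by omega), hx]
  · rintro s' t ⟨ht, hm, hr, hv⟩
    rw [map_fst_outPts] at hr
    have h105 : s'.reg 105 = s.reg 10 := by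
      rw [hr 105 (by simp), State.reg_setReg, if_pos rfl]
    refine ⟨?_, hm, fun k hk hk' => ?_, h105, p, x, hxn, by rw [h105, h10], hv⟩
    · have : (outPts p.added).length = 20 := rfl
      omega
    · rw [hr k (by rw [List.mem_range'_1]; omega), State.reg_setReg, if_neg hk]

/-- Run `c` if the values of all pairs of registers are increasing. -/
def checkCode : List (ℕ × ℕ) → Cmd → Cmd
  | [], c => c
  | a :: l, c => .seq (.arith .sub 26 a.2 a.1) (.ifPos 26 (checkCode l c) .skip)

theorem State.setReg_self (s : State) (k : ℕ) : s.setReg k (s.reg k) = s := by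
  simp [State.setReg]

theorem State.setReg_setReg (s : State) (k : ℕ) (u v : ℤ) :
    (s.setReg k u).setReg k v = s.setReg k v := by
  simp [State.setReg]

/-- Each comparison overwrites register 26, so both continuations must work for an arbitrary value
there. -/
theorem wp_checkCode {B Tc : ℕ} {c : Cmd} {R : State → Prop} :
    ∀ (l : List (ℕ × ℕ)) (s : State),
    (∀ a ∈ l, a.1 ≠ 26 ∧ a.2 ≠ 26 ∧ 0 ≤ s.reg a.1 ∧ 0 ≤ s.reg a.2 ∧ s.reg a.1 ≤ B ∧ s.reg a.2 ≤ B) →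
    ((∀ a ∈ l, s.reg a.1 < s.reg a.2) → ∀ v, WP B c (s.setReg 26 v) fun s' t => t ≤ Tc ∧ R s') →
    ((¬ ∀ a ∈ l, s.reg a.1 < s.reg a.2) → ∀ v, R (s.setReg 26 v)) →
    WP B (checkCode l c) s fun s' t => t ≤ Tc + 2 * l.length + 1 ∧ R s'
  | [], s, _, hc, _ => by
    have := hc (by simp) (s.reg 26)
    rw [State.setReg_self] at this
    exact this.mono fun s' t h => ⟨by simp only [List.length_nil]; omega, h.2⟩
  | a :: l, s, hl, hc, hskip => by
    obtain ⟨h1, h2, h3, h4, h5, h6⟩ := hl a List.mem_cons_self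
    simp only [List.forall_mem_cons] at hc hskip
    rw [checkCode, wp_seq, wp_arith, wp_ifPos]
    simp only [Op.eval, State.reg_setReg, if_true, List.length_cons]
    refine ⟨by rw [_root_.abs_le]; omega, fun h => ?_, fun h => ?_⟩
    · have hreg : ∀ b ∈ l, ((s.setReg 26 (s.reg a.2 - s.reg a.1)).reg b.1 = s.reg b.1) ∧
          ((s.setReg 26 (s.reg a.2 - s.reg a.1)).reg b.2 = s.reg b.2) := by
        intro b hb
        obtain ⟨h1, h2, -⟩ := hl b (List.mem_cons_of_mem _ hb)
        simp [h1, h2]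
      refine (wp_checkCode (R := R) (Tc := Tc) l _ ?_ ?_ ?_).mono ?_
      · intro b hb
        rw [(hreg b hb).1, (hreg b hb).2]
        exact hl b (List.mem_cons_of_mem _ hb)
      · intro hb v
        rw [State.setReg_setReg]
        exact hc ⟨by omega, fun b hb' => by
          have := hb b hb'
          rwa [(hreg b hb').1, (hreg b hb').2] at this⟩ v
      · intro hb v
        rw [State.setReg_setReg]
        refine hskip (fun h' => hb fun b hb' => ?_) v
        rw [(hreg b hb').1, (hreg b hb').2]
        exact h'.2 b hb'
      · rintro s' t ⟨ht, hR⟩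
        exact ⟨by omega, hR⟩
    · rw [wp_skip]
      exact ⟨by omega, hskip (fun h' => by have := h'.1; omega) _⟩

/-- The pairs of registers to compare in order to check the validity of a tuple. -/
def validPairs : List (ℕ × ℕ) :=
  (List.finRange 5).flatMap fun i : Fin 5 => [(prevReg i, (i : ℕ)), ((i : ℕ), nextReg i)]

theorem mem_validPairs {a : ℕ × ℕ} : a ∈ validPairs ↔
    ∃ i : Fin 5, a = (prevReg i, (i : ℕ)) ∨ a = ((i : ℕ), nextReg i) := by
  simp [validPairs]

/-- Look up the table of a role. -/
def lookupCode (rb : ℕ) (r : Role) : Cmd :=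
  block [adrCode rb r.p r.q, .arith .add 22 22 r.stopReg, .load r.b 22]

theorem Role.stopReg_ne (r : Role) {k : ℕ} (h1 : 5 ≤ k) (h2 : k < 100) : r.stopReg ≠ k := by
  unfold stopReg
  split_ifs
  · exact nextReg_ne _ h1 h2
  · exact prevReg_ne _ h1 h2

/-- The memory holds the table `T` at `m`. -/
def HoldsTable (n m : ℕ) (mem : ℕ → ℤ) (T : ℕ → ℕ → ℕ → ℕ) : Prop :=
  ∀ u ≤ n + 1, ∀ v ≤ n + 1, ∀ y ≤ n + 1, mem (adr (n + 3) m u v y) = T u v y ∧ T u v y ≤ n + 1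

theorem Role.stopVal_le {r : Role} {n : ℕ} {x : Fin 5 → ℕ} (hx : ∀ i, x i ≤ n + 1) :
    r.stopVal n x ≤ n + 1 := by
  unfold Role.stopVal prevVal nextVal
  split_ifs <;> first | omega | exact hx _

theorem wp_lookupCode {B n W : ℕ} {M : ℕ → ℤ} {f : ℕ → ℕ → ℕ} (hC : Ctx B n W M f) (r : Role)
    {x : Fin 5 → ℕ} (hxn : ∀ i, x i ≤ n + 1) {s : State} (hE : Env n M s) {rb m : ℕ}
    {T : ℕ → ℕ → ℕ → ℕ} (hT : HoldsTable n m s.mem T)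
    (hp : s.reg r.p = x r.p) (hq : s.reg r.q = x r.q) (hsv : s.reg r.stopReg = r.stopVal n x)
    (hrb : s.reg rb = m) (hm : n + 3 ≤ m) (hm' : m ≤ 2 * (n + 3)) :
    WP B (lookupCode rb r) s fun s' t => t ≤ 8 ∧ s'.mem = s.mem ∧
      s'.reg r.b = T (x r.p) (x r.q) (r.stopVal n x) ∧
      ∀ k : ℕ, k ≠ r.b → k ≠ 22 → s'.reg k = s.reg k := by
  have hB := hC.word
  have hu := hxn r.p
  have hv := hxn r.q
  have hst := r.stopVal_le hxn
  obtain ⟨-, hhi, -, -⟩ := adr_bounds hm hm' (show x r.p < n + 3 by omega) (show x r.q < n + 3 by omega)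
  rw [lookupCode, wp_block_cons]
  refine wp_adrCode hC hE hrb hp hq (fin5_reg_ne _ (by omega)) hm hm' (by omega) (by omega) ?_
  have h22 := r.stopReg_ne (k := 22) (by omega) (by omega)
  have hval := (hT _ hu _ hv _ hst).1
  have hadr : ∀ y, adr (n + 3) m (x r.p) (x r.q) y = ((m + x r.p) * (n + 3) + x r.q) * (n + 3) + y :=
    fun y => rfl
  rw [hadr] at hval
  generalize ((m + x r.p) * (n + 3) + x r.q) * (n + 3) = a at *
  simp only [wp_block_cons, wp_block_nil, wp_arith, wp_load, Op.eval, State.reg_setReg, if_true, h22,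
    if_false, hsv, State.mem_setReg]
  rw [← Nat.cast_add, Int.toNat_natCast, hval]
  refine ⟨by rw [_root_.abs_le]; omega, by omega, by omega, trivial, rfl, fun k hk hk' => ?_⟩
  simp only [hk, hk', if_false]

/-- Compute the two optimized positions, and save the move if it is valid and better than the best
move so far. -/
def bodyCode (A : Fin 5 → EndPt × EndPt) (c : Plan) : Cmd :=
  block [lookupCode 102 c.r₁, lookupCode 106 c.r₂, checkCode validPairs
    (block [gainCode A, .arith .sub 26 10 105, .ifPos 26 (saveCode A) .skip])]

theorem Plan.Fits.neighbors {c : Plan} {A : Fin 5 → EndPt × EndPt} (hc : c.Fits A) :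
    (c.r₁.b ≠ 0 → c.r₁.b - 1 ≠ c.r₂.b) ∧ (c.r₂.b ≠ 0 → c.r₂.b - 1 ≠ c.r₁.b) := by
  refine ⟨fun h h' => hc.succ₂ ?_ ?_, fun h h' => hc.succ₁ ?_ ?_⟩
  · rw [← h']; exact Fin5.sub_one_ne_four _ h
  · rw [← h']; simp
  · rw [← h']; exact Fin5.sub_one_ne_four _ h
  · rw [← h']; simp

/-- The loops run over all triples, including those that no valid tuple extends; there the table
entries are meaningless but still in range. Testing the completed tuple before it may replace the
best move ensures that the latter is always a genuine one. -/
theorem wp_bodyCode {B n W : ℕ} {M : ℕ → ℤ} {f : ℕ → ℕ → ℕ} (hC : Ctx B n W M f) (p : Pattern)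
    {c : Plan} (hc : c.Fits p.added) {T₁ T₂ : ℕ → ℕ → ℕ → ℕ} {x : Fin 5 → ℕ}
    (hxn : ∀ i, x i ≤ n + 1) {s : State} (hE : Env n M s)
    (hx : ∀ i, i ≠ c.r₁.b → i ≠ c.r₂.b → s.reg (i : Fin 5) = x i)
    (hT₁ : HoldsTable n (n + 3) s.mem T₁) (hT₂ : HoldsTable n (2 * (n + 3)) s.mem T₂)
    (hbest : BestInv n f s) :
    WP B (bodyCode p.added c) s fun s' t => t ≤ 190 ∧ s'.mem = s.mem ∧
      (∀ k : ℕ, k ≠ c.r₁.b → k ≠ c.r₂.b → (k < 10 ∨ 30 ≤ k) → (k < 105 ∨ k = 106 ∨ 130 ≤ k) →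
        s'.reg k = s.reg k) ∧
      BestInv n f s' ∧ s.reg 105 ≤ s'.reg 105 ∧
      (Valid n (c.complete n T₁ T₂ x) → gainAt f p.added (c.complete n T₁ T₂ x) ≤ s'.reg 105) := by
  have hB := hC.word
  have hn3 : n + 3 ≤ (n + 3) ^ 3 := Nat.le_self_pow (by omega) _
  have hr102 : s.reg 102 = ((n + 3 : ℕ) : ℤ) := by rw [hE.r102]; simp
  have hr106 : s.reg 106 = ((2 * (n + 3) : ℕ) : ℤ) := by rw [hE.r106]; simp
  obtain ⟨hn1, hn2⟩ := hc.neighbors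
  have hbn := hc.b_ne
  have hb1 := c.r₁.b.isLt
  have hb2 := c.r₂.b.isLt
  rw [bodyCode, wp_block_cons]
  refine (wp_lookupCode hC c.r₁ hxn hE hT₁ (hx _ hc.fits₁.b_ne_p.symm hc.p₁)
    (hx _ hc.fits₁.b_ne_q.symm hc.q₁)
    (hE.reg_stopReg ⟨fun h => hx _ (Fin5.add_one_ne _) (hc.succ₁ h),
      fun h => hx _ (Fin5.sub_one_ne _) (hn1 h)⟩) hr102 (by omega) (by omega)).mono ?_
  rintro s1 t1 ⟨ht1, hm1, hv1, hs1⟩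
  have hE1 : Env n M s1 := hE.of_eq (fun k h _ => hs1 k (by omega) (by omega)) (fun a _ => by rw [hm1])
  have hx1 : ∀ i, i ≠ c.r₁.b → i ≠ c.r₂.b → s1.reg (i : Fin 5) = x i := fun i h1 h2 => by
    rw [hs1 _ (fun h => h1 (Fin.ext h)) (by omega), hx i h1 h2]
  rw [wp_block_cons]
  refine (wp_lookupCode (T := T₂) hC c.r₂ hxn hE1 (by rwa [hm1]) (hx1 _ hc.p₂ hc.fits₂.b_ne_p.symm)
    (hx1 _ hc.q₂ hc.fits₂.b_ne_q.symm)
    (hE1.reg_stopReg ⟨fun h => hx1 _ (hc.succ₂ h) (Fin5.add_one_ne _),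
      fun h => hx1 _ (hn2 h) (Fin5.sub_one_ne _)⟩) (by rw [hs1 _ (by omega) (by omega), hr106])
      (by omega) (by omega)).mono ?_
  rintro s2 t2 ⟨ht2, hm2, hv2, hs2⟩
  have hreg2 : ∀ k : ℕ, k ≠ c.r₁.b → k ≠ c.r₂.b → k ≠ 22 → s2.reg k = s.reg k := fun k h1 h2 h3 => by
    rw [hs2 k h2 h3, hs1 k h1 h3]
  have hE2 : Env n M s2 := hE1.of_eq (fun k h _ => hs2 k (by omega) (by omega)) (fun a _ => by rw [hm2])
  have hT1' := (hT₁ _ (hxn c.r₁.p) _ (hxn c.r₁.q) _ (c.r₁.stopVal_le hxn)).2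
  have hT2' := (hT₂ _ (hxn c.r₂.p) _ (hxn c.r₂.q) _ (c.r₂.stopVal_le hxn)).2
  have hy : c.complete n T₁ T₂ x = Function.update (Function.update x c.r₁.b
    (T₁ (x c.r₁.p) (x c.r₁.q) (c.r₁.stopVal n x))) c.r₂.b
    (T₂ (x c.r₂.p) (x c.r₂.q) (c.r₂.stopVal n x)) := rfl
  set y := c.complete n T₁ T₂ x
  have hyr : ∀ i : Fin 5, s2.reg i = y i := by
    intro i
    rw [hy]
    by_cases h2 : i = c.r₂.b
    · rw [h2, Function.update_self, hv2]
    rw [Function.update_of_ne h2, hs2 _ (fun h => h2 (Fin.ext h)) (by omega)]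
    by_cases h1 : i = c.r₁.b
    · rw [h1, Function.update_self, hv1]
    · rw [Function.update_of_ne h1, hx1 i h1 h2]
  have hyn : ∀ i, y i ≤ n + 1 := by
    intro i
    rw [hy]
    by_cases h2 : i = c.r₂.b
    · rw [h2, Function.update_self]; exact hT2'
    rw [Function.update_of_ne h2]
    by_cases h1 : i = c.r₁.b
    · rw [h1, Function.update_self]; exact hT1'
    · rw [Function.update_of_ne h1]; exact hxn i
  have hprev : ∀ i : Fin 5, s2.reg (prevReg i) = prevVal y i := fun i => hE2.reg_prevReg fun _ => hyr _
  have hnext : ∀ i : Fin 5, s2.reg (nextReg i) = nextVal n y i := fun i => hE2.reg_nextReg fun _ => hyr _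
  have hprevn : ∀ i, prevVal y i ≤ n + 1 := fun i => by
    unfold prevVal
    split_ifs <;> first | omega | exact hyn _
  have hnextn : ∀ i, nextVal n y i ≤ n + 1 := fun i => by
    unfold nextVal
    split_ifs <;> first | omega | exact hyn _
  have hvalid : (∀ a ∈ validPairs, s2.reg a.1 < s2.reg a.2) ↔ Valid n y := by
    rw [valid_iff]
    constructor
    · intro h i
      have h1 := h _ (mem_validPairs.2 ⟨i, Or.inl rfl⟩)
      have h2 := h _ (mem_validPairs.2 ⟨i, Or.inr rfl⟩)
      dsimp only at h1 h2
      rw [hprev, hyr] at h1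
      rw [hnext, hyr] at h2
      omega
    · intro h a ha
      obtain ⟨i, rfl | rfl⟩ := mem_validPairs.1 ha <;> dsimp only
      · rw [hprev, hyr]; exact_mod_cast (h i).1
      · rw [hnext, hyr]; exact_mod_cast (h i).2
  have hbest2 : ∀ v, BestInv n f (s2.setReg 26 v) := fun v => hbest.congr fun k h _ => by
    rw [State.reg_setReg, if_neg (by omega), hreg2 k (by omega) (by omega) (by omega)]
  have h105 : s2.reg 105 = s.reg 105 := hreg2 _ (by omega) (by omega) (by omega)
  rw [wp_block_cons]
  refine (wp_checkCode (Tc := 149) (R := fun s' => s'.mem = s.mem ∧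
      (∀ k : ℕ, k ≠ c.r₁.b → k ≠ c.r₂.b → (k < 10 ∨ 30 ≤ k) → (k < 105 ∨ k = 106 ∨ 130 ≤ k) →
        s'.reg k = s.reg k) ∧
      BestInv n f s' ∧ s.reg 105 ≤ s'.reg 105 ∧ (Valid n y → gainAt f p.added y ≤ s'.reg 105))
      validPairs s2 ?_ ?_ ?_).mono ?_
  · intro a ha
    obtain ⟨i, rfl | rfl⟩ := mem_validPairs.1 ha <;> dsimp only
    · rw [hprev, hyr]
      have h1 := hprevn i
      have h2 := hyn i
      exact ⟨prevReg_ne _ (by omega) (by omega), by omega, by omega, by omega, by omega, by omega⟩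
    · rw [hnext, hyr]
      have h1 := hnextn i
      have h2 := hyn i
      exact ⟨by omega, nextReg_ne _ (by omega) (by omega), by omega, by omega, by omega, by omega⟩
  · intro hv v
    rw [hvalid] at hv
    have hE3 : Env n M (s2.setReg 26 v) := hE2.of_eq
      (fun k h _ => by rw [State.reg_setReg, if_neg (by omega)]) (fun a _ => rfl)
    have hyr3 : ∀ i : Fin 5, (s2.setReg 26 v).reg i = y i := fun i => by
      rw [State.reg_setReg, if_neg (by omega), hyr]
    rw [wp_block_cons]
    refine (wp_gainCode hC p.added hE3 hyr3 hyn).mono ?_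
    rintro s4 t4 ⟨ht4, h10, hm4, hs4⟩
    have hg := abs_gainAt_le hC.weight_le p.added y
    have hb5 := hbest.abs_le hC.weight_le
    rw [← h10] at hg
    have hs4' : ∀ k : ℕ, k ≠ c.r₁.b → k ≠ c.r₂.b → (k < 10 ∨ 30 ≤ k) → s4.reg k = s.reg k :=
      fun k h1 h2 h3 => by
        rw [hs4 k (by omega) (by omega) (by omega), State.reg_setReg, if_neg (by omega),
          hreg2 k h1 h2 (by omega)]
    have h105' : s4.reg 105 = s.reg 105 := hs4' _ (by omega) (by omega) (by omega)
    have hm4' : s4.mem = s.mem := by rw [hm4, State.mem_setReg, hm2, hm1]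
    rw [_root_.abs_le] at hg hb5
    simp only [wp_block_cons, wp_arith, Op.eval, wp_ifPos, State.reg_setReg, if_true, h105', wp_skip,
      wp_block_nil]
    refine ⟨by rw [_root_.abs_le]; omega, fun hpos => ?_, fun hneg => ?_⟩
    · refine (wp_saveCode p (x := y) (f := f) hv (by omega) ?_ ?_ ?_).mono ?_
      · rw [State.reg_setReg, if_neg (by omega), hs4' _ (by omega) (by omega) (by omega), hE.r104]
      · intro i
        rw [State.reg_setReg, if_neg (by omega), hs4 _ (by omega) (by omega) (by omega), hyr3]
      · rw [State.reg_setReg, if_neg (by omega), h10]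
      · rintro s5 t5 ⟨ht5, hm5, hs5, h5, hb⟩
        rw [State.reg_setReg, if_neg (by omega)] at h5
        refine ⟨by omega, by rw [hm5, State.mem_setReg, hm4'], ?_, hb, by omega, fun _ => by omega⟩
        intro k h1 h2 h3 h4
        rw [hs5 k (by omega) (by omega), State.reg_setReg, if_neg (by omega), hs4' k h1 h2 h3]
    · refine ⟨by omega, hm4', ?_, ?_, ?_, ?_⟩
      · intro k h1 h2 h3 h4
        rw [if_neg (by omega), hs4' k h1 h2 h3]
      · refine hbest.congr fun k h _ => ?_
        rw [State.reg_setReg, if_neg (by omega), hs4' k (by omega) (by omega) (by omega)]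
      · rw [if_neg (by omega)]
      · intro _
        rw [if_neg (by omega)]
        omega
  · intro hv v
    rw [hvalid] at hv
    refine ⟨by rw [State.mem_setReg, hm2, hm1], fun k h1 h2 h3 _ => ?_, hbest2 v, ?_, fun h => absurd h hv⟩
    · rw [State.reg_setReg, if_neg (by omega), hreg2 k h1 h2 (by omega)]
    · rw [State.reg_setReg, if_neg (by omega), h105]
  · rintro s3 t3 ⟨ht3, hR⟩
    rw [wp_block_nil]
    have : validPairs.length = 10 := rfl
    exact ⟨by omega, hR⟩

/-! ## Processing all patterns -/

/-- Every entry is in range, even where no candidate exists, because the sweep starts with the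
default 0 in register 20. Later weight lookups therefore use proper addresses. -/
theorem HoldsTable.of_rowOK {n : ℕ} {f : ℕ → ℕ → ℕ} {A : Fin 5 → EndPt × EndPt} {r : Role}
    (hr : r.Fits A) {m : ℕ} {mem : ℕ → ℤ}
    (h : ∀ x : Fin 5 → ℕ, (∀ i, x i ≤ n + 1) → RowOK n f A r x m mem (x r.p) (x r.q)) :
    HoldsTable n m mem fun p q y => (mem (adr (n + 3) m p q y)).toNat := by
  intro u hu v hv y hy
  have hq : (if r.q = r.p then u else v) = v := if_neg hr.p_ne_q.symm
  have h1 := h (fun i => if i = r.p then u else v) (fun i => by split_ifs <;> omega)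
  simp only [if_true, hq] at h1
  have h2 : ∃ i < n + 2, sweepPos n r.fwd i = y := by
    unfold sweepPos
    split_ifs
    · exact ⟨y, by omega, rfl⟩
    · exact ⟨n + 1 - y, by omega, by omega⟩
  obtain ⟨i, hi, rfl⟩ := h2
  obtain ⟨a, ha, h3, -⟩ := h1 i hi
  dsimp only
  rw [h3, Int.toNat_natCast]
  exact ⟨rfl, ha⟩

/-- Neither lookup reads one of the two optimized positions. Hence three nested loops reach the
completion of every tuple. -/
theorem Plan.Fits.complete_congr {c : Plan} {A : Fin 5 → EndPt × EndPt} (hc : c.Fits A) {n : ℕ}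
    {T₁ T₂ : ℕ → ℕ → ℕ → ℕ} {x y : Fin 5 → ℕ}
    (h : ∀ i, i ≠ c.r₁.b → i ≠ c.r₂.b → x i = y i) : c.complete n T₁ T₂ x = c.complete n T₁ T₂ y := by
  obtain ⟨hn1, hn2⟩ := hc.neighbors
  have e1 : c.r₁.stopVal n x = c.r₁.stopVal n y := by
    unfold Role.stopVal prevVal nextVal
    split_ifs with h1 h2 h2
    · rfl
    · exact h _ (Fin5.add_one_ne _) (hc.succ₁ h2)
    · rfl
    · exact h _ (Fin5.sub_one_ne _) (hn1 h2)
  have e2 : c.r₂.stopVal n x = c.r₂.stopVal n y := by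
    unfold Role.stopVal prevVal nextVal
    split_ifs with h1 h2 h2
    · rfl
    · exact h _ (hc.succ₂ h2) (Fin5.add_one_ne _)
    · rfl
    · exact h _ (hn2 h2) (Fin5.sub_one_ne _)
  funext i
  unfold Plan.complete
  rw [e1, e2, h _ hc.fits₁.b_ne_p.symm hc.p₁, h _ hc.fits₁.b_ne_q.symm hc.q₁,
    h _ hc.p₂ hc.fits₂.b_ne_p.symm, h _ hc.q₂ hc.fits₂.b_ne_q.symm]
  by_cases h2 : i = c.r₂.b
  · rw [h2, Function.update_self, Function.update_self]
  rw [Function.update_of_ne h2, Function.update_of_ne h2]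
  by_cases h1 : i = c.r₁.b
  · rw [h1, Function.update_self, Function.update_self]
  · rw [Function.update_of_ne h1, Function.update_of_ne h1, h i h1 h2]

theorem Plan.Fits.eq_t {c : Plan} {A : Fin 5 → EndPt × EndPt} (hc : c.Fits A) {i : Fin 5}
    (h1 : i ≠ c.r₁.b) (h2 : i ≠ c.r₂.b) : i = c.t₁ ∨ i = c.t₂ ∨ i = c.t₃ := by
  have h := hc.nodup.length_le_card
  have hall : ∀ j, j ∈ [c.r₁.b, c.r₂.b, c.t₁, c.t₂, c.t₃] := by
    intro j
    have : [c.r₁.b, c.r₂.b, c.t₁, c.t₂, c.t₃].toFinset = Finset.univ := by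
      rw [← Finset.card_eq_iff_eq_univ, List.toFinset_card_of_nodup hc.nodup]
      simp
    rw [← List.mem_toFinset, this]
    exact Finset.mem_univ j
  have := hall i
  simp only [List.mem_cons, List.not_mem_nil, or_false] at this
  tauto

/-- Try all choices of the three positions that are not optimized. -/
def combineCode (A : Fin 5 → EndPt × EndPt) (c : Plan) : Cmd :=
  forLoop c.t₁ 30 103 (forLoop c.t₂ 31 103 (forLoop c.t₃ 32 103 (bodyCode A c)))

theorem wp_combineCode {B n W : ℕ} {M : ℕ → ℤ} {f : ℕ → ℕ → ℕ} (hC : Ctx B n W M f) (p : Pattern)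
    {c : Plan} (hc : c.Fits p.added) {T₁ T₂ : ℕ → ℕ → ℕ → ℕ} {s : State} (hE : Env n M s)
    (hT₁ : HoldsTable n (n + 3) s.mem T₁) (hT₂ : HoldsTable n (2 * (n + 3)) s.mem T₂)
    (hbest : BestInv n f s) :
    WP B (combineCode p.added c) s fun s' t =>
      t ≤ (n + 2) * ((n + 2) * ((n + 2) * 193 + 6) + 6) + 3 ∧ s'.mem = s.mem ∧
      (∀ k : ℕ, 40 ≤ k → (k < 105 ∨ k = 106 ∨ 130 ≤ k) → s'.reg k = s.reg k) ∧
      BestInv n f s' ∧ s.reg 105 ≤ s'.reg 105 ∧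
      ∀ x : Fin 5 → ℕ, (∀ i, x i ≤ n + 1) → Valid n (c.complete n T₁ T₂ x) →
        gainAt f p.added (c.complete n T₁ T₂ x) ≤ s'.reg 105 := by
  have hB := hC.word
  have hn3 : n + 3 ≤ (n + 3) ^ 3 := Nat.le_self_pow (by omega) _
  have hnd := hc.nodup
  simp only [List.nodup_cons, List.mem_cons, List.not_mem_nil, or_false, not_or] at hnd
  obtain ⟨⟨-, d1, d2, d3⟩, ⟨d4, d5, d6⟩, ⟨d7, d8⟩, d9, -⟩ := hnd
  have hv : ∀ {i j : Fin 5}, i ≠ j → (i : ℕ) ≠ j := fun h h' => h (Fin.ext h')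
  replace d1 := hv d1
  replace d2 := hv d2
  replace d3 := hv d3
  replace d4 := hv d4
  replace d5 := hv d5
  replace d6 := hv d6
  have d7' := hv d7
  have d8' := hv d8
  have d9' := hv d9
  have l1 := c.t₁.isLt
  have l2 := c.t₂.isLt
  have l3 := c.t₃.isLt
  have l4 := c.r₁.b.isLt
  have l5 := c.r₂.b.isLt
  let J : State → Prop := fun s' => s'.mem = s.mem ∧
    (∀ k : ℕ, 40 ≤ k → (k < 105 ∨ k = 106 ∨ 130 ≤ k) → s'.reg k = s.reg k) ∧
    BestInv n f s' ∧ s.reg 105 ≤ s'.reg 105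
  have hJE : ∀ s', J s' → Env n M s' := fun s' h =>
    hE.of_eq (fun k hk hk' => h.2.1 k (by omega) (by omega)) (fun a _ => by rw [h.1])
  have hJset : ∀ (s' : State) (k : ℕ) (v : ℤ), J s' → k < 40 → J (s'.setReg k v) := by
    rintro s' k v ⟨h1, h2, h3, h4⟩ hk
    refine ⟨h1, fun k' hk1 hk2 => ?_, h3.congr fun k' hk1 hk2 => ?_, ?_⟩
    · rw [State.reg_setReg, if_neg (by omega), h2 k' hk1 hk2]
    · rw [State.reg_setReg, if_neg (by omega)]
    · rwa [State.reg_setReg, if_neg (by omega)]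
  -- The invariant covers all triples that precede `(u, v, w)` lexicographically.
  let D : ℕ → ℕ → ℕ → ℤ → Prop := fun u v w z => ∀ x : Fin 5 → ℕ, (∀ i, x i ≤ n + 1) →
    (x c.t₁ < u ∨ x c.t₁ = u ∧ (x c.t₂ < v ∨ x c.t₂ = v ∧ x c.t₃ < w)) →
    Valid n (c.complete n T₁ T₂ x) → gainAt f p.added (c.complete n T₁ T₂ x) ≤ z
  refine wp_forLoop (by omega) (by omega) (by omega) (R := n + 2) (by omega)
    (fun u s' => J s' ∧ D u 0 0 (s'.reg 105)) ((n + 2) * ((n + 2) * 193 + 6) + 3)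
    (by simp [hE.r103]) (by simp [hE.r104]) ?_ ?_ ?_
  · refine ⟨hJset _ _ _ (hJset _ _ _ ⟨rfl, fun _ _ _ => rfl, hbest, le_refl _⟩ (by omega)) (by omega), ?_⟩
    intro x _ h
    omega
  · rintro u hu s1 ⟨hJ1, hD1⟩ ht1 h30 h104
    refine wp_forLoop (by omega) (by omega) (by omega) (R := n + 2) (by omega)
      (fun v s' => J s' ∧ s'.reg c.t₁ = u ∧ s'.reg 30 = ((n + 2 : ℕ) : ℤ) - u ∧ D u v 0 (s'.reg 105))
      ((n + 2) * 193 + 3) (by rw [(hJE _ hJ1).r103]; simp) h104 ?_ ?_ ?_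
    · refine ⟨hJset _ _ _ (hJset _ _ _ hJ1 (by omega)) (by omega), ?_, ?_, ?_⟩
      · rw [State.reg_setReg, State.reg_setReg, if_neg (by omega), if_neg (by omega), ht1]
      · rw [State.reg_setReg, State.reg_setReg, if_neg (by omega), if_neg (by omega), h30]
      · rw [State.reg_setReg, State.reg_setReg, if_neg (by omega), if_neg (by omega)]
        exact fun x hx h => hD1 x hx (by omega)
    · rintro v hv s2 ⟨hJ2, ht12, h302, hD2⟩ ht2 h31 h104
      refine wp_forLoop (by omega) (by omega) (by omega) (R := n + 2) (by omega)
        (fun w s' => J s' ∧ s'.reg c.t₁ = u ∧ s'.reg 30 = ((n + 2 : ℕ) : ℤ) - u ∧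
          s'.reg c.t₂ = v ∧ s'.reg 31 = ((n + 2 : ℕ) : ℤ) - v ∧ D u v w (s'.reg 105))
        190 (by rw [(hJE _ hJ2).r103]; simp) h104 ?_ ?_ ?_
      · refine ⟨hJset _ _ _ (hJset _ _ _ hJ2 (by omega)) (by omega), ?_, ?_, ?_, ?_, ?_⟩ <;>
          rw [State.reg_setReg, State.reg_setReg, if_neg (by omega), if_neg (by omega)]
        exacts [ht12, h302, ht2, h31, fun x hx h => hD2 x hx (by omega)]
      · rintro w hw s3 ⟨hJ3, ht13, h303, ht23, h313, hD3⟩ ht3 h32 h104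
        let y : Fin 5 → ℕ := fun i => if i = c.t₁ then u else if i = c.t₂ then v else
          if i = c.t₃ then w else 0
        have hyn : ∀ i, y i ≤ n + 1 := by
          intro i
          simp only [y]
          split_ifs <;> omega
        have hys : ∀ i, i ≠ c.r₁.b → i ≠ c.r₂.b → s3.reg (i : Fin 5) = y i := by
          intro i h1 h2
          rcases hc.eq_t h1 h2 with rfl | rfl | rfl
          · simp [y, ht13]
          · simp [y, Ne.symm d7, ht23]
          · simp [y, Ne.symm d8, Ne.symm d9, ht3]
        refine (wp_bodyCode hC p hc hyn (hJE _ hJ3) hys (by rwa [hJ3.1]) (by rwa [hJ3.1]) hJ3.2.2.1).mono ?_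
        rintro s4 t4 ⟨ht4, hm4, hr4, hb4, hle4, hg4⟩
        have hJ4 : J s4 := ⟨by rw [hm4, hJ3.1], fun k h1 h2 => by
          rw [hr4 k (by omega) (by omega) (by omega) h2, hJ3.2.1 k h1 h2], hb4, hJ3.2.2.2.trans hle4⟩
        refine ⟨ht4, by rw [hr4 _ (by omega) (by omega) (by omega) (by omega), ht3],
          by rw [hr4 _ (by omega) (by omega) (by omega) (by omega), h32],
          by rw [hr4 _ (by omega) (by omega) (by omega) (by omega), h104],
          hJset _ _ _ (hJset _ _ _ hJ4 (by omega)) (by omega), ?_, ?_, ?_, ?_, ?_⟩ <;>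
          rw [State.reg_setReg, State.reg_setReg, if_neg (by omega), if_neg (by omega)]
        · rw [hr4 _ (by omega) (by omega) (by omega) (by omega), ht13]
        · rw [hr4 _ (by omega) (by omega) (by omega) (by omega), h303]
        · rw [hr4 _ (by omega) (by omega) (by omega) (by omega), ht23]
        · rw [hr4 _ (by omega) (by omega) (by omega) (by omega), h313]
        · intro x hx hlt hval
          by_cases hnew : x c.t₁ = u ∧ x c.t₂ = v ∧ x c.t₃ = w
          · have he : c.complete n T₁ T₂ x = c.complete n T₁ T₂ y := by
              refine hc.complete_congr fun i h1 h2 => ?_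
              rcases hc.eq_t h1 h2 with rfl | rfl | rfl
              · simp [y, hnew]
              · simp [y, Ne.symm d7, hnew]
              · simp [y, Ne.symm d8, Ne.symm d9, hnew]
            rw [he] at hval ⊢
            exact hg4 hval
          · exact (hD3 x hx (by omega) hval).trans hle4
      · rintro s3 t3 ht3' ⟨hJ3, ht13, h303, ht23, h313, hD3⟩ h104'
        refine ⟨ht3', ht23, h313, h104', hJset _ _ _ (hJset _ _ _ hJ3 (by omega)) (by omega), ?_, ?_, ?_⟩ <;>
          rw [State.reg_setReg, State.reg_setReg, if_neg (by omega), if_neg (by omega)]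
        exacts [ht13, h303, fun x hx h => hD3 x hx (by have := hx c.t₃; omega)]
    · rintro s2 t2 ht2' ⟨hJ2, ht12, h302, hD2⟩ h104'
      refine ⟨ht2', ht12, h302, h104', hJset _ _ _ (hJset _ _ _ hJ2 (by omega)) (by omega), ?_⟩
      rw [State.reg_setReg, State.reg_setReg, if_neg (by omega), if_neg (by omega)]
      exact fun x hx h => hD2 x hx (by have := hx c.t₂; omega)
  · rintro s1 t1 ht ⟨hJ1, hD1⟩ -
    exact ⟨ht, hJ1.1, hJ1.2.1, hJ1.2.2.1, hJ1.2.2.2, fun x hx => hD1 x hx (by have := hx c.t₁; omega)⟩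

/-- A plan that fits to a pattern. -/
noncomputable def Pattern.plan (p : Pattern) : Plan := p.exists_plan.choose

theorem Pattern.plan_fits (p : Pattern) : p.plan.Fits p.added := p.exists_plan.choose_spec

/-- Improve the best move by an optimal move with the pattern `p`. -/
noncomputable def processCode (p : Pattern) : Cmd :=
  block [fillCode p.added p.plan.r₁ 102, fillCode p.added p.plan.r₂ 106, combineCode p.added p.plan]

theorem process_time_le (n : ℕ) : 2 * ((n + 2) * ((n + 2) * (123 * (n + 2) + 23) + 6) + 20) +
    ((n + 2) * ((n + 2) * ((n + 2) * 193 + 6) + 6) + 3) + 1 ≤ 600 * (n + 3) ^ 3 := by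
  ring_nf
  nlinarith [Nat.zero_le n]

theorem wp_processCode {B n W : ℕ} {M : ℕ → ℤ} {f : ℕ → ℕ → ℕ} (hC : Ctx B n W M f) (p : Pattern)
    {s : State} (hE : Env n M s) (hbest : BestInv n f s) :
    WP B (processCode p) s fun s' t => t ≤ 600 * (n + 3) ^ 3 ∧ Env n M s' ∧ BestInv n f s' ∧
      s.reg 105 ≤ s'.reg 105 ∧ ∀ x, Valid n x → gainAt f p.added x ≤ s'.reg 105 := by
  have hc := p.plan_fits
  rw [processCode, wp_block_cons]
  refine (wp_fillCode hC p.added p.plan.r₁ hc.fits₁ hE (m := n + 3) (by omega) (by rw [hE.r102]; simp)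
    le_rfl (by omega)).mono ?_
  rintro s1 t1 ⟨ht1, hr1, hm1, hrow1⟩
  have hN : (n + 3) * (n + 3) * (n + 3) = (n + 3) ^ 3 := by ring
  have hN2 : (n + 3 + (n + 3)) * (n + 3) * (n + 3) = 2 * (n + 3) ^ 3 := by ring
  have hN3 : (2 * (n + 3)) * (n + 3) * (n + 3) = 2 * (n + 3) ^ 3 := by ring
  have hE1 : Env n M s1 := hE.of_eq (fun k hk _ => hr1 k (by omega)) (fun a ha => hm1 a (by omega))
  rw [wp_block_cons]
  refine (wp_fillCode hC p.added p.plan.r₂ hc.fits₂ hE1 (m := 2 * (n + 3)) (by omega)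
    (by rw [hE1.r106]; simp) (by omega) (by omega)).mono ?_
  rintro s2 t2 ⟨ht2, hr2, hm2, hrow2⟩
  have hE2 : Env n M s2 := hE1.of_eq (fun k hk _ => hr2 k (by omega)) (fun a ha => hm2 a (by omega))
  have hrow1' : ∀ x : Fin 5 → ℕ, (∀ i, x i ≤ n + 1) →
      RowOK n f p.added p.plan.r₁ x (n + 3) s2.mem (x p.plan.r₁.p) (x p.plan.r₁.q) := by
    intro x hx
    -- The first table ends where the second begins, so filling the second one leaves it intact.
    refine (hrow1 x hx).of_mem_eq fun y hy => hm2 _ (Or.inl ?_)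
    have h1 := hx p.plan.r₁.p
    have h2 := hx p.plan.r₁.q
    obtain ⟨-, -, -, h3⟩ := adr_bounds (N := n + 3) (m := n + 3) le_rfl (by omega)
      (show x p.plan.r₁.p < n + 3 by omega) (show x p.plan.r₁.q < n + 3 by omega)
    unfold adr
    omega
  have hbest2 : BestInv n f s2 := hbest.congr fun k hk _ => by rw [hr2 k (by omega), hr1 k (by omega)]
  rw [wp_block_cons]
  refine (wp_combineCode hC p hc hE2 (HoldsTable.of_rowOK hc.fits₁ hrow1')
    (HoldsTable.of_rowOK hc.fits₂ hrow2) hbest2).mono ?_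
  rintro s3 t3 ⟨ht3, hm3, hr3, hb3, hle3, hg3⟩
  rw [wp_block_nil]
  have htime := process_time_le n
  refine ⟨by omega, ?_, hb3, ?_, fun x hx => ?_⟩
  · exact hE2.of_eq (fun k hk hk' => hr3 k (by omega) (by omega)) (fun a _ => by rw [hm3])
  · rwa [hr2 105 (by omega), hr1 105 (by omega)] at hle3
  -- An arbitrary valid tuple is dominated by its completion, which is among the tuples that were
  -- tried.
  · obtain ⟨h1, h2⟩ := hc.exchange (Role.isTable_of_rowOK hrow1') (Role.isTable_of_rowOK hrow2) hx
    exact h2.trans (hg3 x hx.le h1)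

theorem wp_processAll {B n W : ℕ} {M : ℕ → ℤ} {f : ℕ → ℕ → ℕ} (hC : Ctx B n W M f) :
    ∀ (l : List Pattern) (s : State), Env n M s → BestInv n f s →
    WP B (block (l.map processCode)) s fun s' t => t ≤ l.length * (600 * (n + 3) ^ 3) + 1 ∧
      Env n M s' ∧ BestInv n f s' ∧ s.reg 105 ≤ s'.reg 105 ∧
      ∀ p ∈ l, ∀ x, Valid n x → gainAt f p.added x ≤ s'.reg 105
  | [], s, hE, hb => by
    rw [List.map_nil, wp_block_nil]
    simp [hE, hb]
  | p :: l, s, hE, hb => by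
    rw [List.map_cons, wp_block_cons]
    refine (wp_processCode hC p hE hb).mono ?_
    rintro s1 t1 ⟨ht1, hE1, hb1, hle1, hg1⟩
    refine (wp_processAll hC l s1 hE1 hb1).mono ?_
    rintro s2 t2 ⟨ht2, hE2, hb2, hle2, hg2⟩
    refine ⟨by rw [List.length_cons, Nat.succ_mul]; omega, hE2, hb2, hle1.trans hle2, fun q hq x hx => ?_⟩
    rcases List.mem_cons.1 hq with rfl | hq
    · exact (hg1 x hx).trans hle2
    · exact hg2 q hq x hx

/-! ## Preparation and output -/

/-- The memory holds the tour and the weights. -/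
structure IsInput {n : ℕ} (m : ℕ → ℤ) (w : Sym2 (Fin n) → ℕ) (g : ℕ → Fin n) : Prop where
  zero : m 0 = n
  vertex : ∀ i < n, m (i + 1) = (g i : ℕ)
  weight : ∀ a b : Fin n, m (n + 1 + (a * n + b)) = w s(a, b)

/-- `dst := ` the vertex at the position in `src`. -/
def vtxCode (dst src : ℕ) : Cmd :=
  .seq (.arith .sub 26 101 src) (.ifPos 26 (.ifPos src (.load dst src) (.load dst 104))
    (.seq (.arith .sub dst 104 26) (.load dst dst)))

/-- Positions from 1 to `n` are read directly. Position 0 is treated as position 1, in accordance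
with truncated subtraction in `u - 1`. Positions `n + 1` and `n + 2` wrap around: the address `1 -
(n + 1 - u)` equals `u - n`. -/
theorem wp_vtxCode {B n : ℕ} {m : ℕ → ℤ} {w : Sym2 (Fin n) → ℕ} {g : ℕ → Fin n}
    (hI : IsInput m w g) (hper : ∀ i, g (i + n) = g i) (hn : 3 ≤ n) (hB : n + 3 ≤ B) {s : State}
    (h101 : s.reg 101 = n + 1) (h104 : s.reg 104 = 1) (hm : ∀ a ≤ n, s.mem a = m a) {dst src u : ℕ}
    (hu : s.reg src = u) (hun : u ≤ n + 2) (hsrc : src ≠ 26) :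
    WP B (vtxCode dst src) s fun s' t => t ≤ 5 ∧ s'.mem = s.mem ∧ s'.reg dst = (g (u - 1) : ℕ) ∧
      ∀ k, k ≠ 26 → k ≠ dst → s'.reg k = s.reg k := by
  simp only [vtxCode, wp_seq, wp_arith, Op.eval, wp_ifPos, State.reg_setReg, if_true, wp_load, hsrc,
    if_false, hu, h101, h104, State.mem_setReg, Nat.reduceEqDiff]
  refine ⟨by rw [_root_.abs_le]; omega, fun h => ⟨fun h' => ⟨by omega, by omega, trivial, ?_, ?_⟩,
    fun h' => ⟨by omega, by omega, trivial, ?_, ?_⟩⟩,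
    fun h => ⟨by rw [_root_.abs_le]; omega, by omega, by omega, trivial, ?_, ?_⟩⟩
  · have h1 := hI.vertex (u - 1) (by omega)
    rw [Nat.sub_add_cancel (by omega)] at h1
    rw [Int.toNat_natCast, hm _ (by omega), h1]
  · intro k h1 h2
    simp only [h1, h2, if_false]
  · have h1 := hI.vertex 0 (by omega)
    obtain rfl : u = 0 := by omega
    rw [Int.toNat_one, hm _ (by omega)]
    exact h1
  · intro k h1 h2
    simp only [h1, h2, if_false]
  · have h1 := hI.vertex (u - n - 1) (by omega)
    rw [show (1 - ((n : ℤ) + 1 - u)).toNat = u - n - 1 + 1 by omega, hm _ (by omega), h1,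
      ← hper (u - n - 1), show u - n - 1 + n = u - 1 by omega]
  · intro k h1 h2
    simp only [h1, h2, if_false]

/-- Copy the weight between the positions in the registers `30` and `31` to the table. -/
def prepBody : Cmd :=
  block [vtxCode 20 30, vtxCode 21 31, .arith .sub 22 101 104, .arith .mul 22 20 22,
    .arith .add 22 22 21, .arith .add 22 101 22, .load 10 22, .arith .add 22 102 30,
    .arith .mul 22 22 102, .arith .add 22 22 31, .store 22 10]

/-- The input occupies cells below `(n + 3) * (n + 3)`, and the new matrix begins at this address,
so the input stays readable throughout. -/
theorem wp_prepBody {B n : ℕ} {m : ℕ → ℤ} {w : Sym2 (Fin n) → ℕ} {g : ℕ → Fin n}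
    (hI : IsInput m w g) (hper : ∀ i, g (i + n) = g i) (hn : 3 ≤ n) (hB : 100 * (n + 3) ^ 3 ≤ B)
    {s : State} (h101 : s.reg 101 = n + 1) (h102 : s.reg 102 = n + 3) (h104 : s.reg 104 = 1)
    (hm : ∀ a < (n + 3) * (n + 3), s.mem a = m a) {u v : ℕ}
    (hu : s.reg 30 = u) (hun : u ≤ n + 2) (hv : s.reg 31 = v) (hvn : v ≤ n + 2) :
    WP B prepBody s fun s' t => t ≤ 20 ∧ (∀ k, 30 ≤ k → s'.reg k = s.reg k) ∧
      ∀ a, s'.mem a = if a = (n + 3 + u) * (n + 3) + v then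
        (w s(g (u - 1), g (v - 1)) : ℤ) else s.mem a := by
  have hn3 : n + 3 ≤ (n + 3) ^ 3 := Nat.le_self_pow (by omega) _
  have hlow : n ≤ (n + 3) * (n + 3) - 1 := by
    have : (n + 3) * 1 ≤ (n + 3) * (n + 3) := Nat.mul_le_mul_left _ (by omega)
    omega
  rw [prepBody, wp_block_cons]
  refine (wp_vtxCode hI hper hn (by omega) h101 h104 (fun a ha => hm a (by omega)) hu hun (by omega)).mono ?_
  rintro s1 t1 ⟨ht1, hm1, h1, hr1⟩
  rw [wp_block_cons]
  refine (wp_vtxCode hI hper hn (by omega) (s := s1) (u := v) (by rw [hr1 _ (by omega) (by omega), h101])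
    (by rw [hr1 _ (by omega) (by omega), h104])
    (fun a ha => by rw [hm1, hm a (by omega)]) (by rw [hr1 _ (by omega) (by omega), hv]) hvn (by omega)).mono ?_
  rintro s2 t2 ⟨ht2, hm2, h2, hr2⟩
  have hr : ∀ k, 30 ≤ k → s2.reg k = s.reg k := fun k hk => by
    rw [hr2 k (by omega) (by omega), hr1 k (by omega) (by omega)]
  have h20 : s2.reg 20 = (g (u - 1) : ℕ) := by rw [hr2 20 (by omega) (by omega), h1]
  have hw := hI.weight (g (u - 1)) (g (v - 1))
  have hg1 := (g (u - 1)).isLt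
  have hg2 := (g (v - 1)).isLt
  generalize g (u - 1) = a at *
  generalize g (v - 1) = b at *
  have hab : (a : ℕ) * n + n ≤ n * n := by
    have : ((a : ℕ) + 1) * n ≤ n * n := Nat.mul_le_mul_right _ hg1
    rwa [Nat.succ_mul] at this
  have hnn : n * n + 6 * n + 9 = (n + 3) * (n + 3) := by ring
  have hadr := pow_three_mono_bounds (N := n + 3) (by omega) (show u < n + 3 by omega)
    (show v < n + 3 by omega)
  have hsq : (n + 3) * (n + 3) ≤ (n + 3 + u) * (n + 3) := Nat.mul_le_mul_right _ (by omega)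
  have hle : n + 3 + u ≤ (n + 3 + u) * (n + 3) := Nat.le_mul_of_pos_right _ (by omega)
  have hbnd : ∀ z : ℕ, z ≤ B → |(z : ℤ)| ≤ (B : ℤ) := fun z h1 => by
    rw [abs_of_nonneg (by positivity)]
    exact_mod_cast h1
  have e1 : (n : ℤ) + 1 - 1 = (n : ℕ) := by ring
  have e2 : ((a : ℕ) : ℤ) * (n : ℕ) = ((a * n : ℕ) : ℤ) := by push_cast; rfl
  have e3 : ((a * n : ℕ) : ℤ) + (b : ℕ) = ((a * n + b : ℕ) : ℤ) := by push_cast; rfl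
  have e4 : (n : ℤ) + 1 + ((a * n + b : ℕ) : ℤ) = ((n + 1 + (a * n + b) : ℕ) : ℤ) := by push_cast; ring
  have e5 : (n : ℤ) + 3 + u = ((n + 3 + u : ℕ) : ℤ) := by push_cast; rfl
  have e6 : ((n + 3 + u : ℕ) : ℤ) * (n + 3) = (((n + 3 + u) * (n + 3) : ℕ) : ℤ) := by push_cast; rfl
  have e7 : (((n + 3 + u) * (n + 3) : ℕ) : ℤ) + v = (((n + 3 + u) * (n + 3) + v : ℕ) : ℤ) := by
    push_cast; rfl
  have hmem : s2.mem (n + 1 + (a * n + b)) = w s(a, b) := by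
    rw [hm2, hm1, hm _ (by omega), hw]
  simp only [wp_block_cons, wp_block_nil, wp_arith, Op.eval, State.reg_setReg, if_true, if_false, wp_load,
    wp_store, State.mem_setReg, Nat.reduceEqDiff, hr 101, hr 104, hr 102, hr 30, hr 31, Nat.reduceLeDiff, le_refl,
    h101, h102, h104, hu, hv, h20, h2, e1, e2, e3, e4, e5, e6, e7, Int.toNat_natCast, hmem, State.reg_setMem,
    State.mem_setMem, hm2, hm1]
  refine ⟨hbnd _ (by omega), hbnd _ (by omega), hbnd _ (by omega), hbnd _ (by omega), by positivity,
    hbnd _ (by omega), hbnd _ (by omega), hbnd _ (by omega), by positivity, by omega, ?_, fun c => trivial⟩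
  intro k hk
  repeat rw [if_neg (by omega)]
  exact hr k hk

/-- Fill the table of the weights between positions. -/
def prepCode : Cmd := forLoop 30 32 102 (forLoop 31 33 102 prepBody)

theorem wp_prepCode {B n : ℕ} {m : ℕ → ℤ} {w : Sym2 (Fin n) → ℕ} {g : ℕ → Fin n}
    (hI : IsInput m w g) (hper : ∀ i, g (i + n) = g i) (hn : 3 ≤ n) (hB : 100 * (n + 3) ^ 3 ≤ B)
    {s : State} (h101 : s.reg 101 = n + 1) (h102 : s.reg 102 = n + 3) (h104 : s.reg 104 = 1)
    (hm : s.mem = m) :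
    WP B prepCode s fun s' t => t ≤ (n + 3) * ((n + 3) * 23 + 6) + 3 ∧
      (∀ k, 100 ≤ k → s'.reg k = s.reg k) ∧ (∀ a < (n + 3) * (n + 3), s'.mem a = m a) ∧
      ∀ u ≤ n + 2, ∀ v ≤ n + 2, s'.mem ((n + 3 + u) * (n + 3) + v) = w s(g (u - 1), g (v - 1)) := by
  have hn3 : n + 3 ≤ (n + 3) ^ 3 := Nat.le_self_pow (by omega) _
  let J : State → Prop := fun s' => (∀ k, 100 ≤ k → s'.reg k = s.reg k) ∧
    ∀ a < (n + 3) * (n + 3), s'.mem a = m a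
  have hJset : ∀ (s' : State) (k : ℕ) (v : ℤ), J s' → k < 100 → J (s'.setReg k v) := by
    rintro s' k v ⟨h1, h2⟩ hk
    exact ⟨fun k' hk' => by rw [State.reg_setReg, if_neg (by omega), h1 k' hk'], h2⟩
  let D : ℕ → ℕ → State → Prop := fun u v s' => ∀ u' v', u' ≤ n + 2 → v' ≤ n + 2 →
    (u' < u ∨ u' = u ∧ v' < v) → s'.mem ((n + 3 + u') * (n + 3) + v') = w s(g (u' - 1), g (v' - 1))
  refine wp_forLoop (by omega) (by omega) (by omega) (R := n + 3) (by omega)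
    (fun u s' => J s' ∧ D u 0 s') ((n + 3) * 23 + 3) (by simp [h102]) h104 ?_ ?_ ?_
  · refine ⟨hJset _ _ _ (hJset _ _ _ ⟨fun _ _ => rfl, fun _ _ => by rw [hm]⟩ (by omega)) (by omega), ?_⟩
    intro u v _ _ h
    omega
  · rintro u hu s1 ⟨hJ1, hD1⟩ h30 h32 h104'
    refine wp_forLoop (by omega) (by omega) (by omega) (R := n + 3) (by omega)
      (fun v s' => J s' ∧ s'.reg 30 = u ∧ s'.reg 32 = ((n + 3 : ℕ) : ℤ) - u ∧ D u v s') 20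
      (by rw [hJ1.1 _ (by omega), h102]; simp) h104' ?_ ?_ ?_
    · refine ⟨hJset _ _ _ (hJset _ _ _ hJ1 (by omega)) (by omega), ?_, ?_, ?_⟩
      · simp [h30]
      · simp [h32]
      · exact hD1
    · rintro v hv s2 ⟨hJ2, h302, h322, hD2⟩ h31 h33 h104''
      refine (wp_prepBody hI hper hn hB (s := s2) (by rw [hJ2.1 _ (by omega), h101])
        (by rw [hJ2.1 _ (by omega), h102]) h104'' hJ2.2 h302 (by omega) h31 (by omega)).mono ?_
      rintro s3 t3 ⟨ht3, hr3, hm3⟩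
      have hsq : (n + 3) * (n + 3) ≤ (n + 3 + u) * (n + 3) := Nat.mul_le_mul_right _ (by omega)
      refine ⟨ht3, by rw [hr3 _ (by omega), h31], by rw [hr3 _ (by omega), h33],
        by rw [hr3 _ (by omega), h104''], hJset _ _ _ (hJset _ _ _ ⟨?_, ?_⟩ (by omega)) (by omega),
        ?_, ?_, ?_⟩
      · intro k hk
        rw [hr3 k (by omega), hJ2.1 k hk]
      · intro a ha
        rw [hm3, if_neg (by omega), hJ2.2 a ha]
      · simp [hr3 30, h302]
      · simp [hr3 32, h322]
      · intro u' v' hu' hv' h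
        rw [State.mem_setReg, State.mem_setReg, hm3]
        split_ifs with he
        · obtain ⟨h1, rfl⟩ := mul_add_inj (by omega) (by omega) he
          obtain rfl : u' = u := by omega
          rfl
        · refine hD2 u' v' hu' hv' ?_
          by_contra h'
          obtain ⟨rfl, rfl⟩ : u' = u ∧ v' = v := by omega
          exact he rfl
    · rintro s2 t2 ht2 ⟨hJ2, h302, h322, hD2⟩ h104''
      refine ⟨ht2, h302, h322, h104'', hJset _ _ _ (hJset _ _ _ hJ2 (by omega)) (by omega), ?_⟩
      exact fun u' v' hu' hv' h => hD2 u' v' hu' hv' (by omega)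
  · rintro s1 t1 ht ⟨hJ1, hD1⟩ -
    exact ⟨ht, hJ1.1, hJ1.2, fun u hu v hv => hD1 u v hu hv (by omega)⟩

/-- The pattern of the first candidate. -/
def firstPattern : Pattern := (1, fun _ => true)

/-- Start with the move that `firstPattern` describes at the first five positions. -/
def initCode : Cmd :=
  block [.const 0 1, .const 1 2, .const 2 3, .const 3 4, .const 4 5, gainCode firstPattern.added,
    saveCode firstPattern.added]

/-- The first candidate puts the removed edges back: it keeps the order and the orientation of all
segments. It gives `BestInv` a genuine move from the outset and requires five positions to exist. -/
theorem wp_initCode {B n W : ℕ} {M : ℕ → ℤ} {f : ℕ → ℕ → ℕ} (hC : Ctx B n W M f) (hn : 5 ≤ n)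
    {s : State} (hE : Env n M s) :
    WP B initCode s fun s' t => t ≤ 151 ∧ Env n M s' ∧ BestInv n f s' := by
  have hB := hC.word
  have hn3 : n + 3 ≤ (n + 3) ^ 3 := Nat.le_self_pow (by omega) _
  have hx : Valid n fun i : Fin 5 => (i : ℕ) + 1 :=
    ⟨fun i j h => by simpa using h, by simp, by simpa using hn⟩
  simp only [initCode, wp_block_cons, wp_const]
  refine ⟨by rw [_root_.abs_le]; omega, by rw [_root_.abs_le]; omega, by rw [_root_.abs_le]; omega,
    by rw [_root_.abs_le]; omega, by rw [_root_.abs_le]; omega, ?_⟩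
  set s1 := ((((s.setReg 0 1).setReg 1 2).setReg 2 3).setReg 3 4).setReg 4 5 with hs1
  have hE1 : Env n M s1 := by
    refine hE.of_eq (fun k hk _ => ?_) (fun a _ => rfl)
    simp only [hs1, State.reg_setReg]
    repeat rw [if_neg (by omega)]
  have hx1 : ∀ i : Fin 5, s1.reg i = ((fun i : Fin 5 => (i : ℕ) + 1) i : ℕ) := by
    intro i
    fin_cases i <;> simp [hs1]
  refine (wp_gainCode hC firstPattern.added hE1 hx1 hx.le).mono ?_
  rintro s2 t2 ⟨ht2, h10, hm2, hr2⟩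
  refine (wp_saveCode firstPattern hx (by omega) (s := s2) (f := f) ?_ ?_ h10).mono ?_
  · rw [hr2 _ (by omega) (by omega) (by omega), hE1.r104]
  · intro i
    rw [hr2 _ (by omega) (by omega) (by omega), hx1]
  · rintro s3 t3 ⟨ht3, hm3, hr3, -, hb⟩
    rw [wp_block_nil]
    refine ⟨by omega, ?_, hb⟩
    exact hE1.of_eq (fun k hk _ => by
      rw [hr3 k (by omega) (by omega), hr2 k (by omega) (by omega) (by omega)])
      (fun a _ => by rw [hm3, hm2])

theorem wp_translate {B n : ℕ} {m : ℕ → ℤ} {w : Sym2 (Fin n) → ℕ} {g : ℕ → Fin n}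
    (hI : IsInput m w g) (hper : ∀ i, g (i + n) = g i) (hn : 3 ≤ n) (hB : n + 3 ≤ B) {pos : ℕ → ℕ} :
    ∀ (l : List ℕ) (s : State), (∀ k ∈ l, 110 ≤ k ∧ s.reg k = pos k ∧ pos k ≤ n + 2) → l.Nodup →
    s.reg 101 = n + 1 → s.reg 104 = 1 → (∀ a ≤ n, s.mem a = m a) →
    WP B (block (l.map fun k => vtxCode k k)) s fun s' t => t ≤ 5 * l.length + 1 ∧ s'.mem = s.mem ∧
      (∀ k, k ≠ 26 → k ∉ l → s'.reg k = s.reg k) ∧ ∀ k ∈ l, s'.reg k = (g (pos k - 1) : ℕ)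
  | [], s, _, _, _, _, _ => by
    rw [List.map_nil, wp_block_nil]
    simp
  | k :: l, s, hl, hnd, h101, h104, hm => by
    rw [List.map_cons, wp_block_cons]
    rw [List.nodup_cons] at hnd
    obtain ⟨hk, hpos, hposn⟩ := hl k List.mem_cons_self
    refine (wp_vtxCode hI hper hn hB h101 h104 hm hpos hposn (by omega)).mono ?_
    rintro s1 t1 ⟨ht1, hm1, hv1, hr1⟩
    refine (wp_translate (pos := pos) hI hper hn hB l s1 (fun k' hk' => ?_) hnd.2
      (by rw [hr1 _ (by omega) (by omega), h101]) (by rw [hr1 _ (by omega) (by omega), h104])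
      (by rwa [hm1])).mono ?_
    · have h := hl k' (List.mem_cons_of_mem _ hk')
      rw [hr1 k' (by omega) (fun h => hnd.1 (h ▸ hk'))]
      exact h
    · rintro s2 t2 ⟨ht2, hm2, hr2, hv2⟩
      refine ⟨by rw [List.length_cons]; omega, by rw [hm2, hm1], fun k' h1 h2 => ?_, fun k' hk' => ?_⟩
      · rw [List.mem_cons, not_or] at h2
        rw [hr2 k' h1 h2.2, hr1 k' h1 h2.1]
      · rcases List.mem_cons.1 hk' with rfl | hk'
        · rw [hr2 _ (by omega) hnd.1, hv1]
        · exact hv2 k' hk'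

theorem wp_stores {B : ℕ} : ∀ (l : List ℕ) (s : State), (∀ k ∈ l, 110 ≤ k ∧ k ≤ B) → l.Nodup →
    WP B (block (l.map fun k => .seq (.const 23 ((k - 109 : ℕ) : ℤ)) (.store 23 k))) s fun s' t =>
      t ≤ 2 * l.length + 1 ∧ (∀ k, k ≠ 23 → s'.reg k = s.reg k) ∧
      (∀ a, (∀ k ∈ l, a ≠ k - 109) → s'.mem a = s.mem a) ∧ ∀ k ∈ l, s'.mem (k - 109) = s.reg k
  | [], s, _, _ => by
    rw [List.map_nil, wp_block_nil]
    simp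
  | k :: l, s, hl, hnd => by
    rw [List.map_cons, wp_block_cons]
    rw [List.nodup_cons] at hnd
    obtain ⟨hk, hkB⟩ := hl k List.mem_cons_self
    simp only [wp_seq, wp_const, wp_store, State.reg_setReg, if_true, Int.toNat_natCast]
    rw [if_neg (by omega)]
    refine ⟨by rw [_root_.abs_le]; omega, by positivity, ?_⟩
    refine (wp_stores l _ (fun k' hk' => hl k' (List.mem_cons_of_mem _ hk')) hnd.2).mono ?_
    rintro s1 t1 ⟨ht1, hr1, hm1, hv1⟩
    refine ⟨by rw [List.length_cons]; omega, fun k' h => ?_, fun a ha => ?_, fun k' hk' => ?_⟩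
    · rw [hr1 k' h, State.reg_setMem, State.reg_setReg, if_neg h]
    · rw [List.forall_mem_cons] at ha
      rw [hm1 a ha.2, State.mem_setMem, if_neg ha.1, State.mem_setReg]
    · rcases List.mem_cons.1 hk' with rfl | hk'
      · rw [hm1, State.mem_setMem, if_pos rfl]
        intro k'' hk'' h
        have := hl k'' (List.mem_cons_of_mem _ hk'')
        obtain rfl : k' = k'' := by omega
        exact hnd.1 hk''
      · have := hl k' (List.mem_cons_of_mem _ hk')
        rw [hv1 k' hk', State.reg_setMem, State.reg_setReg, if_neg (by omega)]

/-- Write the best move to the memory. -/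
def outputCode : Cmd :=
  block [block ((List.range' 110 20).map fun k => vtxCode k k),
    block ((List.range' 110 20).map fun k => .seq (.const 23 ((k - 109 : ℕ) : ℤ)) (.store 23 k)),
    .store 100 104]

theorem wp_outputCode {B n : ℕ} {m : ℕ → ℤ} {w : Sym2 (Fin n) → ℕ} {g : ℕ → Fin n}
    (hI : IsInput m w g) (hper : ∀ i, g (i + n) = g i) (hn : 3 ≤ n) (hB : n + 200 ≤ B) {s : State}
    {f : ℕ → ℕ → ℕ} (h100 : s.reg 100 = 0) (h101 : s.reg 101 = n + 1) (h104 : s.reg 104 = 1)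
    (hm : ∀ a ≤ n, s.mem a = m a) (hb : BestInv n f s) :
    WP B outputCode s fun s' t => t ≤ 150 ∧ ∃ (p : Pattern) (x : Fin 5 → ℕ), Valid n x ∧
      s.reg 105 = gainAt f p.added x ∧ ShowsMove 5 s'.mem (removedEdges g x) (addedEdges g x p) := by
  obtain ⟨p, x, hx, hg, ho⟩ := hb
  have hpos : ∀ k ∈ List.range' 110 20, ∃ u : ℕ, s.reg k = u ∧ u ≤ n + 2 := by
    intro k hk
    rw [← map_fst_outPts p.added, List.mem_map] at hk
    obtain ⟨a, ha, rfl⟩ := hk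
    exact ⟨_, ho a ha, ptPos_le hx.le _⟩
  have hpos' : ∀ k ∈ List.range' 110 20, 110 ≤ k ∧ s.reg k = ((s.reg k).toNat : ℕ) ∧
      (s.reg k).toNat ≤ n + 2 := by
    intro k hk
    obtain ⟨u, h1, h2⟩ := hpos k hk
    rw [List.mem_range'_1] at hk
    rw [h1]
    exact ⟨hk.1, by simp, by simpa using h2⟩
  rw [outputCode, wp_block_cons]
  -- All positions are turned into vertices before anything is stored, since the output overwrites
  -- the cells that hold the tour.
  refine (wp_translate hI hper hn (by omega) _ s hpos' List.nodup_range' h101 h104 hm).mono ?_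
  rintro s1 t1 ⟨ht1, hm1, hr1, hv1⟩
  rw [wp_block_cons]
  refine (wp_stores _ s1 (fun k hk => ?_) List.nodup_range').mono ?_
  · rw [List.mem_range'_1] at hk
    omega
  rintro s2 t2 ⟨ht2, hr2, hm2, hv2⟩
  have h100' : s2.reg 100 = 0 := by
    rw [hr2 _ (by omega), hr1 _ (by omega) (by rw [List.mem_range'_1]; omega), h100]
  have h104' : s2.reg 104 = 1 := by
    rw [hr2 _ (by omega), hr1 _ (by omega) (by rw [List.mem_range'_1]; omega), h104]
  rw [List.length_range'] at ht1 ht2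
  simp only [wp_block_cons, wp_store, wp_block_nil, h100', h104', Int.toNat_zero]
  refine ⟨le_refl _, by omega, p, x, hx, hg, by simp, ?_⟩
  have hcell : ∀ a ∈ outPts p.added, (s2.setMem 0 1).mem (a.1 - 109) = (g (ptPos x a.2 - 1) : ℕ) := by
    intro a ha
    have h := mem_outPts ha
    have hk : a.1 ∈ List.range' 110 20 := by rw [List.mem_range'_1]; omega
    rw [State.mem_setMem, if_neg (by omega), hv2 _ hk, hv1 _ hk, ho a ha, Int.toNat_natCast]
  have hmemj : ∀ (j : Fin 5), (110 + 4 * (j : ℕ), (j, false)) ∈ outPts p.added ∧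
      (111 + 4 * (j : ℕ), (j, true)) ∈ outPts p.added ∧
      (112 + 4 * (j : ℕ), (p.added j).1) ∈ outPts p.added ∧
      (113 + 4 * (j : ℕ), (p.added j).2) ∈ outPts p.added := by
    intro j
    simp only [outPts, List.mem_flatMap]
    exact ⟨⟨j, List.mem_finRange j, by simp⟩, ⟨j, List.mem_finRange j, by simp⟩,
      ⟨j, List.mem_finRange j, by simp⟩, ⟨j, List.mem_finRange j, by simp⟩⟩
  refine ⟨fun j => g (x j - 1), fun j => g (x j), fun j => g (ptPos x (p.added j).1 - 1),
    fun j => g (ptPos x (p.added j).2 - 1), fun j => ?_, rfl, rfl⟩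
  obtain ⟨h1, h2, h3, h4⟩ := hmemj j
  have c1 := hcell _ h1
  have c2 := hcell _ h2
  have c3 := hcell _ h3
  have c4 := hcell _ h4
  dsimp only at c1 c2 c3 c4
  rw [show 110 + 4 * (j : ℕ) - 109 = 4 * j + 1 by omega] at c1
  rw [show 111 + 4 * (j : ℕ) - 109 = 4 * j + 2 by omega] at c2
  rw [show 112 + 4 * (j : ℕ) - 109 = 4 * j + 3 by omega] at c3
  rw [show 113 + 4 * (j : ℕ) - 109 = 4 * j + 4 by omega] at c4
  exact ⟨by simpa [ptPos] using c1, by simpa [ptPos] using c2, c3, c4⟩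

/-! ## The program -/

/-- Find an optimal move of five edges; there are at least five vertices. -/
noncomputable def mainCode : Cmd :=
  block [prepCode, initCode, block ((Finset.univ : Finset Pattern).toList.map processCode), outputCode]

/-- The time constant of `mainCode`. -/
noncomputable def mainConst : ℕ := (Finset.univ : Finset Pattern).toList.length * 600 + 1000

theorem main_time_le {L N t₁ t₂ t₃ t₄ : ℕ} (hN : 8 ≤ N) (h₁ : t₁ ≤ N * (N * 23 + 6) + 3) (h₂ : t₂ ≤ 151)
    (h₃ : t₃ ≤ L * (600 * N ^ 3) + 1) (h₄ : t₄ ≤ 150) :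
    t₁ + (t₂ + (t₃ + (t₄ + 1))) ≤ (L * 600 + 1000) * N ^ 3 := by
  have h5 : 8 ^ 3 ≤ N ^ 3 := Nat.pow_le_pow_left hN 3
  have h6 : N * N ≤ N ^ 3 := by
    rw [← pow_two]
    exact Nat.pow_le_pow_right (by omega) (by omega)
  have h7 : N ≤ N ^ 3 := Nat.le_self_pow (by omega) _
  have h8 : N * (N * 23 + 6) + 3 = 23 * (N * N) + 6 * N + 3 := by ring
  rw [add_mul, mul_assoc]
  omega

theorem wp_mainCode {B n W : ℕ} {m : ℕ → ℤ} {w : Sym2 (Fin n) → ℕ} {g : ℕ → Fin n}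
    (hI : IsInput m w g) (hper : ∀ i, g (i + n) = g i) (hn : 5 ≤ n) (hw : ∀ e, w e ≤ W)
    (hB : 100 * ((n + 3) ^ 3 + W) ≤ B) {s : State} (h100 : s.reg 100 = 0) (h101 : s.reg 101 = n + 1)
    (h102 : s.reg 102 = n + 3) (h103 : s.reg 103 = n + 2) (h104 : s.reg 104 = 1)
    (h106 : s.reg 106 = 2 * (n + 3)) (hm : s.mem = m) :
    WP B mainCode s fun s' t => t ≤ mainConst * (n + 3) ^ 3 ∧ ∃ (p : Pattern) (x : Fin 5 → ℕ),
      Valid n x ∧ ShowsMove 5 s'.mem (removedEdges g x) (addedEdges g x p) ∧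
      ∀ (q : Pattern) (y : Fin 5 → ℕ), Valid n y →
        gainAt (fun u v => w s(g (u - 1), g (v - 1))) q.added y ≤
          gainAt (fun u v => w s(g (u - 1), g (v - 1))) p.added x := by
  have hn3 : n + 3 ≤ (n + 3) ^ 3 := Nat.le_self_pow (by decide) _
  rw [mainCode, wp_block_cons]
  refine (wp_prepCode hI hper (by omega) (by omega) h101 h102 h104 hm).mono ?_
  rintro s1 t1 ⟨ht1, hr1, hm1, hw1⟩
  have hC : Ctx B n W s1.mem fun u v => w s(g (u - 1), g (v - 1)) :=
    ⟨by omega, hB, fun _ _ => hw _, hw1⟩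
  have hE1 : Env n s1.mem s1 := ⟨by rw [hr1 _ (by omega), h100], by rw [hr1 _ (by omega), h101],
    by rw [hr1 _ (by omega), h102], by rw [hr1 _ (by omega), h103], by rw [hr1 _ (by omega), h104],
    by rw [hr1 _ (by omega), h106], fun _ _ => rfl⟩
  rw [wp_block_cons]
  refine (wp_initCode hC hn hE1).mono ?_
  rintro s2 t2 ⟨ht2, hE2, hb2⟩
  rw [wp_block_cons]
  refine (wp_processAll hC _ s2 hE2 hb2).mono ?_
  rintro s3 t3 ⟨ht3, hE3, hb3, -, hg3⟩
  rw [wp_block_cons]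
  have hsq : n < (n + 3) * (n + 3) := by
    have : (n + 3) * 1 ≤ (n + 3) * (n + 3) := Nat.mul_le_mul_left _ (by omega)
    omega
  refine (wp_outputCode hI hper (by omega) (by omega) hE3.r100 hE3.r101 hE3.r104
    (fun a ha => by rw [hE3.mem a (by omega), hm1 a (by omega)]) hb3).mono ?_
  rintro s4 t4 ⟨ht4, p, x, hx, hg, hs⟩
  rw [wp_block_nil]
  exact ⟨main_time_le (by omega) ht1 ht2 ht3 ht4, p, x, hx, hs, fun q y hy => hg ▸ hg3 q (by simp) y hy⟩

/-- The program for the optimization problem. -/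
noncomputable def solver : Cmd :=
  block [.load 101 100, .const 104 1, .arith .add 101 101 104, .arith .add 103 101 104,
    .arith .add 102 103 104, .arith .add 106 102 102, .const 26 5, .arith .sub 26 101 26,
    .ifPos 26 mainCode (.store 100 100)]

/-- All registers start with 0, so register 100 serves as the address of `n` and as the constant 0.
The final test is on `(n + 1) - 5`, which is positive exactly when `n ≥ 5`. -/
theorem wp_solver {B n W : ℕ} {m : ℕ → ℤ} {w : Sym2 (Fin n) → ℕ} {g : ℕ → Fin n}
    (hI : IsInput m w g) (hper : ∀ i, g (i + n) = g i) (hw : ∀ e, w e ≤ W)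
    (hB : 100 * ((n + 3) ^ 3 + W) ≤ B) :
    WP B solver ⟨fun _ => 0, m⟩ fun s' t => t ≤ (mainConst + 20) * (n + 3) ^ 3 ∧
      ((n < 5 ∧ s'.mem 0 = 0) ∨ ∃ (p : Pattern) (x : Fin 5 → ℕ),
      Valid n x ∧ ShowsMove 5 s'.mem (removedEdges g x) (addedEdges g x p) ∧
      ∀ (q : Pattern) (y : Fin 5 → ℕ), Valid n y →
        gainAt (fun u v => w s(g (u - 1), g (v - 1))) q.added y ≤
          gainAt (fun u v => w s(g (u - 1), g (v - 1))) p.added x) := by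
  have hn3 : n + 3 ≤ (n + 3) ^ 3 := Nat.le_self_pow (by omega) _
  have h0 := hI.zero
  simp only [solver, wp_block_cons, wp_block_nil, wp_load, wp_const, wp_arith, Op.eval, State.reg_setReg,
    State.mem_setReg, wp_ifPos, wp_store, if_true, if_false, Nat.reduceEqDiff, Int.toNat_zero, h0, le_refl,
    true_and, State.mem_setMem]
  refine ⟨by simp; omega, by rw [_root_.abs_le]; omega, by rw [_root_.abs_le]; omega,
    by rw [_root_.abs_le]; omega, by rw [_root_.abs_le]; omega, by rw [_root_.abs_le]; omega,
    by rw [_root_.abs_le]; omega, fun hpos => ?_, fun hneg => ?_⟩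
  · refine (wp_mainCode hI hper (by omega) hw hB ?_ ?_ ?_ ?_ ?_ ?_ rfl).mono ?_
    · simp
    · simp
    · simp; ring
    · simp; ring
    · simp
    · simp; ring
    · rintro s' t ⟨ht, h⟩
      refine ⟨?_, Or.inr h⟩
      rw [add_mul]
      omega
  · refine ⟨?_, Or.inl ⟨by omega, trivial⟩⟩
    rw [add_mul]
    omega

/-! ## The tour as a cyclic enumeration -/

section Tour

variable {n : ℕ} {a : Fin n} {H : (⊤ : SimpleGraph (Fin n)).Walk a a}

theorem length_of_isHamiltonianCycle (hH : H.IsHamiltonianCycle) : H.length = n := by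
  rw [hH.length_eq, Fintype.card_fin]

theorem getVert_mod (hl : H.length = n) (i : ℕ) (hi : i ≤ n) : H.getVert (i % n) = H.getVert i := by
  rcases hi.lt_or_eq with h | rfl
  · rw [Nat.mod_eq_of_lt h]
  · rw [Nat.mod_self, SimpleGraph.Walk.getVert_zero, SimpleGraph.Walk.getVert_of_length_le _ hl.le]

theorem isCyclicEnum_getVert (hH : H.IsHamiltonianCycle) : IsCyclicEnum (fun i => H.getVert (i % n)) n := by
  have hl := length_of_isHamiltonianCycle hH
  have h3 : 3 ≤ n := hl ▸ hH.isCycle.three_le_length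
  refine ⟨h3, fun i => by simp, ?_, ?_⟩
  · intro i hi j hj h
    rw [Nat.mod_eq_of_lt hi, Nat.mod_eq_of_lt hj] at h
    exact hH.isCycle.getVert_injOn' (show i ≤ H.length - 1 by omega)
      (show j ≤ H.length - 1 by omega) h
  · intro v
    obtain ⟨i, hv, hi⟩ := SimpleGraph.Walk.mem_support_iff_exists_getVert.1 (hH.mem_support v)
    exact ⟨i % n, Nat.mod_lt _ (by omega), by
      rw [Nat.mod_mod, getVert_mod hl i (by omega), hv]⟩

theorem edges_eq_enumEdges (hH : H.IsHamiltonianCycle) :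
    H.edges.toFinset = enumEdges (fun i => H.getVert (i % n)) n := by
  have hl := length_of_isHamiltonianCycle hH
  ext e
  simp only [List.mem_toFinset, enumEdges, Finset.mem_image, Finset.mem_range, List.mem_iff_getElem,
    SimpleGraph.Walk.length_edges, hl]
  have key : ∀ i (hi : i < H.edges.length),
      H.edges[i] = s(H.getVert (i % n), H.getVert ((i + 1) % n)) := by
    intro i hi
    have hi' : i < n := by rw [SimpleGraph.Walk.length_edges, hl] at hi; exact hi
    rw [getVert_mod hl i hi'.le, getVert_mod hl (i + 1) hi', SimpleGraph.Walk.getElem_edges]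
  constructor
  · rintro ⟨i, hi, rfl⟩
    exact ⟨i, hi, (key i _).symm⟩
  · rintro ⟨i, hi, rfl⟩
    exact ⟨i, hi, key i _⟩

theorem isInput_inputMem (w : Sym2 (Fin n) → ℕ) :
    IsInput (inputMem w H) w fun i => H.getVert (i % n) := by
  refine ⟨by simp [inputMem], fun i hi => ?_, fun a b => ?_⟩
  · rw [inputMem, if_neg (by omega), if_pos (by omega), Nat.add_sub_cancel, Nat.mod_eq_of_lt hi]
  · have hab : (a : ℕ) * n + b < n * n := by
      have : ((a : ℕ) + 1) * n ≤ n * n := Nat.mul_le_mul_right _ a.isLt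
      have := b.isLt
      rw [Nat.succ_mul] at *
      omega
    have hsub : n + 1 + ((a : ℕ) * n + b) - (n + 1) = a * n + b := by omega
    rw [inputMem, if_neg (by omega), if_neg (by omega), dif_pos (by omega)]
    congr 3
    · apply Fin.ext
      simp only [Fin.coe_divNat, hsub]
      rw [mul_comm, Nat.mul_add_div (by have := a.isLt; omega), Nat.div_eq_of_lt b.isLt, add_zero]
    · apply Fin.ext
      simp only [Fin.coe_modNat, hsub]
      rw [mul_comm, Nat.mul_add_mod, Nat.mod_eq_of_lt b.isLt]

end Tour

/-! ### Word size, running time and conclusion -/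

theorem word_bound {n W : ℕ} (hn : 3 ≤ n) : 100 * ((n + 3) ^ 3 + W) ≤ (n + W) ^ 10 := by
  have h1 : (n + 3) ^ 3 ≤ (2 * (n + W)) ^ 3 := Nat.pow_le_pow_left (by omega) _
  -- Since `n + 3 ≤ 2 * (n + W)`, the left side is at most 100 · (8 + 1) = 900 times `(n + W) ^ 3`.
  -- The factor 900 is below 3^7 = 2187, hence the exponent 7 + 3.
  have h2 : n + W ≤ (n + W) ^ 3 := Nat.le_self_pow (by omega) _
  have h3 : 3 ^ 7 ≤ (n + W) ^ 7 := Nat.pow_le_pow_left (by omega) _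
  have h4 : 3 ^ 7 * (n + W) ^ 3 ≤ (n + W) ^ 7 * (n + W) ^ 3 := Nat.mul_le_mul_right _ h3
  rw [mul_pow] at h1
  rw [← pow_add, show 7 + 3 = 10 from rfl] at h4
  omega

theorem time_bound {n K t : ℕ} (hn : 3 ≤ n) (ht : t ≤ K * (n + 3) ^ 3) :
    -- The factor 8 comes from `n + 3 ≤ 2 * n`; the cubic bound is then relaxed to the exponent 3.4,
    -- as `n ≥ 1`.
    (t : ℝ) ≤ (8 * K : ℕ) * (n : ℝ) ^ (3.4 : ℝ) := by
  have h1 : (n + 3) ^ 3 ≤ (2 * n) ^ 3 := Nat.pow_le_pow_left (by omega) _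
  have h2 : t ≤ 8 * K * n ^ 3 := by
    refine ht.trans ((Nat.mul_le_mul_left _ h1).trans_eq ?_)
    ring
  have h3 : (n : ℝ) ^ 3 ≤ (n : ℝ) ^ (3.4 : ℝ) := by
    rw [← Real.rpow_natCast]
    exact Real.rpow_le_rpow_of_exponent_le (by exact_mod_cast (by omega : 1 ≤ n)) (by norm_num)
  calc (t : ℝ) ≤ ((8 * K * n ^ 3 : ℕ) : ℝ) := by exact_mod_cast h2
    _ = (8 * K : ℕ) * (n : ℝ) ^ 3 := by push_cast; ring
    _ ≤ _ := mul_le_mul_of_nonneg_left h3 (by positivity)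

end KOpt

open KOpt in
theorem mainTheorem3 :
    KOpt.KOptOptimizationInTime 5 (fun n => (n : ℝ) ^ (3.4 : ℝ)) := by
  refine ⟨solver, 10, (8 * (mainConst + 20) : ℕ), fun n W w a H hH hw => ?_⟩
  have hg := isCyclicEnum_getVert hH
  have hn := hg.three_le
  obtain ⟨s, t, he, ht, h⟩ := wp_solver (isInput_inputMem (H := H) w) hg.periodic hw (word_bound hn)
  refine ⟨s, t, he, time_bound hn ht, ?_⟩
  rw [edges_eq_enumEdges hH]
  rcases h with ⟨h5, h0⟩ | ⟨p, x, hx, hs, hopt⟩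
  -- With fewer than five vertices the tour has fewer than five edges to remove.
  · refine Or.inr ⟨h0, ?_⟩
    rintro ⟨Em, Ep, hm⟩
    have h1 := Finset.card_le_card hm.removed_subset
    have h2 : (enumEdges (fun i => H.getVert (i % n)) n).card ≤ n :=
      Finset.card_image_le.trans (by simp)
    have := hm.card_removed
    omega
  · refine Or.inl ⟨_, _, hs, isKMove_of_pattern hg hx p, fun Em Ep hm => ?_⟩
    -- Any competing move is rewritten as a pattern at valid positions, where the optimality
    -- established for the program applies.
    obtain ⟨y, hy, rfl⟩ := exists_positions hg hm.removed_subset hm.card_removed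
    obtain ⟨q, rfl⟩ := hm.exists_pattern hg hy
    rw [gain_eq_gainAt hg hx p w, gain_eq_gainAt hg hy q w]
    exact hopt q y hy
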